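/- Let $p$ be a prime, $q=p^e$ with $e\ge 1$, and let $\mathbf k$ be a field containing $\mathbf F_{q^2}$. For a $\mathbf k$-algebra $R$ and an $R$-module $M$, a $q$-bic form on $M$ is a biadditive pairing $\beta\colon M\times M\to R$ which is $R$-linear in the second variable and $q$-linear in the first, i.e. $\beta(cm,n)=c^q\beta(m,n)$; equivalently, an $R$-linear map $M^{[1]}\otimes_R M\to R$ where $M^{[1]}$ is the $q$-Frobenius twist of $M$. Let $V$ be a finite-dimensional $\mathbf k$-vector space. *Invariants.* For a $q$-bic form $\beta$ on $V$ put $\mathrm P_{-1}V=0$ and $\mathrm P_iV=\{v\in V:\beta(w,v)=0\text{ for all }w\in\mathrm P_{i-1}V\}$ for $i\ge 0$. For $m\ge 1$ and $\epsilon=(-1)^m$ let $$a_m=\dim_{\mathbf k}\mathrm P_{m-\epsilon-1}V/\mathrm P_{m+\epsilon-1}V,\qquad b_m=a_m-a_{m+1}.$$ For $m\ge1$ let $\Theta_m(\beta)=\sum_{k=1}^m b_{2k-1}$, $$\Phi_{2k-1}(\beta)=\dim_{\mathbf k}V+b_{2k-1}+2\sum_{\ell=1}^{k-1}(k-\ell)b_{2\ell-1},\qquad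 \Phi_{2k}(\beta)=\sum_{\ell=1}^{k-1}2\ell b_{2\ell}+2k\Big(\sum_{\ell\ge1}b_{2\ell-1}+\sum_{\ell\ge k}b_{2\ell}\Big),$$ $$\Psi_{2k-1}(\beta)=b_{2k-1}+2\sum_{\ell=1}^{k-1}(k-\ell)b_{2\ell-1},\qquad \Psi_{2k}(\beta)=\sum_{\ell=1}^{k-1}\ell b_{2\ell}+k\Big(\sum_{\ell\ge1}b_{2\ell-1}+\sum_{\ell\ge k}b_{2\ell}\Big).$$ *Specialization.* For $q$-bic forms $\beta,\beta'$ on $V$, say that $\beta$ specializes to $\beta'$ if there exist a discrete valuation ring $R$ over $\mathbf k$ with fraction field $K$ and residue field $\kappa$, and a $q$-bic form $\gamma$ on a finite free $R$-module $M$, such that $(V_K,\beta_K)\cong(M_K,\gamma_K)$ and $(V_\kappa,\beta'_\kappa)\cong(M_\kappa,\gamma_\kappa)$ as $q$-bic forms over $K$ and $\kappa$, respectively. The parameter space of $q$-bic forms on $V$ is the affine space $\operatorname{Spec}\operatorname{Sym}^*(V^{[1]}\otimes_{\mathbf k}V)$, identified by Gram matrices in a basis of $V$ with the affine space of square matrices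 of size $\dim_{\mathbf k} V$; the orbit of $\beta$ is the image of the orbit map $\mathbf{GL}_V\to\operatorname{Spec}\operatorname{Sym}^*(V^{[1]}\otimes_{\mathbf k}V)$, $g\mapsto g\cdot\beta$. **Proposition.** Let $\beta$ and $\beta'$ be $q$-bic forms on $V$. Then $\Phi_m(\beta)\le\Phi_m(\beta')$ for all $m\ge1$ if and only if $\Psi_m(\beta)\le\Psi_m(\beta')$ for all $m\ge1$. If these inequalities hold and $\Theta_m(\beta)\le\Theta_m(\beta')$ for all $m\ge1$, then $\beta$ specializes to $\beta'$, and the Zariski closure of the orbit of $\beta$ contains the point $[\beta']$. -/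

import Mathlib

open scoped TensorProduct

universe u v

/-- A `q`-bic form on the `R`-module `M`: an `R`-linear map `M^{[1]} ⊗ M → R`, where `M^{[1]}` is
the Frobenius twist of `M` by `x ↦ x ^ q`. Since `m ↦ m^{[1]}` is the universal `q`-linear map out
of `M`, this is a biadditive pairing on `M` which is `q`-linear in the first variable and linear in
the second; `β m n` stands for `β(m^{[1]}, n)`. -/
structure QBicForm (q : ℕ) (R : Type*) (M : Type*) [CommRing R] [AddCommGroup M] [Module R M] where
  toFun : M → M →ₗ[R] R
  map_add' : ∀ m n : M, toFun (m + n) = toFun m + toFun n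
  map_smul' : ∀ (c : R) (m : M), toFun (c • m) = c ^ q • toFun m

namespace QBicForm

section General

variable {q : ℕ} {R : Type*} [CommRing R]
  {M : Type*} [AddCommGroup M] [Module R M] {N : Type*} [AddCommGroup N] [Module R N]

instance : CoeFun (QBicForm q R M) (fun _ => M → M →ₗ[R] R) := ⟨QBicForm.toFun⟩

/-- Two `q`-bic forms are isomorphic if some linear isomorphism carries one to the other. -/
def Isomorphic (β : QBicForm q R M) (γ : QBicForm q R N) : Prop :=
  ∃ φ : M ≃ₗ[R] N, ∀ m n : M, γ (φ m) (φ n) = β m n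

/-- The Gram matrix `(β(e_i^{[1]}, e_j))_{i,j}` of a form with respect to a basis. -/
noncomputable def gram {ι : Type*} (β : QBicForm q R M) (b : Module.Basis ι R M) : Matrix ι ι R :=
  Matrix.of fun i j => β (b i) (b j)

/-- The right orthogonal `(N^{[1]})^⊥` in `M` of the Frobenius twist of a submodule `N` of `M`;
as `N^{[1]}` is generated by the elements `w^{[1]}` with `w ∈ N`, it suffices to test on these. -/
def rightOrtho (β : QBicForm q R M) (N : Submodule R M) : Submodule R M where
  carrier := {v | ∀ w ∈ N, β w v = 0}
  add_mem' := by
    intro a b ha hb w hw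
    rw [map_add, ha w hw, hb w hw, add_zero]
  zero_mem' := fun w _ => map_zero _
  smul_mem' := by
    intro c a ha w hw
    rw [map_smul, ha w hw, smul_zero]

/-- The `⊥`-filtration `P_i`, which is indexed from `i = -1`: `perpFil β j` is `P_{j-1}`, so
`perpFil β 0 = P_{-1} = 0` and `P_i = (P_{i-1}^{[1]})^⊥` for `i ≥ 0`. -/
def perpFil (β : QBicForm q R M) : ℕ → Submodule R M
  | 0 => ⊥
  | j + 1 => β.rightOrtho (perpFil β j)

end General

section BaseChange

variable {p : ℕ} [Fact p.Prime] {e : ℕ} {R : Type*} [CommRing R] [CharP R p]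
  {M : Type*} [AddCommGroup M] [Module R M]

theorem add_pow_of_algebra (p : ℕ) [Fact p.Prime] (e : ℕ) (R : Type*) [CommRing R] [CharP R p]
    {S : Type*} [CommRing S] [Algebra R S] (a b : S) :
    (a + b) ^ p ^ e = a ^ p ^ e + b ^ p ^ e := by
  rcases subsingleton_or_nontrivial S with h | h
  · exact Subsingleton.elim _ _
  · have hS : CharP S p := by
      refine (CharP.charP_iff_prime_eq_zero Fact.out).2 ?_
      have h0 : algebraMap R S (p : R) = 0 := by rw [CharP.cast_eq_zero, map_zero]
      rwa [map_natCast] at h0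
    exact add_pow_char_pow a b p e

/-- The additive map `S ⊗ M → Hom_S(S ⊗ M, S)` given by
`s ⊗ m ↦ (t ⊗ n ↦ s ^ q * t * β(m, n))`, where `q = p ^ e`. -/
noncomputable def baseChangeAux (S : Type*) [CommRing S] [Algebra R S]
    (β : QBicForm (p ^ e) R M) : S ⊗[R] M →+ (S ⊗[R] M →ₗ[S] S) :=
  TensorProduct.liftAddHom
    { toFun := fun s =>
        { toFun := fun m =>
            s ^ p ^ e • ((TensorProduct.AlgebraTensorModule.rid R S S).toLinearMap ∘ₗ
              (β m).baseChange S)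
          map_zero' := by
            have h : β.toFun 0 = 0 := by simpa using β.map_add' 0 0
            rw [h, LinearMap.baseChange_zero, LinearMap.comp_zero, smul_zero]
          map_add' := fun m n => by
            rw [β.map_add', LinearMap.baseChange_add, LinearMap.comp_add, smul_add] }
      map_zero' := by
        ext m : 1
        have hp : p ^ e ≠ 0 := pow_ne_zero _ (Fact.out : p.Prime).ne_zero
        simp only [AddMonoidHom.coe_mk, ZeroHom.coe_mk, AddMonoidHom.zero_apply]
        rw [zero_pow hp, zero_smul]
      map_add' := fun s t => by
        ext m : 1
        simp only [AddMonoidHom.coe_mk, ZeroHom.coe_mk, AddMonoidHom.add_apply]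
        rw [add_pow_of_algebra p e R, add_smul] }
    (fun r s m => by
      simp only [AddMonoidHom.coe_mk, ZeroHom.coe_mk]
      rw [β.map_smul', LinearMap.baseChange_smul, LinearMap.comp_smul, Algebra.smul_def, mul_pow,
        ← map_pow, mul_smul, algebraMap_smul, smul_comm])

theorem baseChangeAux_tmul (S : Type*) [CommRing S] [Algebra R S]
    (β : QBicForm (p ^ e) R M) (s : S) (m : M) (t : S) (n : M) :
    baseChangeAux S β (s ⊗ₜ m) (t ⊗ₜ n) = s ^ p ^ e * (t * algebraMap R S (β m n)) := by
  simp [baseChangeAux, TensorProduct.liftAddHom_tmul, Algebra.smul_def, mul_comm]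

/-- The extension of scalars of a `q`-bic form along `R → S`, where `q = p ^ e` is a power of the
prime characteristic `p` of `R`. -/
noncomputable def baseChange (S : Type*) [CommRing S] [Algebra R S]
    (β : QBicForm (p ^ e) R M) : QBicForm (p ^ e) S (S ⊗[R] M) where
  toFun := baseChangeAux S β
  map_add' := map_add _
  map_smul' := by
    intro c x
    induction x with
    | zero => simp
    | add x y hx hy => rw [smul_add, map_add, map_add, hx, hy, smul_add]
    | tmul s m =>
      refine LinearMap.ext fun y => ?_
      induction y with
      | zero => simp
      | add x y hx hy => rw [map_add, map_add, hx, hy]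
      | tmul t n =>
        rw [TensorProduct.smul_tmul', LinearMap.smul_apply, baseChangeAux_tmul,
          baseChangeAux_tmul, smul_eq_mul, smul_eq_mul, mul_pow, mul_assoc]

theorem baseChange_tmul (S : Type*) [CommRing S] [Algebra R S]
    (β : QBicForm (p ^ e) R M) (s : S) (m : M) (t : S) (n : M) :
    β.baseChange S (s ⊗ₜ m) (t ⊗ₜ n) = s ^ p ^ e * (t * algebraMap R S (β m n)) :=
  baseChangeAux_tmul S β s m t n

end BaseChange

section Invariants

variable {q : ℕ} {k : Type*} [Field k] {V : Type*} [AddCommGroup V] [Module k V]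

/-- For `m ≥ 1` and `ε = (-1)^m`, the dimension `a_m` of `P_{m-ε-1} V / P_{m+ε-1} V`: this is
`P_m / P_{m-2}` for odd `m` and `P_{m-2} / P_m` for even `m` (recall `perpFil β j = P_{j-1}`). -/
noncomputable def aInv (β : QBicForm q k V) (m : ℕ) : ℕ :=
  if Even m then
    Module.finrank k
      (β.perpFil (m - 1) ⧸ (β.perpFil (m + 1)).submoduleOf (β.perpFil (m - 1)))
  else
    Module.finrank k
      (β.perpFil (m + 1) ⧸ (β.perpFil (m - 1)).submoduleOf (β.perpFil (m + 1)))

/-- `b_m = a_m - a_{m+1}` for `m ≥ 1`, the multiplicities in the type `(a; b_m)_{m ≥ 1}`. -/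
noncomputable def bInv (β : QBicForm q k V) (m : ℕ) : ℤ :=
  (β.aInv m : ℤ) - β.aInv (m + 1)

/-- `Θ_m(β) = ∑_{k=1}^m b_{2k-1}`. -/
noncomputable def Theta (β : QBicForm q k V) (m : ℕ) : ℤ :=
  ∑ k ∈ Finset.Icc 1 m, β.bInv (2 * k - 1)

/-- `Φ_m(β)` for `m = 2r - 1`. -/
noncomputable def PhiOdd (β : QBicForm q k V) (r : ℕ) : ℤ :=
  (Module.finrank k V : ℤ) + β.bInv (2 * r - 1)
    + 2 * ∑ l ∈ Finset.Icc 1 (r - 1), ((r : ℤ) - l) * β.bInv (2 * l - 1)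

/-- `Φ_m(β)` for `m = 2r`; the unbounded sums have only finitely many nonzero terms. -/
noncomputable def PhiEven (β : QBicForm q k V) (r : ℕ) : ℤ :=
  (∑ l ∈ Finset.Icc 1 (r - 1), 2 * (l : ℤ) * β.bInv (2 * l))
    + 2 * (r : ℤ) * ((∑ᶠ l ∈ Set.Ici 1, β.bInv (2 * l - 1))
      + ∑ᶠ l ∈ Set.Ici r, β.bInv (2 * l))

/-- `Φ_m(β)` for `m ≥ 1`. -/
noncomputable def Phi (β : QBicForm q k V) (m : ℕ) : ℤ :=
  if Even m then β.PhiEven (m / 2) else β.PhiOdd ((m + 1) / 2)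

/-- `Ψ_m(β)` for `m = 2r - 1`. -/
noncomputable def PsiOdd (β : QBicForm q k V) (r : ℕ) : ℤ :=
  β.bInv (2 * r - 1)
    + 2 * ∑ l ∈ Finset.Icc 1 (r - 1), ((r : ℤ) - l) * β.bInv (2 * l - 1)

/-- `Ψ_m(β)` for `m = 2r`. -/
noncomputable def PsiEven (β : QBicForm q k V) (r : ℕ) : ℤ :=
  (∑ l ∈ Finset.Icc 1 (r - 1), (l : ℤ) * β.bInv (2 * l))
    + (r : ℤ) * ((∑ᶠ l ∈ Set.Ici 1, β.bInv (2 * l - 1))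
      + ∑ᶠ l ∈ Set.Ici r, β.bInv (2 * l))

/-- `Ψ_m(β)` for `m ≥ 1`. -/
noncomputable def Psi (β : QBicForm q k V) (m : ℕ) : ℤ :=
  if Even m then β.PsiEven (m / 2) else β.PsiOdd ((m + 1) / 2)

end Invariants

section Moduli

variable {p : ℕ} [Fact p.Prime] {e : ℕ} {k : Type u} [Field k] [CharP k p]
  {V : Type v} [AddCommGroup V] [Module k V]

/-- `β` specializes to `β'`: there are a discrete valuation ring `R` over `k` and a `q`-bic form
`γ` on a finite free `R`-module `M` whose generic fibre is isomorphic to `β` over the fraction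
field of `R` and whose special fibre is isomorphic to `β'` over the residue field of `R`. -/
def SpecializesTo (β β' : QBicForm (p ^ e) k V) : Prop :=
  ∃ (R : Type u) (_ : CommRing R) (_ : IsDomain R) (_ : IsDiscreteValuationRing R)
    (_ : Algebra k R) (M : Type u) (_ : AddCommGroup M) (_ : Module R M) (_ : Module.Finite R M)
    (_ : Module.Free R M) (γ : QBicForm (p ^ e) R M),
    haveI : CharP R p := charP_of_injective_algebraMap (algebraMap k R).injective p
    Isomorphic (β.baseChange (FractionRing R)) (γ.baseChange (FractionRing R)) ∧
    Isomorphic (β'.baseChange (IsLocalRing.ResidueField R))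
      (γ.baseChange (IsLocalRing.ResidueField R))

/-- The parameter space of `q`-bic forms on a vector space over `k` with a basis indexed by `ι`,
as a topological space: the spectrum of the polynomial ring in the entries `x_{ij}` of the Gram
matrix. -/
abbrev ParamSpace (k : Type u) [Field k] (ι : Type) : Type u :=
  PrimeSpectrum (MvPolynomial (ι × ι) k)

/-- The point of the parameter space underlying the `L`-valued point given by a `q`-bic form `γ`
on `L ⊗ V`: the polynomials over `k` vanishing at its Gram matrix. -/
noncomputable def point {ι : Type} (b : Module.Basis ι k V) {L : Type u} [Field L] [Algebra k L]
    (γ : QBicForm (p ^ e) L (L ⊗[k] V)) : ParamSpace k ι :=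
  ⟨RingHom.ker (MvPolynomial.aeval (R := k)
      fun ij : ι × ι => γ.gram (Algebra.TensorProduct.basis L b) ij.1 ij.2),
    RingHom.ker_isPrime _⟩

/-- The orbit of `β` under the algebraic group `GL_V`, as a subset of the parameter space: the
points underlying the forms `γ` on `L ⊗ V` isomorphic to `β` over `L`, for all extensions `L` of
`k`. -/
def orbit {ι : Type} (b : Module.Basis ι k V) (β : QBicForm (p ^ e) k V) : Set (ParamSpace k ι) :=
  {x | ∃ (L : Type u) (_ : Field L) (_ : Algebra k L) (γ : QBicForm (p ^ e) L (L ⊗[k] V)),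
    Isomorphic (β.baseChange L) γ ∧ x = point b γ}

end Moduli

end QBicForm

/-!
The equivalence of the two systems of inequalities is formal: `Φ_m` is `2 Ψ_m` for even `m`, and
`dim V + Ψ_m` for odd `m`.

For the specialization, let `F` be an algebraic closure of `k`. Over `F` every form is, in a
suitable basis, a sum of `a` loops `β(f, f) = 1` and of chains `e_0 → e_1 → ⋯ → e_{m-1}` with
`β(e_i, e_{i+1}) = 1` (`hasStBasis`). Lang's theorem, in the form that the fixed vectors of a
`Q`-linear automorphism span, gives an orthonormal basis of a nondegenerate form
(`Nondeg.exists_orthonormal_basis`). From any other form either a vector of the two-sided radical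
splits off, or the form is an extension `extMat B A` of a smaller form, in which vectors
`x_c → y_c` are put in front of functionals `A c` of the smaller space. The invariant `b_m` counts the chains of length `m` (`bInv_of_gram_eq_St`),
and it does not change under base change.

The geometric side is reduced to the relation `Deg B C` between Gram matrices over `F`: over the
fraction field of `F⟦X⟧` the matrix `B` is congruent to a matrix over `F⟦X⟧` whose reduction
modulo `X` is `C`. Such a family is a specialization over a discrete valuation ring
(`specializesTo_of_deg`), and a polynomial vanishing on the orbit of `B` vanishes on the family,
hence at `C` (`point_mem_closure_orbit_of_deg`). Because `F` is perfect, the substitution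
`X ↦ X ^ p ^ N` may be used to gain `p`-power roots and a high order of contact; this makes `Deg`
transitive (`Deg.trans`) and compatible with extensions (`Deg.extMat`). So it suffices to degenerate
a few forms of dimension at most three and to split off a chain of length two
(`deg_hyperbolic`, `deg_chain_three`, `deg_chain_two`, `deg_loop`, `deg_extMat_zero`). Lengthening
all chains by even numbers turns these into moves on the types of forms.

What remains is combinatorial. Write the even chain lengths as `2 l` for `l ∈ E` and the odd ones as
`2 l + 1` for `l ∈ O`. Then `Θ_m` is the number of `l ∈ O` with `l < m`, and
`Ψ_{2 r} = ∑_{l ∈ E} min(l, r) + r |O|`. When these are at most the corresponding numbers of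
`β'`, the moves lead from the type of `β` to that of `β'` (`hdeg_of_le`): the smallest odd chain
of `β` is shortened to one of `β'` and cancelled, until `β` has no odd chains. The odd chains
of `β'` are then removed by moves into the type of `β'` (`hdeg_of_source_even`), and for even
chains alone the inequalities between truncated sums are a dominance order, in which two parts may
be brought closer together or two loops traded for a longer part (`hdeg_of_even`).
-/

set_option linter.unusedSectionVars false

/-! ### Frobenius twists, congruence, and extensions of Gram matrices -/

namespace QBicForm

open Matrix

section Twist

variable (p : ℕ) [Fact p.Prime] (e : ℕ)

/-- The Frobenius twist of a matrix: every entry is raised to the power `p ^ e`. -/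
def tw {m n K : Type*} [CommRing K] [CharP K p] (M : Matrix m n K) : Matrix m n K :=
  M.map (iterateFrobenius K p e)

variable {l m n o K L : Type*} [CommRing K] [CharP K p] [CommRing L] [CharP L p]

theorem tw_apply (M : Matrix m n K) (i : m) (j : n) : tw p e M i j = M i j ^ p ^ e := rfl

theorem tw_mul [Fintype m] (M : Matrix l m K) (N : Matrix m n K) :
    tw p e (M * N) = tw p e M * tw p e N := Matrix.map_mul

theorem tw_one [DecidableEq m] : tw p e (1 : Matrix m m K) = 1 :=
  Matrix.map_one _ (map_zero _) (map_one _)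

theorem tw_zero : tw p e (0 : Matrix m n K) = 0 :=
  Matrix.map_zero _ (map_zero _)

theorem tw_neg (M : Matrix m n K) : tw p e (-M) = -tw p e M := by
  ext i j
  exact map_neg (iterateFrobenius K p e) (M i j)

theorem tw_fromCols (M : Matrix m n K) (N : Matrix m o K) :
    tw p e (fromCols M N) = fromCols (tw p e M) (tw p e N) := by
  ext i (j | j) <;> rfl

theorem tw_transpose (M : Matrix m n K) : tw p e Mᵀ = (tw p e M)ᵀ := rfl

theorem tw_smul (c : K) (M : Matrix m n K) : tw p e (c • M) = c ^ p ^ e • tw p e M := by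
  ext i j
  simp [tw_apply, mul_pow]

theorem tw_map (φ : K →+* L) (M : Matrix m n K) : tw p e (M.map φ) = (tw p e M).map φ := by
  ext i j
  simp [tw_apply]

theorem tw_fromBlocks (A : Matrix l n K) (B : Matrix l o K) (C : Matrix m n K)
    (D : Matrix m o K) : tw p e (fromBlocks A B C D) =
      fromBlocks (tw p e A) (tw p e B) (tw p e C) (tw p e D) :=
  fromBlocks_map _ _ _ _ _

theorem tw_submatrix (M : Matrix m n K) (f : l → m) (g : o → n) :
    tw p e (M.submatrix f g) = (tw p e M).submatrix f g := rfl

/-- Two Gram matrices are congruent if one arises from the other by an invertible change of basis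
`g`, which acts by `B ↦ (g^{[1]})ᵀ B g`. The index types may differ, so that invertibility is
witnessed by an explicit two-sided inverse. -/
def Cong [Fintype m] [Fintype n] [DecidableEq m] [DecidableEq n]
    (B : Matrix m m K) (C : Matrix n n K) : Prop :=
  ∃ (g : Matrix m n K) (h : Matrix n m K), g * h = 1 ∧ h * g = 1 ∧ (tw p e g)ᵀ * B * g = C

variable [Fintype l] [Fintype m] [Fintype n] [Fintype o]
  [DecidableEq l] [DecidableEq m] [DecidableEq n] [DecidableEq o]

variable {p e}

theorem Cong.refl (B : Matrix m m K) : Cong p e B B :=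
  ⟨1, 1, by simp, by simp, by simp [tw_one]⟩

theorem Cong.trans {A : Matrix l l K} {B : Matrix m m K} {C : Matrix n n K}
    (h₁ : Cong p e A B) (h₂ : Cong p e B C) : Cong p e A C := by
  obtain ⟨g, h, hgh, hhg, rfl⟩ := h₁
  obtain ⟨g', h', hgh', hhg', rfl⟩ := h₂
  refine ⟨g * g', h' * h, ?_, ?_, ?_⟩
  · rw [Matrix.mul_assoc, ← Matrix.mul_assoc g', hgh', Matrix.one_mul, hgh]
  · rw [Matrix.mul_assoc, ← Matrix.mul_assoc h, hhg, Matrix.one_mul, hhg']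
  · rw [tw_mul, transpose_mul]
    simp only [Matrix.mul_assoc]

theorem Cong.symm {A : Matrix l l K} {B : Matrix m m K} (h₁ : Cong p e A B) : Cong p e B A := by
  obtain ⟨g, h, hgh, hhg, rfl⟩ := h₁
  refine ⟨h, g, hhg, hgh, ?_⟩
  have h1 : (tw p e h)ᵀ * (tw p e g)ᵀ = 1 := by
    rw [← transpose_mul, ← tw_mul, hgh, tw_one, transpose_one]
  calc (tw p e h)ᵀ * ((tw p e g)ᵀ * A * g) * h
      = ((tw p e h)ᵀ * (tw p e g)ᵀ) * A * (g * h) := by simp only [Matrix.mul_assoc]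
    _ = A := by rw [h1, hgh, Matrix.one_mul, Matrix.mul_one]

theorem Cong.map (φ : K →+* L) {A : Matrix l l K} {B : Matrix m m K} (h₁ : Cong p e A B) :
    Cong p e (A.map φ) (B.map φ) := by
  obtain ⟨g, h, hgh, hhg, rfl⟩ := h₁
  refine ⟨g.map φ, h.map φ, ?_, ?_, ?_⟩
  · rw [← Matrix.map_mul, hgh, Matrix.map_one _ (map_zero _) (map_one _)]
  · rw [← Matrix.map_mul, hhg, Matrix.map_one _ (map_zero _) (map_one _)]
  · rw [Matrix.map_mul, Matrix.map_mul, tw_map, transpose_map]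

theorem Cong.of_equiv (A : Matrix l l K) (B : Matrix m m K) (σ : m ≃ l)
    (h : ∀ i j, B i j = A (σ i) (σ j)) : Cong p e A B := by
  have hB : B = A.submatrix σ σ := by ext i j; exact h i j
  refine ⟨(1 : Matrix l l K).submatrix id σ, (1 : Matrix l l K).submatrix σ id, ?_, ?_, ?_⟩
  · rw [Matrix.submatrix_mul_equiv]; simp
  · rw [← Matrix.submatrix_mul _ _ _ _ _ Function.bijective_id]; simp
  · rw [tw_submatrix, tw_one, transpose_submatrix, transpose_one, hB]
    have h1 : (1 : Matrix l l K).submatrix σ id * A = A.submatrix σ id := by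
      have := Matrix.submatrix_mul (1 : Matrix l l K) A σ id id Function.bijective_id
      simpa using this.symm
    rw [h1]
    have := Matrix.submatrix_mul A (1 : Matrix l l K) σ id σ Function.bijective_id
    simpa using this.symm

theorem Cong.blockDiag {A : Matrix l l K} {A' : Matrix m m K} {B : Matrix n n K}
    {B' : Matrix o o K} (h₁ : Cong p e A A') (h₂ : Cong p e B B') :
    Cong p e (Matrix.fromBlocks A 0 0 B) (Matrix.fromBlocks A' 0 0 B') := by
  obtain ⟨g, h, hgh, hhg, rfl⟩ := h₁
  obtain ⟨g', h', hgh', hhg', rfl⟩ := h₂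
  refine ⟨Matrix.fromBlocks g 0 0 g', Matrix.fromBlocks h 0 0 h', ?_, ?_, ?_⟩
  · simp [fromBlocks_multiply, hgh, hgh']
  · simp [fromBlocks_multiply, hhg, hhg']
  · simp [tw_fromBlocks, tw_zero, fromBlocks_transpose, fromBlocks_multiply]

/-- For matrices with the same index type it suffices that the change of basis has a right
inverse. -/
theorem Cong.of_mul_eq_one {A B : Matrix m m K} (g h : Matrix m m K) (hgh : g * h = 1)
    (hB : (tw p e g)ᵀ * A * g = B) : Cong p e A B :=
  ⟨g, h, hgh, mul_eq_one_comm.1 hgh, hB⟩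

end Twist

section Extension

variable {κ ι ι' K L : Type*} [Fintype κ] [Fintype ι] [DecidableEq κ] [DecidableEq ι]
  [Fintype ι'] [DecidableEq ι'] [CommRing K] [CommRing L]

/-- The extension of a form with Gram matrix `B` by the functionals `A c`, for `c ∈ κ`: vectors
`x_c` and `y_c` are added, with `β(x_c, y_c) = 1` and `β(y_c, ·) = A c` on the old space. A chain
`u_1 → u_2 → ⋯` of the old form, on whose first vector some `A c` is `1`, grows to
`x_c → y_c → u_1 → u_2 → ⋯`. -/
def extMat (B : Matrix ι ι K) (A : Matrix κ ι K) : Matrix (κ ⊕ (κ ⊕ ι)) (κ ⊕ (κ ⊕ ι)) K :=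
  fromBlocks 0 (fromCols 1 0) 0 (fromBlocks 0 A 0 B)

/-- `A` is admissible for `B` if the functionals `A c` and `β(u, ·)` together span the dual
space, that is, if the stacked matrix has a left inverse. -/
def Admissible (B : Matrix ι ι K) (A : Matrix κ ι K) : Prop :=
  ∃ (P : Matrix ι ι K) (Q : Matrix ι κ K), P * B + Q * A = 1

theorem extMat_map (φ : K →+* L) (B : Matrix ι ι K) (A : Matrix κ ι K) :
    (extMat B A).map φ = extMat (B.map φ) (A.map φ) := by
  rw [extMat, extMat, fromBlocks_map, fromBlocks_map]
  congr 1
  · ext; simp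
  · ext i (j | j) <;> simp [fromCols, Matrix.one_apply, apply_ite φ]
  · ext; simp
  · congr 1 <;> ext <;> simp

theorem Admissible.map (φ : K →+* L) {B : Matrix ι ι K} {A : Matrix κ ι K}
    (h : Admissible B A) : Admissible (B.map φ) (A.map φ) := by
  obtain ⟨P, Q, h⟩ := h
  refine ⟨P.map φ, Q.map φ, ?_⟩
  rw [← Matrix.map_mul, ← Matrix.map_mul, ← Matrix.map_add φ (map_add φ), h,
    Matrix.map_one _ (map_zero _) (map_one _)]

variable {p : ℕ} [Fact p.Prime] {e : ℕ} [CharP K p] [CharP L p]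

/-- A change of basis of the old form carries over to an extension, with the functionals
expressed in the new basis. -/
theorem Cong.extMat_right {B : Matrix ι ι K} {C : Matrix ι' ι' K} (A : Matrix κ ι K)
    (g : Matrix ι ι' K) (h : Matrix ι' ι K) (hgh : g * h = 1) (hhg : h * g = 1)
    (hC : (tw p e g)ᵀ * B * g = C) : Cong p e (extMat B A) (extMat C (A * g)) := by
  refine ⟨fromBlocks 1 0 0 (fromBlocks 1 0 0 g), fromBlocks 1 0 0 (fromBlocks 1 0 0 h),
    ?_, ?_, ?_⟩
  · simp [fromBlocks_multiply, hgh]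
  · simp [fromBlocks_multiply, hhg]
  · subst hC
    simp [extMat, tw_fromBlocks, tw_zero, tw_one, fromBlocks_transpose, fromBlocks_multiply,
      fromCols_mul_fromBlocks]

/-- Entries `β(y, y)` and `β(u, y)` can be removed from an extension when they are `q`-th
powers, by adding multiples of the `x_c` to the `y_c` and the `u_i`. The pairing of the `x_c` with
the `y_c` may be any matrix `D` whose inverse consists of `q`-th powers. -/
theorem cong_extMat_of_junk (B : Matrix ι ι K) (A : Matrix κ ι K) (D D' : Matrix κ κ K)
    (G : Matrix κ κ K) (E : Matrix κ ι K) (hD : (tw p e D')ᵀ * D = 1) (hD' : IsUnit D') :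
    Cong p e (fromBlocks 0 (fromCols D 0) 0
      (fromBlocks (tw p e G)ᵀ A (tw p e E)ᵀ B)) (extMat B A) := by
  obtain ⟨W, hW⟩ := hD'.exists_right_inv
  refine Cong.of_mul_eq_one (fromBlocks D' (fromCols (-(D' * G)) (-(D' * E))) 0 1)
    (fromBlocks W (fromCols G E) 0 1) ?_ ?_
  · rw [fromBlocks_multiply]
    simp only [hW, Matrix.mul_zero, Matrix.zero_mul, Matrix.mul_one, add_zero,
      zero_add]
    rw [mul_fromCols]
    have h0 : fromCols (D' * G) (D' * E) + fromCols (-(D' * G)) (-(D' * E)) = 0 := by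
      ext i (j | j) <;> simp [fromCols]
    rw [h0, fromBlocks_one]
  · have key : (tw p e (fromCols (-(D' * G)) (-(D' * E))))ᵀ * fromCols D (0 : Matrix κ ι K) =
        fromBlocks (-(tw p e G)ᵀ) 0 (-(tw p e E)ᵀ) 0 := by
      have h1 : tw p e (fromCols (-(D' * G)) (-(D' * E))) =
          fromCols (-(tw p e D' * tw p e G)) (-(tw p e D' * tw p e E)) := by
        rw [tw_fromCols, tw_neg, tw_neg, tw_mul, tw_mul]
      rw [h1, transpose_fromCols, fromRows_mul_fromCols, transpose_neg, transpose_neg,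
        transpose_mul, transpose_mul, Matrix.neg_mul, Matrix.neg_mul,
        Matrix.neg_mul, Matrix.mul_assoc (tw p e G)ᵀ _ D, Matrix.mul_assoc (tw p e E)ᵀ _ D, hD]
      simp
    rw [tw_fromBlocks, fromBlocks_transpose, fromBlocks_multiply, fromBlocks_multiply, tw_one,
      tw_zero]
    simp only [Matrix.mul_zero, Matrix.zero_mul, Matrix.mul_one, Matrix.one_mul, add_zero,
      zero_add, transpose_zero, transpose_one]
    rw [key, extMat, fromBlocks_add, mul_fromCols, hD]
    simp

end Extension

end QBicForm

/-! ### Changing the functionals of an extension -/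

namespace QBicForm

open Matrix

section ExtensionUniqueness

variable {κ ι K L : Type*} [Fintype κ] [Fintype ι] [DecidableEq κ] [DecidableEq ι]

/-- Two linear surjections from the same finite-dimensional space differ by an automorphism. -/
theorem _root_.LinearMap.exists_equiv_comp_eq_of_surjective {K V W : Type*} [Field K]
    [AddCommGroup V] [Module K V] [FiniteDimensional K V] [AddCommGroup W] [Module K W]
    (f g : V →ₗ[K] W) (hf : Function.Surjective f) (hg : Function.Surjective g) :
    ∃ φ : V ≃ₗ[K] V, ∀ v, f (φ v) = g v := by
  obtain ⟨s, hs⟩ := f.exists_rightInverse_of_surjective (LinearMap.range_eq_top.2 hf)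
  obtain ⟨t, ht⟩ := g.exists_rightInverse_of_surjective (LinearMap.range_eq_top.2 hg)
  have hdim : Module.finrank K (LinearMap.ker g) = Module.finrank K (LinearMap.ker f) := by
    have h1 := f.finrank_range_add_finrank_ker
    have h2 := g.finrank_range_add_finrank_ker
    rw [LinearMap.range_eq_top.2 hf] at h1
    rw [LinearMap.range_eq_top.2 hg] at h2
    omega
  let θ : LinearMap.ker g ≃ₗ[K] LinearMap.ker f := LinearEquiv.ofFinrankEq _ _ hdim
  have hs' : ∀ w, f (s w) = w := fun w => LinearMap.congr_fun hs w
  have ht' : ∀ w, g (t w) = w := fun w => LinearMap.congr_fun ht w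
  let π : V →ₗ[K] LinearMap.ker g :=
    LinearMap.codRestrict _ (LinearMap.id - t ∘ₗ g) (fun v => by simp [ht'])
  let φ : V →ₗ[K] V := s ∘ₗ g + (LinearMap.ker f).subtype ∘ₗ θ.toLinearMap ∘ₗ π
  have hφ : ∀ v, f (φ v) = g v := by
    intro v
    have h1 : f (θ (π v) : V) = 0 := (θ (π v)).2
    simp [φ, hs', h1]
  have hinj : Function.Injective φ := by
    rw [← LinearMap.ker_eq_bot, LinearMap.ker_eq_bot']
    intro v hv
    have hgv : g v = 0 := by rw [← hφ, hv, map_zero]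
    have h1 : θ (π v) = 0 := by
      ext
      simpa [φ, hgv] using hv
    have h2 : π v = 0 := by simpa using h1
    have h3 : (π v : V) = v := by simp [π, hgv]
    rw [← h3, h2]; rfl
  exact ⟨LinearEquiv.ofInjectiveEndo φ hinj, hφ⟩

/-- Over a field, any two admissible families of functionals with the same index type agree, up
to an invertible change of the family, modulo the functionals `β(u, ·)`. -/
theorem Admissible.exists_eq [Field K] {B : Matrix ι ι K} {A₁ A₂ : Matrix κ ι K}
    (h₁ : Admissible B A₁) (h₂ : Admissible B A₂) :
    ∃ (H : Matrix κ κ K) (Z : Matrix κ ι K), IsUnit H ∧ A₂ = H * A₁ + Z * B := by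
  let I : Submodule K (ι → K) := LinearMap.range B.vecMulLinear
  have hsurj : ∀ A : Matrix κ ι K, Admissible B A →
      Function.Surjective (I.mkQ ∘ₗ A.vecMulLinear) := by
    rintro A ⟨P, Q, hPQ⟩ w
    obtain ⟨w, rfl⟩ := I.mkQ_surjective w
    refine ⟨w ᵥ* Q, ?_⟩
    have h1 : w = (w ᵥ* P) ᵥ* B + (w ᵥ* Q) ᵥ* A := by
      rw [vecMul_vecMul, vecMul_vecMul, ← vecMul_add, hPQ, vecMul_one]
    have h2 : I.mkQ ((w ᵥ* P) ᵥ* B) = 0 :=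
      (Submodule.Quotient.mk_eq_zero _).2 ⟨w ᵥ* P, rfl⟩
    conv_rhs => rw [h1, map_add, h2, zero_add]
    rfl
  obtain ⟨φ, hφ⟩ := LinearMap.exists_equiv_comp_eq_of_surjective _ _ (hsurj A₁ h₁) (hsurj A₂ h₂)
  have hZ : ∀ c : κ, ∃ z : ι → K, z ᵥ* B = A₂ c - (φ (Pi.single c 1)) ᵥ* A₁ := by
    intro c
    have h3 := hφ (Pi.single c 1)
    have h4 : I.mkQ (A₂ c - (φ (Pi.single c 1)) ᵥ* A₁) = 0 := by
      rw [map_sub, sub_eq_zero]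
      have : (Pi.single c 1 : κ → K) ᵥ* A₂ = A₂ c := by simp; rfl
      rw [← this]
      exact h3.symm
    obtain ⟨z, hz⟩ := (Submodule.Quotient.mk_eq_zero _).1 h4
    exact ⟨z, hz⟩
  choose Z hZ using hZ
  refine ⟨Matrix.of fun c => φ (Pi.single c 1), Matrix.of Z, ?_, ?_⟩
  · have h5 : (Matrix.of fun c => φ (Pi.single c 1)) = (LinearMap.toMatrix' φ.toLinearMap)ᵀ := by
      ext c d
      simp [LinearMap.toMatrix'_apply]
    rw [h5, isUnit_transpose]
    refine ⟨⟨_, LinearMap.toMatrix' φ.symm.toLinearMap, ?_, ?_⟩, rfl⟩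
    · rw [← LinearMap.toMatrix'_comp]; simp
    · rw [← LinearMap.toMatrix'_comp]; simp
  · ext c i
    have := congrFun (hZ c) i
    simp only [Matrix.add_apply, Matrix.mul_apply, Matrix.of_apply]
    simp only [vecMul, dotProduct, Pi.sub_apply] at this
    rw [this]
    ring

variable [CommRing K] [CommRing L] {p : ℕ} [Fact p.Prime] {e : ℕ} [CharP K p] [CharP L p]

theorem map_eq_tw_tw {ψ ρ : K →+* L} (hψ : ∀ x, ψ x = (ρ x ^ p ^ e) ^ p ^ e) {m n : Type*}
    (M : Matrix m n K) : M.map ψ = tw p e (tw p e (M.map ρ)) := by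
  ext i j
  simp [tw_apply, hψ]

theorem map_mul_tw_transpose {ψ ρ : K →+* L} (hψ : ∀ x, ψ x = (ρ x ^ p ^ e) ^ p ^ e)
    {m : Type*} (M : Matrix m ι K) (Z : Matrix κ ι K) :
    M.map ψ * (tw p e (Z.map ρ))ᵀ = (tw p e (tw p e (M.map ρ) * (Z.map ρ)ᵀ)ᵀ)ᵀ := by
  rw [map_eq_tw_tw hψ, tw_transpose, transpose_transpose, tw_mul, tw_transpose]

/-- Changing the functionals by an invertible matrix and by functionals `β(u, ·)` does not change
the extension, after a base change `ψ` all of whose values are `q ^ 2`-th powers. -/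
theorem cong_extMat_of_eq (ψ ρ : K →+* L) (hψ : ∀ x, ψ x = (ρ x ^ p ^ e) ^ p ^ e)
    {B : Matrix ι ι K} {A₁ A₂ : Matrix κ ι K} (H : Matrix κ κ K) (Z : Matrix κ ι K)
    (hH : IsUnit H) (hA : A₂ = H * A₁ + Z * B) :
    Cong p e (extMat (B.map ψ) (A₁.map ψ)) (extMat (B.map ψ) (A₂.map ψ)) := by
  obtain ⟨H', hHH'⟩ := hH.exists_right_inv
  have hmap : ∀ (φ : K →+* L), H.map φ * H'.map φ = 1 := fun φ => by
    rw [← Matrix.map_mul, hHH', Matrix.map_one _ (map_zero _) (map_one _)]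
  have htw : tw p e (H.map ρ) * tw p e (H'.map ρ) = 1 := by rw [← tw_mul, hmap, tw_one]
  have htw' : tw p e (H'.map ρ) * tw p e (H.map ρ) = 1 := mul_eq_one_comm.1 htw
  -- Replacing the `y_c` by combinations of the `y_c` and `u_i` turns the functionals `A₁` into
  -- `A₂`. This creates entries `β(y, y)` and `β(u, y)`, which are `q`-th powers and so can be
  -- cleared.
  refine Cong.trans (B := fromBlocks 0 (fromCols (tw p e (H.map ρ))ᵀ 0) 0
      (fromBlocks (A₂.map ψ * (tw p e (Z.map ρ))ᵀ) (A₂.map ψ)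
        (B.map ψ * (tw p e (Z.map ρ))ᵀ) (B.map ψ))) ?_ ?_
  · refine Cong.of_mul_eq_one
      (Matrix.fromBlocks 1 0 0
        (Matrix.fromBlocks (tw p e (H.map ρ))ᵀ 0 (tw p e (Z.map ρ))ᵀ 1))
      (Matrix.fromBlocks 1 0 0
        (Matrix.fromBlocks (tw p e (H'.map ρ))ᵀ 0
          (-((tw p e (Z.map ρ))ᵀ * (tw p e (H'.map ρ))ᵀ)) 1)) ?_ ?_
    · simp [fromBlocks_multiply, ← transpose_mul, htw']
    · have h1 : H.map ψ * A₁.map ψ + Z.map ψ * B.map ψ = A₂.map ψ := by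
        rw [hA, Matrix.map_add ψ (map_add ψ), Matrix.map_mul, Matrix.map_mul]
      rw [map_eq_tw_tw hψ H, map_eq_tw_tw hψ Z] at h1
      simp [extMat, tw_fromBlocks, tw_zero, tw_one, fromBlocks_transpose, fromBlocks_multiply,
        fromCols_mul_fromBlocks, tw_transpose, h1]
  · rw [map_mul_tw_transpose hψ, map_mul_tw_transpose hψ]
    refine cong_extMat_of_junk _ _ _ (H'.map ρ) _ _ ?_ ?_
    · rw [← transpose_mul, htw, transpose_one]
    · exact ⟨⟨_, H.map ρ, mul_eq_one_comm.1 (hmap ρ), hmap ρ⟩, rfl⟩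

end ExtensionUniqueness

end QBicForm

/-! ### Degenerations over power series -/

namespace QBicForm

open Matrix

section Degeneration

variable (p : ℕ) [Fact p.Prime] (e : ℕ) (F : Type u) [Field F] [CharP F p]

instance charP_powerSeries : CharP (PowerSeries F) p :=
  charP_of_injective_algebraMap (algebraMap F (PowerSeries F)).injective p

instance charP_fractionRing_powerSeries : CharP (FractionRing (PowerSeries F)) p :=
  IsFractionRing.charP_of_isFractionRing (PowerSeries F) p

/-- The embedding of the constants `F` into the fraction field of `F⟦X⟧`. -/
noncomputable def const : F →+* FractionRing (PowerSeries F) :=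
  (algebraMap (PowerSeries F) (FractionRing (PowerSeries F))).comp PowerSeries.C

/-- The inclusion of `F⟦X⟧` into its fraction field. -/
noncomputable abbrev toFrac : PowerSeries F →+* FractionRing (PowerSeries F) :=
  algebraMap (PowerSeries F) (FractionRing (PowerSeries F))

/-- A form `B` over `F` degenerates to `C` if `B` becomes congruent, over the fraction field of
`F⟦X⟧`, to a form over `F⟦X⟧` that reduces to `C` modulo `X`. -/
def Deg {F : Type u} [Field F] [CharP F p] {m n : Type*} [Fintype m] [Fintype n] [DecidableEq m]
    [DecidableEq n] (B : Matrix m m F) (C : Matrix n n F) : Prop :=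
  ∃ T : Matrix n n (PowerSeries F), T.map PowerSeries.constantCoeff = C ∧
    Cong p e (B.map (const F)) (T.map (toFrac F))

section Perfect

variable [PerfectRing F p]

/-- The automorphism of `F⟦X⟧` that takes `p ^ n`-th roots of the coefficients. -/
noncomputable def coeffRoot (n : ℕ) : PowerSeries F →+* PowerSeries F :=
  PowerSeries.map ((iterateFrobeniusEquiv F p n).symm : F →+* F)

theorem coeffRoot_injective (n : ℕ) : Function.Injective (coeffRoot p F n) :=
  PowerSeries.map_injective _ (RingHom.injective _)

/-- The extension of `coeffRoot` to the fraction field. -/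
noncomputable def coeffRootFrac (n : ℕ) :
    FractionRing (PowerSeries F) →+* FractionRing (PowerSeries F) :=
  IsFractionRing.map (A := PowerSeries F) (B := PowerSeries F) (coeffRoot_injective p F n)

/-- The endomorphism `f(X) ↦ f(X ^ p ^ n)` of `F⟦X⟧`, written as the `p ^ n`-th power of
`coeffRoot`. -/
noncomputable def substPow (n : ℕ) : PowerSeries F →+* PowerSeries F :=
  (iterateFrobenius (PowerSeries F) p n).comp (coeffRoot p F n)

/-- The endomorphism `X ↦ X ^ p ^ n` of the fraction field of `F⟦X⟧`; it makes every element
a `p ^ n`-th power. -/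
noncomputable def substPowFrac (n : ℕ) :
    FractionRing (PowerSeries F) →+* FractionRing (PowerSeries F) :=
  (iterateFrobenius (FractionRing (PowerSeries F)) p n).comp (coeffRootFrac p F n)

theorem substPowFrac_apply (n : ℕ) (x : FractionRing (PowerSeries F)) :
    substPowFrac p F n x = coeffRootFrac p F n x ^ p ^ n := rfl

theorem substPow_C (n : ℕ) (a : F) : substPow p F n (PowerSeries.C a) = PowerSeries.C a := by
  simp only [substPow, coeffRoot, RingHom.comp_apply, PowerSeries.map_C, iterateFrobenius_def]
  rw [← map_pow]
  congr 1
  exact (iterateFrobeniusEquiv F p n).apply_symm_apply a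

theorem substPow_X (n : ℕ) : substPow p F n PowerSeries.X = PowerSeries.X ^ p ^ n := by
  simp [substPow, coeffRoot, iterateFrobenius_def]

theorem substPowFrac_toFrac (n : ℕ) (f : PowerSeries F) :
    substPowFrac p F n (toFrac F f) = toFrac F (substPow p F n f) := by
  have h : coeffRootFrac p F n (toFrac F f) = toFrac F (coeffRoot p F n f) := by
    unfold coeffRootFrac IsFractionRing.map
    exact IsLocalization.map_eq _ f
  rw [substPowFrac_apply, h, substPow, RingHom.comp_apply, iterateFrobenius_def, map_pow]

theorem substPowFrac_const (n : ℕ) (a : F) :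
    substPowFrac p F n (const F a) = const F a := by
  rw [const, RingHom.comp_apply, substPowFrac_toFrac, substPow_C]

theorem constantCoeff_substPow (n : ℕ) (f : PowerSeries F) :
    PowerSeries.constantCoeff (substPow p F n f) = PowerSeries.constantCoeff f := by
  have h : f - PowerSeries.C (PowerSeries.constantCoeff f) ∈
      Ideal.span {(PowerSeries.X : PowerSeries F)} := by
    rw [Ideal.mem_span_singleton, PowerSeries.X_dvd_iff]
    simp
  obtain ⟨g, hg⟩ := Ideal.mem_span_singleton.1 h
  have hp : p ^ n ≠ 0 := pow_ne_zero _ (Fact.out : p.Prime).ne_zero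
  rw [sub_eq_iff_eq_add.1 hg, map_add, map_mul, substPow_C, substPow_X]
  simp only [map_add, map_mul, map_pow, PowerSeries.constantCoeff_X, zero_pow hp, zero_mul]

theorem map_const_map_substPowFrac (n : ℕ) {l m : Type*} (B : Matrix l m F) :
    (B.map (const F)).map (substPowFrac p F n) = B.map (const F) := by
  ext i j
  simp [substPowFrac_const]

theorem map_toFrac_map_substPowFrac (n : ℕ) {l m : Type*} (B : Matrix l m (PowerSeries F)) :
    (B.map (toFrac F)).map (substPowFrac p F n) = (B.map (substPow p F n)).map (toFrac F) := by
  ext i j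
  simp only [Matrix.map_apply, substPowFrac_toFrac]

end Perfect

variable {p e F}
variable {l m n o : Type*} [Fintype l] [Fintype m] [Fintype n] [Fintype o]
  [DecidableEq l] [DecidableEq m] [DecidableEq n] [DecidableEq o]

theorem map_C_map_toFrac (B : Matrix m n F) :
    (B.map PowerSeries.C).map (toFrac F) = B.map (const F) := rfl

theorem map_C_map_constantCoeff (B : Matrix m n F) :
    (B.map PowerSeries.C).map PowerSeries.constantCoeff = B := by
  ext i j
  simp

theorem Cong.deg {B : Matrix m m F} {C : Matrix n n F} (h : Cong p e B C) : Deg p e B C :=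
  ⟨C.map PowerSeries.C, map_C_map_constantCoeff C, h.map (const F)⟩

theorem Deg.congLeft {A : Matrix l l F} {B : Matrix m m F} {C : Matrix n n F}
    (h₁ : Cong p e A B) (h₂ : Deg p e B C) : Deg p e A C := by
  obtain ⟨T, hT, h⟩ := h₂
  exact ⟨T, hT, (h₁.map (const F)).trans h⟩

theorem Deg.blockDiag {A : Matrix l l F} {A' : Matrix m m F} {B : Matrix n n F}
    {B' : Matrix o o F} (h₁ : Deg p e A A') (h₂ : Deg p e B B') :
    Deg p e (fromBlocks A 0 0 B) (fromBlocks A' 0 0 B') := by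
  obtain ⟨T, hT, h⟩ := h₁
  obtain ⟨T', hT', h'⟩ := h₂
  refine ⟨fromBlocks T 0 0 T', ?_, ?_⟩
  · rw [fromBlocks_map, hT, hT']
    rw [Matrix.map_zero _ (map_zero _), Matrix.map_zero _ (map_zero _)]
  · have := h.blockDiag h'
    rw [fromBlocks_map, fromBlocks_map, Matrix.map_zero _ (map_zero _),
      Matrix.map_zero _ (map_zero _), Matrix.map_zero _ (map_zero _),
      Matrix.map_zero _ (map_zero _)]
    exact this

theorem map_smul_ringHom {R S : Type*} [CommRing R] [CommRing S] (φ : R →+* S) (a : R)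
    (M : Matrix m n R) : (a • M).map φ = φ a • M.map φ := by
  ext i j
  simp

/-- If `s` clears the denominators of the change of basis `g`, then a form divisible by
`s ^ (q + 1)` remains integral under `g`. -/
theorem congr_smul_map {R S : Type*} [CommRing R] [CharP R p] [CommRing S] [CharP S p]
    (φ : R →+* S) (s x w : R) (g : Matrix m n S) (G : Matrix m n R) (E : Matrix m m R)
    (h : φ s • g = G.map φ) :
    (tw p e g)ᵀ * (φ (x * (s ^ (p ^ e + 1) * w)) • E.map φ) * g =
      ((x * w) • ((tw p e G)ᵀ * E * G)).map φ := by
  have h3 : ((tw p e G)ᵀ * E * G).map φ =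
      φ (s ^ (p ^ e + 1)) • ((tw p e g)ᵀ * E.map φ * g) := by
    rw [Matrix.map_mul, Matrix.map_mul, transpose_map, ← tw_map, ← h, tw_smul,
      transpose_smul, Matrix.smul_mul, Matrix.smul_mul, Matrix.mul_smul, smul_smul, map_pow,
      ← pow_succ]
  rw [map_smul_ringHom, h3, smul_smul, Matrix.mul_smul, Matrix.smul_mul, ← map_mul]
  congr 2
  ring

/-- Degeneration is transitive: the first family is reparametrized by `X ↦ X ^ p ^ N`, so that it
agrees with its limit to a high order in `X`, and the second change of basis, which has poles of
bounded order, is applied to the result. -/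
theorem Deg.trans [PerfectRing F p] {A : Matrix l l F} {B : Matrix m m F} {C : Matrix n n F}
    (h₁ : Deg p e A B) (h₂ : Deg p e B C) : Deg p e A C := by
  obtain ⟨T, hT, hc⟩ := h₁
  obtain ⟨S, hS, g, h, hgh, hhg, hg⟩ := h₂
  have hE : ∀ i j, ∃ f, T i j = PowerSeries.C (B i j) + PowerSeries.X * f := by
    intro i j
    have : PowerSeries.X ∣ T i j - PowerSeries.C (B i j) := by
      rw [PowerSeries.X_dvd_iff, ← hT]
      simp
    obtain ⟨f, hf⟩ := this
    exact ⟨f, by rw [← hf]; ring⟩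
  choose E hE using hE
  have hTE : T = B.map PowerSeries.C + (PowerSeries.X : PowerSeries F) • Matrix.of E := by
    ext1 i j
    simp [hE]
  -- a common denominator `s` of the second change of basis `g`
  obtain ⟨s, hs⟩ := IsLocalization.exist_integer_multiples_of_finite
    (nonZeroDivisors (PowerSeries F)) (fun x : m × n => g x.1 x.2)
  choose G hG using hs
  have hs0 : (s : PowerSeries F) ≠ 0 := nonZeroDivisors.ne_zero s.2
  set G' : Matrix m n (PowerSeries F) := Matrix.of fun i j => G (i, j) with hG'
  have hgG : toFrac F s • g = G'.map (toFrac F) := by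
    ext i j
    simp [hG', hG (i, j), Algebra.smul_def]
  -- `X ^ p ^ N` is divisible by `X * s ^ (q + 1)` for large `N`
  obtain ⟨N, w, hw⟩ : ∃ (N : ℕ) (w : PowerSeries F),
      PowerSeries.X ^ p ^ N = PowerSeries.X * ((s : PowerSeries F) ^ (p ^ e + 1) * w) := by
    obtain ⟨d, hd⟩ := IsDiscreteValuationRing.associated_pow_irreducible hs0
      (PowerSeries.X_irreducible (R := F))
    obtain ⟨c, hc⟩ := hd.dvd
    refine ⟨1 + d * (p ^ e + 1), ?_⟩
    have h1 : 1 + d * (p ^ e + 1) < p ^ (1 + d * (p ^ e + 1)) :=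
      Nat.lt_pow_self (Fact.out : p.Prime).one_lt
    obtain ⟨r, hr⟩ := Nat.exists_eq_add_of_lt h1
    refine ⟨c ^ (p ^ e + 1) * PowerSeries.X ^ (r + 1), ?_⟩
    rw [hr, ← mul_assoc ((s : PowerSeries F) ^ (p ^ e + 1)), ← mul_pow, ← hc]
    ring
  set E' : Matrix m m (PowerSeries F) := (Matrix.of E).map (substPow p F N) with hE'
  have hψ : (T.map (toFrac F)).map (substPowFrac p F N) =
      B.map (const F) + toFrac F (PowerSeries.X ^ p ^ N) • E'.map (toFrac F) := by
    rw [map_toFrac_map_substPowFrac, hTE]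
    ext i j
    simp [hE', substPow_C, substPow_X, const]
  refine ⟨S + (PowerSeries.X * w) • ((tw p e G')ᵀ * E' * G'), ?_, ?_⟩
  · ext i j
    simp [← hS]
  · refine Cong.trans (B := (T.map (toFrac F)).map (substPowFrac p F N)) ?_ ?_
    · have := hc.map (substPowFrac p F N)
      rwa [map_const_map_substPowFrac] at this
    · refine ⟨g, h, hgh, hhg, ?_⟩
      rw [hψ, Matrix.mul_add, Matrix.add_mul, hg, hw, Matrix.map_add _ (map_add _),
        congr_smul_map (p := p) (e := e) (toFrac F) s PowerSeries.X w g G' E' hgG]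

variable {κ : Type*} [Fintype κ] [DecidableEq κ]

/-- A square matrix over `F⟦X⟧` that reduces to the identity modulo `X` is invertible. -/
theorem isUnit_of_map_constantCoeff {M : Matrix m m (PowerSeries F)}
    (h : M.map PowerSeries.constantCoeff = 1) : IsUnit M := by
  rw [Matrix.isUnit_iff_isUnit_det, PowerSeries.isUnit_iff_constantCoeff]
  have h1 := RingHom.map_det (PowerSeries.constantCoeff (R := F)) M
  rw [h1, RingHom.mapMatrix_apply, h, det_one]
  exact isUnit_one

/-- Degenerations lift to extensions. Over the fraction field, the two extensions of the family
given by the limits of the functionals and by the transform of the original functionals agree up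
to `q ^ 2`-th roots, and these are provided by the substitution `X ↦ X ^ (q ^ 2)`. -/
theorem Deg.extMat [PerfectRing F p] {B : Matrix m m F} {C : Matrix n n F} (h : Deg p e B C)
    {A : Matrix κ m F} {A' : Matrix κ n F} (hA : Admissible B A) (hA' : Admissible C A') :
    Deg p e (extMat B A) (extMat C A') := by
  obtain ⟨T, hT, g, h, hgh, hhg, hg⟩ := h
  obtain ⟨P, Q, hPQ⟩ := hA'
  set ψ := substPowFrac p F (e + e) with hψdef
  have hψ : ∀ x, ψ x = (coeffRootFrac p F (e + e) x ^ p ^ e) ^ p ^ e := by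
    intro x
    rw [hψdef, substPowFrac_apply, ← pow_mul, pow_add]
  -- the functionals `A'` remain admissible for the family
  have hU : IsUnit (P.map PowerSeries.C * T + Q.map PowerSeries.C * A'.map PowerSeries.C) := by
    apply isUnit_of_map_constantCoeff
    rw [Matrix.map_add _ (map_add _), Matrix.map_mul, Matrix.map_mul, hT,
      map_C_map_constantCoeff, map_C_map_constantCoeff, map_C_map_constantCoeff, hPQ]
  obtain ⟨W, hW⟩ := hU.exists_left_inv
  have hadm : Admissible (B.map (const F)) (A'.map (const F) * h) := by
    have hW' := congrArg (fun M => g * M.map (toFrac F) * h) hW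
    simp only [Matrix.map_mul, Matrix.map_add _ (map_add (toFrac F)), map_C_map_toFrac,
      Matrix.map_one _ (map_zero (toFrac F)) (map_one (toFrac F)), Matrix.mul_one, hgh] at hW'
    rw [← hg] at hW'
    refine ⟨g * W.map (toFrac F) * P.map (const F) * (tw p e g)ᵀ,
      g * W.map (toFrac F) * Q.map (const F), ?_⟩
    rw [← hW']
    simp only [Matrix.mul_assoc, Matrix.mul_add, Matrix.add_mul, hgh, Matrix.mul_one]
  obtain ⟨H, Z, hH, hHZ⟩ := (hA.map (const F)).exists_eq hadm
  have h1 := cong_extMat_of_eq (p := p) (e := e) ψ (coeffRootFrac p F (e + e)) hψ H Z hH hHZ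
  have h2 := Cong.extMat_right (p := p) (e := e) (B := (B.map (const F)).map ψ)
    ((A'.map (const F) * h).map ψ) (g.map ψ) (h.map ψ)
    (by rw [← Matrix.map_mul, hgh, Matrix.map_one _ (map_zero _) (map_one _)])
    (by rw [← Matrix.map_mul, hhg, Matrix.map_one _ (map_zero _) (map_one _)])
    (C := (T.map (toFrac F)).map ψ)
    (by rw [← hg, Matrix.map_mul, Matrix.map_mul, tw_map, transpose_map])
  rw [← Matrix.map_mul, Matrix.mul_assoc, hhg, Matrix.mul_one, hψdef,
    map_const_map_substPowFrac, map_const_map_substPowFrac, map_toFrac_map_substPowFrac] at h2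
  rw [hψdef, map_const_map_substPowFrac, map_const_map_substPowFrac] at h1
  refine ⟨QBicForm.extMat (T.map (substPow p F (e + e))) (A'.map PowerSeries.C), ?_, ?_⟩
  · rw [extMat_map, map_C_map_constantCoeff]
    congr 1
    rw [← hT]
    ext i j
    simp [constantCoeff_substPow]
  · rw [extMat_map, extMat_map]
    exact h1.trans h2

end Degeneration

end QBicForm

/-! ### Fixed vectors of semilinear maps -/

namespace QBicForm

section Lang

variable {F : Type*} [Field F] [IsAlgClosed F]
  {V : Type*} [AddCommGroup V] [Module F V]

open Polynomial in
/-- The polynomials `P_0 = a_0 X^Q`, `P_{i+1} = P_i^Q + a_{i+1} X^Q`, whose values are the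
coefficients of a vector fixed by a `Q`-linear map in terms of the last coefficient. -/
noncomputable def fixPoly (Q : ℕ) (a : ℕ → F) : ℕ → F[X]
  | 0 => C (a 0) * X ^ Q
  | i + 1 => fixPoly Q a i ^ Q + C (a (i + 1)) * X ^ Q

open Polynomial in
/-- The divisibility by `X ^ Q` leaves a nonconstant equation after division of `P_i(x) = x`
by `x`, and so yields a nonzero solution. -/
theorem X_pow_dvd_fixPoly {Q : ℕ} (hQ : 2 ≤ Q) (a : ℕ → F) (i : ℕ) :
    X ^ Q ∣ fixPoly Q a i := by
  induction i with
  | zero => exact dvd_mul_left _ _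
  | succ i ih => exact dvd_add (ih.trans (dvd_pow_self _ (by omega))) (dvd_mul_left _ _)

open Polynomial in
theorem fixPoly_ne_zero {Q : ℕ} (hQ : 2 ≤ Q) (a : ℕ → F) {i j : ℕ} (hij : i ≤ j)
    (hi : a i ≠ 0) : fixPoly Q a j ≠ 0 := by
  have key : ∀ j, (∃ i ≤ j, a i ≠ 0) → fixPoly Q a j ≠ 0 := by
    intro j
    induction j with
    | zero =>
      rintro ⟨i, hi, h⟩
      obtain rfl : i = 0 := by omega
      simpa [fixPoly] using h
    | succ j ih =>
      rintro ⟨i, hi, h⟩ h0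
      by_cases hP : fixPoly Q a j = 0
      · have hi' : i = j + 1 := by
          by_contra hne
          exact ih ⟨i, by omega, h⟩ hP
        subst hi'
        rw [fixPoly, hP, zero_pow (by omega), zero_add] at h0
        simp [h] at h0
      · rw [fixPoly, add_eq_zero_iff_eq_neg] at h0
        have h1 : Q ≤ (fixPoly Q a j).natDegree := by
          have := natDegree_le_of_dvd (X_pow_dvd_fixPoly hQ a j) hP
          simpa using this
        have h2 := congrArg natDegree h0
        rw [natDegree_pow, natDegree_neg] at h2
        have h3 : (C (a (j + 1)) * X ^ Q).natDegree ≤ Q := natDegree_C_mul_X_pow_le _ _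
        nlinarith
  exact key j ⟨i, hij, hi⟩

/-- A `Q`-linear injective endomorphism of a nonzero finite-dimensional vector space over an
algebraically closed field fixes some nonzero vector. The vector is sought in the span of the
iterates of one vector, where the condition is a polynomial equation in a single unknown. -/
theorem exists_fixed_ne_zero [FiniteDimensional F V] [Nontrivial V] {Q : ℕ} (hQ : 2 ≤ Q)
    (φ : V →+ V) (hφ : ∀ (c : F) v, φ (c • v) = c ^ Q • φ v) (hinj : Function.Injective φ) :
    ∃ v : V, v ≠ 0 ∧ φ v = v := by
  classical
  obtain ⟨v, hv⟩ := exists_ne (0 : V)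
  -- the first linear relation `φ^(m' + 1) v = ∑ a_i φ^i v` among the iterates
  have hex : ∃ m, ¬ LinearIndependent F (fun i : Fin (m + 1) => φ^[i] v) := by
    refine ⟨Module.finrank F V, fun h => ?_⟩
    have := h.fintype_card_le_finrank
    simp at this
  have hm := Nat.find_spec hex
  have hmin : ∀ k < Nat.find hex, _ := fun k hk => Nat.find_min hex hk
  set m := Nat.find hex
  obtain ⟨m', hm'⟩ : ∃ m', m = m' + 1 := by
    refine Nat.exists_eq_succ_of_ne_zero fun h0 => hm ?_
    rw [h0]
    have : Subsingleton (Fin (0 + 1)) := inferInstanceAs (Subsingleton (Fin 1))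
    exact LinearIndependent.of_subsingleton (0 : Fin 1) hv
  have hli : LinearIndependent F (fun i : Fin (m' + 1) => φ^[i] v) := by
    have := hmin m' (by omega)
    exact not_not.1 this
  have hmem : φ^[m' + 1] v ∈ Submodule.span F (Set.range fun i : Fin (m' + 1) => φ^[i] v) := by
    by_contra hnot
    apply hm
    rw [hm', linearIndependent_finSucc']
    exact ⟨hli, hnot⟩
  obtain ⟨a', ha'⟩ := (Submodule.mem_span_range_iff_exists_fun F).1 hmem
  set a : ℕ → F := fun i => if h : i < m' + 1 then a' ⟨i, h⟩ else 0 with ha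
  have hrel : ∑ i ∈ Finset.range (m' + 1), a i • φ^[i] v = φ^[m' + 1] v := by
    rw [← ha', Finset.sum_range]
    refine Finset.sum_congr rfl fun i _ => ?_
    rw [ha]
    simp only [i.2, dif_pos]
  obtain ⟨i₀, hi₀, hai₀⟩ : ∃ i ≤ m', a i ≠ 0 := by
    by_contra! hall
    have h0 : φ^[m' + 1] v = 0 := by
      rw [← hrel]
      refine Finset.sum_eq_zero fun i hi => ?_
      rw [hall i (by simpa [Nat.lt_succ_iff] using hi), zero_smul]
    have h1 : φ^[m' + 1] v = φ^[m' + 1] 0 := by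
      rw [h0, Function.iterate_fixed (map_zero φ)]
    exact hv ((hinj.iterate _) h1)
  -- a nonzero solution `x` of `P_{m'}(x) = x`
  obtain ⟨x, hx0, hx⟩ : ∃ x : F, x ≠ 0 ∧ (fixPoly Q a m').eval x = x := by
    obtain ⟨R, hR⟩ := X_pow_dvd_fixPoly hQ a m'
    have hP := fixPoly_ne_zero hQ a hi₀ hai₀
    have hR0 : R ≠ 0 := by rintro rfl; simp [hR] at hP
    have hdeg : (Polynomial.X ^ (Q - 1) * R - 1 : Polynomial F).degree ≠ 0 := by
      have h1 : 0 < (Polynomial.X ^ (Q - 1) * R : Polynomial F).degree := by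
        rw [Polynomial.degree_mul, Polynomial.degree_X_pow]
        have h2 : (0 : WithBot ℕ) ≤ R.degree := Polynomial.zero_le_degree_iff.2 hR0
        have h3 : (0 : WithBot ℕ) < ((Q - 1 : ℕ) : WithBot ℕ) := by
          exact_mod_cast (by omega : 0 < Q - 1)
        exact add_pos_of_pos_of_nonneg h3 h2
      rw [Polynomial.degree_sub_eq_left_of_degree_lt]
      · exact h1.ne'
      · simpa using h1
    obtain ⟨x, hx⟩ := IsAlgClosed.exists_root _ hdeg
    have hx' : x ^ (Q - 1) * R.eval x = 1 := by
      simpa [Polynomial.IsRoot, sub_eq_zero] using hx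
    refine ⟨x, ?_, ?_⟩
    · rintro rfl
      rw [zero_pow (by omega), zero_mul] at hx'
      exact zero_ne_one hx'
    · rw [hR, Polynomial.eval_mul, Polynomial.eval_pow, Polynomial.eval_X]
      obtain ⟨Q', rfl⟩ : ∃ Q', Q = Q' + 1 := ⟨Q - 1, by omega⟩
      rw [Nat.add_sub_cancel] at hx'
      rw [pow_succ, mul_right_comm, hx', one_mul]
  set c : ℕ → F := fun i => (fixPoly Q a i).eval x with hc
  have hc0 : c 0 = a 0 * x ^ Q := by simp [hc, fixPoly]
  have hcs : ∀ i, c (i + 1) = c i ^ Q + a (i + 1) * x ^ Q := by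
    intro i; simp [hc, fixPoly]
  refine ⟨∑ i ∈ Finset.range (m' + 1), c i • φ^[i] v, ?_, ?_⟩
  · intro h0
    rw [Finset.sum_range] at h0
    have h1 := Fintype.linearIndependent_iff.1 hli (fun i => c i) h0 ⟨m', by omega⟩
    exact hx0 (hx ▸ h1)
  · have hcm : c m' = x := hx
    have h1 : φ (∑ i ∈ Finset.range (m' + 1), c i • φ^[i] v) =
        ∑ i ∈ Finset.range (m' + 1), c i ^ Q • φ^[i + 1] v := by
      rw [map_sum]
      refine Finset.sum_congr rfl fun i _ => ?_
      rw [hφ, Function.iterate_succ_apply']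
    rw [h1, Finset.sum_range_succ, hcm, ← hrel, Finset.smul_sum, Finset.sum_range_succ',
      Finset.sum_range_succ' (fun i => c i • φ^[i] v), hc0, ← add_assoc,
      ← Finset.sum_add_distrib]
    congr 1
    · refine Finset.sum_congr rfl fun i _ => ?_
      rw [hcs, add_smul, smul_smul, mul_comm]
    · rw [smul_smul, mul_comm]

/-- Lang's theorem for a vector space: the vectors fixed by an injective `Q`-linear endomorphism
span. -/
theorem span_fixed_eq_top [FiniteDimensional F V] {Q : ℕ} (hQ : 2 ≤ Q)
    (φ : V →+ V) (hφ : ∀ (c : F) v, φ (c • v) = c ^ Q • φ v) (hinj : Function.Injective φ) :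
    Submodule.span F {v : V | φ v = v} = ⊤ := by
  set W := Submodule.span F {v : V | φ v = v} with hW
  by_contra hne
  have hmap : ∀ w ∈ W, φ w ∈ W := by
    intro w hw
    induction hw using Submodule.span_induction with
    | mem x hx => rw [show φ x = x from hx]; exact Submodule.subset_span hx
    | zero => rw [map_zero]; exact W.zero_mem
    | add x y _ _ hx hy => rw [map_add]; exact W.add_mem hx hy
    | smul a x _ hx => rw [hφ]; exact W.smul_mem _ hx
  -- `φ` is surjective on the span `W`, so that the induced map on `V ⧸ W` is injective
  have hsurj : ∀ w ∈ W, ∀ c : F, ∃ u ∈ W, φ u = c • w := by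
    intro w hw
    induction hw using Submodule.span_induction with
    | mem x hx =>
      intro c
      obtain ⟨d, hd⟩ := IsAlgClosed.exists_pow_nat_eq c (by omega : 0 < Q)
      exact ⟨d • x, W.smul_mem _ (Submodule.subset_span hx), by
        rw [hφ, hd, show φ x = x from hx]⟩
    | zero => exact fun c => ⟨0, W.zero_mem, by simp⟩
    | add x y _ _ hx hy =>
      intro c
      obtain ⟨u, hu, hu'⟩ := hx c
      obtain ⟨w, hw, hw'⟩ := hy c
      exact ⟨u + w, W.add_mem hu hw, by rw [map_add, hu', hw', smul_add]⟩
    | smul a x _ hx =>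
      intro c
      obtain ⟨u, hu, hu'⟩ := hx (c * a)
      exact ⟨u, hu, by rw [hu', smul_smul]⟩
  -- so is `φ - 1` by Artin–Schreier, which lifts fixed vectors of the quotient to `V`
  have hAS : ∀ w ∈ W, ∀ c : F, ∃ u ∈ W, φ u - u = c • w := by
    intro w hw
    induction hw using Submodule.span_induction with
    | mem x hx =>
      intro c
      have hdeg : (Polynomial.X ^ Q - Polynomial.X - Polynomial.C c : Polynomial F).degree ≠ 0 := by
        have h1 : (Polynomial.X + Polynomial.C c : Polynomial F).degree <
            (Polynomial.X ^ Q : Polynomial F).degree := by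
          rw [Polynomial.degree_X_add_C, Polynomial.degree_X_pow]
          exact_mod_cast (by omega : 1 < Q)
        rw [sub_sub, Polynomial.degree_sub_eq_left_of_degree_lt h1, Polynomial.degree_X_pow]
        exact_mod_cast (by omega : Q ≠ 0)
      obtain ⟨d, hd⟩ := IsAlgClosed.exists_root _ hdeg
      have hd' : d ^ Q - d = c := by simpa [Polynomial.IsRoot, sub_eq_zero] using hd
      exact ⟨d • x, W.smul_mem _ (Submodule.subset_span hx), by
        rw [hφ, show φ x = x from hx, ← sub_smul, hd']⟩
    | zero => exact fun c => ⟨0, W.zero_mem, by simp⟩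
    | add x y _ _ hx hy =>
      intro c
      obtain ⟨u, hu, hu'⟩ := hx c
      obtain ⟨w, hw, hw'⟩ := hy c
      exact ⟨u + w, W.add_mem hu hw, by rw [map_add, smul_add, ← hu', ← hw']; abel⟩
    | smul a x _ hx =>
      intro c
      obtain ⟨u, hu, hu'⟩ := hx (c * a)
      exact ⟨u, hu, by rw [hu', smul_smul]⟩
  have : Nontrivial (V ⧸ W) := Submodule.Quotient.nontrivial_iff.2 hne
  let ψ : V ⧸ W →+ V ⧸ W :=
    QuotientAddGroup.map W.toAddSubgroup W.toAddSubgroup φ (fun w hw => hmap w hw)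
  have hψ : ∀ v, ψ (W.mkQ v) = W.mkQ (φ v) := fun v => rfl
  obtain ⟨x, hx0, hx⟩ := exists_fixed_ne_zero (F := F) hQ ψ
    (by
      intro c x
      obtain ⟨v, rfl⟩ := W.mkQ_surjective x
      rw [← map_smul, hψ, hψ, hφ, map_smul])
    (by
      rw [injective_iff_map_eq_zero]
      intro x hx
      obtain ⟨v, rfl⟩ := W.mkQ_surjective x
      rw [hψ] at hx
      have h1 : φ v ∈ W := (Submodule.Quotient.mk_eq_zero W).1 hx
      obtain ⟨u, hu, hu'⟩ := hsurj _ h1 1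
      rw [one_smul] at hu'
      exact (Submodule.Quotient.mk_eq_zero W).2 (hinj hu' ▸ hu))
  obtain ⟨v, rfl⟩ := W.mkQ_surjective x
  rw [hψ, ← sub_eq_zero, ← map_sub] at hx
  obtain ⟨u, hu, hu'⟩ := hAS _ ((Submodule.Quotient.mk_eq_zero W).1 hx) (-1)
  apply hx0
  have h2 : v + u ∈ W := by
    refine Submodule.subset_span ?_
    change φ (v + u) = v + u
    rw [map_add, ← sub_eq_zero]
    have : φ v + φ u - (v + u) = (φ v - v) + (φ u - u) := by abel
    rw [this, hu']
    simp
  exact (Submodule.Quotient.mk_eq_zero W).2 ((W.add_mem_iff_left hu).1 h2)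

end Lang

end QBicForm

/-! ### Orthonormal bases of nondegenerate forms -/

namespace QBicForm

section Basic

variable {q : ℕ} {R : Type*} [CommRing R] {M : Type*} [AddCommGroup M] [Module R M]

theorem add_left (β : QBicForm q R M) (m n x : M) : β (m + n) x = β m x + β n x := by
  rw [β.map_add', LinearMap.add_apply]

theorem smul_left (β : QBicForm q R M) (c : R) (m x : M) : β (c • m) x = c ^ q * β m x := by
  rw [β.map_smul', LinearMap.smul_apply, smul_eq_mul]

/-- The additive map `m ↦ β(m^{[1]}, x)`. -/
def leftHom (β : QBicForm q R M) (x : M) : M →+ R :=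
  AddMonoidHom.mk' (fun m => β m x) fun m n => β.add_left m n x

theorem zero_left (β : QBicForm q R M) (x : M) : β 0 x = 0 := map_zero (β.leftHom x)

theorem sub_left (β : QBicForm q R M) (m n x : M) : β (m - n) x = β m x - β n x :=
  map_sub (β.leftHom x) m n

theorem sum_left (β : QBicForm q R M) {ι : Type*} (s : Finset ι) (f : ι → M) (x : M) :
    β (∑ i ∈ s, f i) x = ∑ i ∈ s, β (f i) x := map_sum (β.leftHom x) f s

/-- The restriction of a form to a submodule. -/
def restrict (β : QBicForm q R M) (N : Submodule R M) : QBicForm q R N where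
  toFun m := (β m).comp N.subtype
  map_add' m n := by ext x; exact β.add_left _ _ _
  map_smul' c m := by ext x; exact β.smul_left _ _ _

theorem restrict_apply (β : QBicForm q R M) (N : Submodule R M) (m n : N) :
    β.restrict N m n = β m n := rfl

theorem mem_rightOrtho (β : QBicForm q R M) (N : Submodule R M) (v : M) :
    v ∈ β.rightOrtho N ↔ ∀ w ∈ N, β w v = 0 := Iff.rfl

/-- A form is nondegenerate if the right orthogonal of the whole module vanishes. -/
def Nondeg (β : QBicForm q R M) : Prop := ∀ v, (∀ w, β w v = 0) → v = 0

end Basic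

section Hermitian

variable {p : ℕ} [Fact p.Prime] {e : ℕ} {F : Type*} [Field F] [CharP F p]
  {V : Type*} [AddCommGroup V] [Module F V]

theorem pow_add_pow (a b : F) : (a + b) ^ p ^ e = a ^ p ^ e + b ^ p ^ e :=
  add_pow_char_pow a b p e

/-- The evaluation of a nondegenerate form on the vectors of a basis in the first variable. -/
noncomputable def evalEquiv [FiniteDimensional F V] {β : QBicForm (p ^ e) F V} (hβ : β.Nondeg)
    {n : ℕ} (b : Module.Basis (Fin n) F V) : V ≃ₗ[F] (Fin n → F) :=
  LinearEquiv.ofInjectiveOfFinrankEq (LinearMap.pi fun i => β (b i))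
    (by
      rw [← LinearMap.ker_eq_bot, LinearMap.ker_eq_bot']
      intro v hv
      refine hβ v fun w => ?_
      rw [← b.sum_repr w, β.sum_left]
      refine Finset.sum_eq_zero fun i _ => ?_
      rw [β.smul_left]
      have : β (b i) v = 0 := congrFun hv i
      rw [this, mul_zero])
    (by rw [Module.finrank_fin_fun, Module.finrank_eq_card_basis b, Fintype.card_fin])

theorem evalEquiv_apply [FiniteDimensional F V] {β : QBicForm (p ^ e) F V} (hβ : β.Nondeg)
    {n : ℕ} (b : Module.Basis (Fin n) F V) (v : V) (i : Fin n) :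
    evalEquiv hβ b v i = β (b i) v := rfl

/-- A nondegenerate form on a finite-dimensional space is nondegenerate in the first variable,
although it is only `q`-linear there. -/
theorem Nondeg.left [FiniteDimensional F V] {β : QBicForm (p ^ e) F V} (hβ : β.Nondeg) {v : V}
    (hv : ∀ w, β v w = 0) : v = 0 := by
  set b := Module.finBasis F V
  rw [← b.sum_repr v]
  refine Finset.sum_eq_zero fun j _ => ?_
  have h1 := hv ((evalEquiv hβ b).symm (Pi.single j 1))
  rw [← b.sum_repr v, β.sum_left] at h1
  have h2 : ∀ i, β (b i) ((evalEquiv hβ b).symm (Pi.single j 1)) =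
      (Pi.single j 1 : Fin _ → F) i := by
    intro i
    rw [← evalEquiv_apply hβ b, LinearEquiv.apply_symm_apply]
  simp only [β.smul_left, h2] at h1
  rw [Finset.sum_eq_single j (by intro i _ hij; simp [hij]) (by simp), Pi.single_eq_same,
    mul_one] at h1
  rw [pow_eq_zero_iff (pow_ne_zero _ (Fact.out : p.Prime).ne_zero)] at h1
  rw [h1, zero_smul]

/-- The `q ^ 2`-linear endomorphism `φ` of `V` with `β(v, w) ^ q = β(w, φ v)` attached to a
nondegenerate form; its fixed vectors are the Hermitian vectors. -/
noncomputable def hermitianMap [FiniteDimensional F V] {β : QBicForm (p ^ e) F V}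
    (hβ : β.Nondeg) : V →+ V :=
  AddMonoidHom.mk' (fun v => (evalEquiv hβ (Module.finBasis F V)).symm
      fun i => β v (Module.finBasis F V i) ^ p ^ e)
    (by
      intro v w
      rw [← map_add]
      congr 1
      ext i
      rw [Pi.add_apply, ← pow_add_pow, β.add_left])

theorem apply_hermitianMap [FiniteDimensional F V] {β : QBicForm (p ^ e) F V}
    (hβ : β.Nondeg) (v w : V) : β w (hermitianMap hβ v) = β v w ^ p ^ e := by
  set b := Module.finBasis F V with hb
  have h : ∀ i, β (b i) (hermitianMap hβ v) = β v (b i) ^ p ^ e := by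
    intro i
    rw [← evalEquiv_apply hβ b]
    exact congrFun (LinearEquiv.apply_symm_apply _ _) i
  rw [← b.sum_repr w, β.sum_left, map_sum,
    show (∑ i, β v (b.repr w i • b i)) ^ p ^ e = ∑ i, β v (b.repr w i • b i) ^ p ^ e from
      sum_pow_char_pow p e _ _]
  refine Finset.sum_congr rfl fun i _ => ?_
  rw [β.smul_left, h, map_smul, smul_eq_mul, mul_pow]

theorem hermitianMap_smul [FiniteDimensional F V] {β : QBicForm (p ^ e) F V}
    (hβ : β.Nondeg) (c : F) (v : V) :
    hermitianMap hβ (c • v) = c ^ (p ^ e * p ^ e) • hermitianMap hβ v := by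
  rw [← sub_eq_zero]
  refine hβ _ fun w => ?_
  rw [map_sub, (β w).map_smul, apply_hermitianMap, apply_hermitianMap, β.smul_left, mul_pow,
    pow_mul, smul_eq_mul, sub_self]

theorem hermitianMap_injective [FiniteDimensional F V] {β : QBicForm (p ^ e) F V}
    (hβ : β.Nondeg) : Function.Injective (hermitianMap hβ) := by
  rw [injective_iff_map_eq_zero]
  intro v hv
  refine hβ.left fun w => ?_
  have h := apply_hermitianMap hβ v w
  rw [hv, map_zero] at h
  exact pow_eq_zero_iff (pow_ne_zero _ (Fact.out : p.Prime).ne_zero) |>.1 h.symm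

variable [IsAlgClosed F]

/-- Some element of the field with `q ^ 2` elements has nonzero trace to the field with `q`
elements. -/
theorem exists_add_pow_ne_zero (he : 1 ≤ e) :
    ∃ x : F, x ^ (p ^ e * p ^ e) = x ∧ x + x ^ p ^ e ≠ 0 := by
  classical
  by_contra! hall
  have hq : 2 ≤ p ^ e := (Fact.out : p.Prime).two_le.trans (Nat.le_self_pow (by omega) p)
  have hq2 : p ^ e < p ^ e * p ^ e := by nlinarith
  set f : Polynomial F := Polynomial.X ^ (p ^ e * p ^ e) - Polynomial.X with hf
  have hsep : f.Separable := galois_poly_separable p _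
    (dvd_mul_of_dvd_left (dvd_pow_self p (by omega)) _)
  have hdeg : f.natDegree = p ^ e * p ^ e := FiniteField.X_pow_card_sub_X_natDegree_eq F (by omega)
  set g : Polynomial F := Polynomial.X ^ p ^ e + Polynomial.X with hg
  have hgdeg : g.natDegree = p ^ e := by
    have : (Polynomial.X : Polynomial F).natDegree <
        (Polynomial.X ^ p ^ e : Polynomial F).natDegree := by
      rw [Polynomial.natDegree_X, Polynomial.natDegree_X_pow]; omega
    rw [hg, Polynomial.natDegree_add_eq_left_of_natDegree_lt this, Polynomial.natDegree_X_pow]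
  have hg0 : g ≠ 0 := by
    intro h; rw [h, Polynomial.natDegree_zero] at hgdeg; omega
  have hle : f.roots ≤ g.roots := by
    rw [Multiset.le_iff_subset (Polynomial.nodup_roots hsep)]
    intro x hx
    have hx' : x ^ (p ^ e * p ^ e) = x := by
      have := Polynomial.isRoot_of_mem_roots hx
      simpa [hf, Polynomial.IsRoot, sub_eq_zero] using this
    rw [Polynomial.mem_roots hg0]
    have := hall x hx'
    simp [hg, Polynomial.IsRoot, add_comm, this]
  have := Multiset.card_le_card hle
  rw [IsAlgClosed.card_roots_eq_natDegree, IsAlgClosed.card_roots_eq_natDegree, hdeg, hgdeg] at this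
  omega

/-- A nondegenerate form on a nonzero space has a vector `v` with `β(v, v) = 1` whose left and
right orthogonals coincide. -/
theorem Nondeg.exists_unit_vector [FiniteDimensional F V] [Nontrivial V]
    {β : QBicForm (p ^ e) F V} (hβ : β.Nondeg) (he : 1 ≤ e) :
    ∃ v : V, β v v = 1 ∧ ∀ w, β v w = 0 → β w v = 0 := by
  have hq : 2 ≤ p ^ e := (Fact.out : p.Prime).two_le.trans (Nat.le_self_pow (by omega) p)
  have hspan := span_fixed_eq_top (F := F) (by nlinarith : 2 ≤ p ^ e * p ^ e) (hermitianMap hβ)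
    (hermitianMap_smul hβ) (hermitianMap_injective hβ)
  -- on the fixed vectors, which span, `β` is Hermitian
  have hherm : ∀ v, hermitianMap hβ v = v → ∀ w, β w v = β v w ^ p ^ e := by
    intro v hv w
    rw [← apply_hermitianMap hβ, hv]
  obtain ⟨v, hv, hvv⟩ : ∃ v, hermitianMap hβ v = v ∧ β v v ≠ 0 := by
    by_contra! hall
    have hzero : ∀ u, hermitianMap hβ u = u → ∀ v, hermitianMap hβ v = v → β u v = 0 := by
      intro u hu v hv
      by_contra hz
      obtain ⟨x, hx, hx'⟩ := exists_add_pow_ne_zero (p := p) (F := F) he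
      have hz2 : β u v ^ (p ^ e * p ^ e) = β u v := by
        rw [pow_mul, ← hherm u hu v, ← hherm v hv u]
      -- `u + c v` with `β(u, v) c = x` is again a fixed vector, on which `β` takes the
      -- trace of `x` as value
      have hc : (x / β u v) ^ (p ^ e * p ^ e) = x / β u v := by rw [div_pow, hx, hz2]
      have hw : hermitianMap hβ (u + (x / β u v) • v) = u + (x / β u v) • v := by
        rw [map_add, hermitianMap_smul, hu, hv, hc]
      have h1 := hall _ hw
      rw [map_add, map_smul, β.add_left, β.add_left, β.smul_left, β.smul_left, hall u hu,
        hall v hv, hherm u hu v, ← mul_pow, smul_eq_mul, mul_zero, add_zero, zero_add,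
        div_mul_cancel₀ _ hz, add_comm] at h1
      exact hx' h1
    obtain ⟨v, hv⟩ := exists_ne (0 : V)
    refine hv (hβ v fun w => ?_)
    clear hv
    have hw : w ∈ Submodule.span F {v : V | hermitianMap hβ v = v} := hspan ▸ Submodule.mem_top
    have hv' : v ∈ Submodule.span F {v : V | hermitianMap hβ v = v} := hspan ▸ Submodule.mem_top
    induction hw using Submodule.span_induction with
    | mem x hx =>
      induction hv' using Submodule.span_induction with
      | mem y hy => exact hzero x hx y hy
      | zero => exact map_zero _
      | add y z _ _ hy hz => rw [map_add, hy, hz, add_zero]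
      | smul a y _ hy => rw [map_smul, hy, smul_zero]
    | zero => exact β.zero_left v
    | add x y _ _ hx hy => rw [β.add_left, hx, hy, add_zero]
    | smul a x _ hx => rw [β.smul_left, hx, mul_zero]
  -- scaling by `c` multiplies `β(v, v)` by `c ^ (q + 1)`
  obtain ⟨c, hc⟩ := IsAlgClosed.exists_pow_nat_eq (β v v)⁻¹ (Nat.succ_pos (p ^ e))
  have hc0 : c ≠ 0 := by
    rintro rfl
    rw [Nat.succ_eq_add_one, zero_pow (by omega)] at hc
    exact inv_ne_zero hvv hc.symm
  refine ⟨c • v, ?_, ?_⟩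
  · rw [map_smul, β.smul_left, smul_eq_mul, ← mul_assoc, ← pow_succ', hc, inv_mul_cancel₀ hvv]
  · intro w hw
    rw [β.smul_left] at hw
    have h1 : β v w = 0 := (mul_eq_zero.1 hw).resolve_left (pow_ne_zero _ hc0)
    rw [map_smul, hherm v hv w, h1, zero_pow (by omega), smul_zero]

/-- Over an algebraically closed field, a nondegenerate form has an orthonormal basis. -/
theorem Nondeg.exists_orthonormal_basis (he : 1 ≤ e) (n : ℕ) :
    ∀ {V : Type v} [AddCommGroup V] [Module F V] [FiniteDimensional F V]
      {β : QBicForm (p ^ e) F V}, β.Nondeg → Module.finrank F V = n →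
      ∃ b : Module.Basis (Fin n) F V, β.gram b = 1 := by
  induction n with
  | zero =>
    intro V _ _ _ β _ hn
    exact ⟨(Module.finBasis F V).reindex (finCongr hn), by ext i; exact i.elim0⟩
  | succ n ih =>
    intro V _ _ _ β hβ hn
    have : Nontrivial V := Module.nontrivial_of_finrank_pos (R := F) (by omega)
    obtain ⟨v, hvv, hv⟩ := hβ.exists_unit_vector he
    set C := LinearMap.ker (β v) with hC
    have hCn : Module.finrank F C = n := by
      have h1 := (β v).finrank_range_add_finrank_ker
      have h2 : LinearMap.range (β v) = ⊤ := by
        rw [LinearMap.range_eq_top]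
        intro a
        exact ⟨a • v, by simp [hvv]⟩
      rw [h2, ← hC, finrank_top, Module.finrank_self, hn] at h1
      omega
    have hnd : (β.restrict C).Nondeg := by
      intro u hu
      ext
      refine hβ _ fun w => ?_
      have h1 : w - β v w • v ∈ C := by
        rw [hC, LinearMap.mem_ker, map_sub, map_smul, hvv, smul_eq_mul, mul_one, sub_self]
      have h2 := hu ⟨_, h1⟩
      rw [restrict_apply, β.sub_left, β.smul_left, LinearMap.mem_ker.1 u.2, mul_zero,
        sub_zero] at h2
      exact h2
    obtain ⟨b, hb⟩ := ih hnd hCn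
    refine ⟨Module.Basis.mkFinCons v b ?_ ?_, ?_⟩
    · intro c x hx h
      have := congrArg (β v) h
      rw [map_add, map_smul, hvv, LinearMap.mem_ker.1 hx, map_zero] at this
      simpa using this
    · intro z
      refine ⟨-β v z, ?_⟩
      rw [hC, LinearMap.mem_ker, map_add, map_smul, hvv]
      simp
    · have hb' : ∀ i j, β (b i) (b j) = (1 : Matrix (Fin n) (Fin n) F) i j := fun i j => by
        rw [← hb]; rfl
      have h1 : ∀ i, β v (b i) = 0 := fun i => (b i).2
      have h2 : ∀ i, β (b i) v = 0 := fun i => hv _ (h1 i)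
      ext i j
      rw [gram, Matrix.of_apply, Module.Basis.coe_mkFinCons]
      refine Fin.cases ?_ (fun i => ?_) i <;> refine Fin.cases ?_ (fun j => ?_) j
      · simp [hvv]
      · simp [h1, (Fin.succ_ne_zero j).symm]
      · simp [h2]
      · simp [hb', Matrix.one_apply]

end Hermitian

end QBicForm

/-! ### Standard forms -/

namespace QBicForm

open Matrix

section Standard

/-- The index type of the standard form with `a` loops and a chain of length `ℓ c` for
each `c`. -/
abbrev StIdx (a : ℕ) {κ : Type*} (ℓ : κ → ℕ) : Type _ := Fin a ⊕ Σ c, Fin (ℓ c)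

/-- The Gram matrix of the standard form `1 ^ a ⊕ ⨁ N_{ℓ c}`: it has `a` basis vectors with
`β(f, f) = 1`, and for each `c` a chain of basis vectors `e_0, …, e_{ℓ c - 1}` with
`β(e_i, e_{i+1}) = 1`; all other entries vanish. Chains of length `0` are allowed. -/
def St (K : Type*) [Zero K] [One K] (a : ℕ) {κ : Type*} [DecidableEq κ] (ℓ : κ → ℕ) :
    Matrix (StIdx a ℓ) (StIdx a ℓ) K :=
  Matrix.of fun i j => match i, j with
    | .inl i, .inl j => if i = j then 1 else 0
    | .inr ⟨c, i⟩, .inr ⟨d, j⟩ => if c = d ∧ (i : ℕ) + 1 = j then 1 else 0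
    | _, _ => 0

/-- The functionals that take the first coordinate of each chain of a standard form. -/
def stTail (K : Type*) [Zero K] [One K] (a : ℕ) {κ : Type*} [DecidableEq κ] (ℓ : κ → ℕ) :
    Matrix κ (StIdx a ℓ) K :=
  Matrix.of fun c j => match j with
    | .inl _ => 0
    | .inr ⟨d, j⟩ => if c = d ∧ (j : ℕ) = 0 then 1 else 0

section entries

variable {K : Type*} [Zero K] [One K] {a : ℕ} {κ : Type*} [DecidableEq κ] {ℓ : κ → ℕ}

@[simp] theorem St_inl_inl (i j : Fin a) :
    St K a ℓ (.inl i) (.inl j) = if i = j then 1 else 0 := rfl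

@[simp] theorem St_inl_inr (i : Fin a) (x : Σ c, Fin (ℓ c)) :
    St K a ℓ (.inl i) (.inr x) = 0 := rfl

@[simp] theorem St_inr_inl (i : Fin a) (x : Σ c, Fin (ℓ c)) :
    St K a ℓ (.inr x) (.inl i) = 0 := rfl

@[simp] theorem St_inr_inr (x y : Σ c, Fin (ℓ c)) :
    St K a ℓ (.inr x) (.inr y) = if x.1 = y.1 ∧ (x.2 : ℕ) + 1 = y.2 then 1 else 0 := rfl

@[simp] theorem stTail_inl (c : κ) (i : Fin a) : stTail K a ℓ c (.inl i) = 0 := rfl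

@[simp] theorem stTail_inr (c : κ) (x : Σ c, Fin (ℓ c)) :
    stTail K a ℓ c (.inr x) = if c = x.1 ∧ (x.2 : ℕ) = 0 then 1 else 0 := rfl

end entries

theorem sigma_fin_ext {κ : Type*} {ℓ : κ → ℕ} {x y : Σ c, Fin (ℓ c)} (h1 : x.1 = y.1)
    (h2 : (x.2 : ℕ) = y.2) : x = y := by
  obtain ⟨c, i⟩ := x
  obtain ⟨d, j⟩ := y
  obtain rfl : c = d := h1
  obtain rfl : i = j := Fin.ext h2
  rfl

variable {p : ℕ} [Fact p.Prime] {e : ℕ} {K : Type*} [CommRing K] [CharP K p]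
  {κ κ' : Type*} [Fintype κ] [DecidableEq κ] [Fintype κ'] [DecidableEq κ']

/-- Reindexing the chains, and adding chains of length `0`, does not change a standard form. -/
theorem cong_St_of_injective (a : ℕ) {ℓ : κ → ℕ} {ℓ' : κ' → ℕ} (f : κ → κ')
    (hf : Function.Injective f) (h : ∀ c, ℓ' (f c) = ℓ c) (h0 : ∀ d, 0 < ℓ' d → d ∈ Set.range f) :
    Cong p e (St K a ℓ) (St K a ℓ') := by
  let σ : StIdx a ℓ → StIdx a ℓ' :=
    Sum.map id fun x => ⟨f x.1, Fin.cast (h x.1).symm x.2⟩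
  have hσ : Function.Bijective σ := by
    refine Function.Bijective.sumMap Function.bijective_id ⟨?_, ?_⟩
    · intro x y hxy
      have h1 := congrArg Sigma.fst hxy
      have h2 := congrArg (fun z : Σ d, Fin (ℓ' d) => (z.2 : ℕ)) hxy
      exact sigma_fin_ext (hf h1) h2
    · rintro ⟨d, j⟩
      obtain ⟨c, rfl⟩ := h0 d (by have := j.2; omega)
      exact ⟨⟨c, Fin.cast (h c) j⟩, sigma_fin_ext rfl rfl⟩
  refine (Cong.of_equiv (St K a ℓ') (St K a ℓ) (Equiv.ofBijective σ hσ) ?_).symm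
  rintro (i | x) (j | y) <;> simp [σ, hf.eq_iff]

theorem cong_St_sum (a b : ℕ) (ℓ : κ → ℕ) (ℓ' : κ' → ℕ) :
    Cong p e (fromBlocks (St K a ℓ) 0 0 (St K b ℓ')) (St K (a + b) (Sum.elim ℓ ℓ')) := by
  let σ : StIdx a ℓ ⊕ StIdx b ℓ' ≃ StIdx (a + b) (Sum.elim ℓ ℓ') :=
    (Equiv.sumSumSumComm _ _ _ _).trans
      (Equiv.sumCongr finSumFinEquiv 
        (Equiv.sumSigmaDistrib fun c => Fin (Sum.elim ℓ ℓ' c)).symm)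
  refine (Cong.of_equiv _ _ σ ?_).symm
  rintro ((i | ⟨c, x⟩) | (i | ⟨c, x⟩)) ((j | ⟨d, y⟩) | (j | ⟨d, y⟩)) <;>
    simp [σ, Equiv.sumSigmaDistrib, Fin.ext_iff] <;> omega

/-- The extension by the first coordinates of the chains lengthens every chain by `2`, including
the chains of length `0`. -/
theorem cong_extMat_St (a : ℕ) (ℓ : κ → ℕ) :
    Cong p e (extMat (St K a ℓ) (stTail K a ℓ)) (St K a fun c => ℓ c + 2) := by
  let σ : κ ⊕ (κ ⊕ StIdx a ℓ) → StIdx a fun c => ℓ c + 2 := fun x => match x with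
    | .inl c => .inr ⟨c, 0⟩
    | .inr (.inl c) => .inr ⟨c, 1⟩
    | .inr (.inr (.inl i)) => .inl i
    | .inr (.inr (.inr ⟨c, i⟩)) => .inr ⟨c, i.succ.succ⟩
  have hσ : Function.Bijective σ := by
    refine ⟨?_, ?_⟩
    · rintro (c | c | i | ⟨c, i⟩) (d | d | j | ⟨d, j⟩) hxy
      all_goals
        simp only [σ, Sum.inr.injEq, Sum.inl.injEq, reduceCtorEq] at hxy
      all_goals try
        have h1 := congrArg Sigma.fst hxy
        have h2 := congrArg (fun z : Σ d, Fin (ℓ d + 2) => (z.2 : ℕ)) hxy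
        simp at h1 h2
      · rw [h1]
      · rw [h1]
      · rw [hxy]
      · rw [sigma_fin_ext (x := ⟨c, i⟩) (y := ⟨d, j⟩) h1 h2]
    · rintro (i | ⟨c, i⟩)
      · exact ⟨.inr (.inr (.inl i)), rfl⟩
      · refine Fin.cases ⟨.inl c, rfl⟩ (fun i => ?_) i
        refine Fin.cases ⟨.inr (.inl c), rfl⟩ (fun i => ?_) i
        exact ⟨.inr (.inr (.inr ⟨c, i⟩)), rfl⟩
  refine (Cong.of_equiv _ _ (Equiv.ofBijective σ hσ) ?_).symm
  rintro (c | c | i | ⟨c, i⟩) (d | d | j | ⟨d, j⟩) <;>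
    simp [σ, extMat, Matrix.one_apply, eq_comm]

end Standard

section AdmissibleField

variable {F : Type*} [Field F] {κ ι : Type*} [Fintype κ] [Fintype ι] [DecidableEq κ]
  [DecidableEq ι]

theorem admissible_of_forall {B : Matrix ι ι F} {A : Matrix κ ι F}
    (h : ∀ v, B *ᵥ v = 0 → A *ᵥ v = 0 → v = 0) : Admissible B A := by
  obtain ⟨L, hL⟩ := (B.mulVecLin.prod A.mulVecLin).exists_leftInverse_of_injective (by
    rw [LinearMap.ker_eq_bot']
    intro v hv
    exact h v (congrArg Prod.fst hv) (congrArg Prod.snd hv))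
  refine ⟨LinearMap.toMatrix' (L ∘ₗ LinearMap.inl F _ _),
    LinearMap.toMatrix' (L ∘ₗ LinearMap.inr F _ _), ?_⟩
  apply Matrix.toLin'.injective
  rw [map_add, Matrix.toLin'_mul, Matrix.toLin'_mul, Matrix.toLin'_toMatrix',
    Matrix.toLin'_toMatrix', Matrix.toLin'_one]
  refine LinearMap.ext fun v => ?_
  have := LinearMap.congr_fun hL v
  simp only [LinearMap.comp_apply, LinearMap.add_apply, ← map_add] at this ⊢
  simpa using this

/-- The first coordinates of the chains form an admissible family of functionals. -/
theorem admissible_stTail (a : ℕ) (ℓ : κ → ℕ) : Admissible (St F a ℓ) (stTail F a ℓ) := by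
  refine admissible_of_forall fun v hB hA => ?_
  ext i
  rcases i with i | ⟨c, ⟨_ | j, hj⟩⟩
  · have h1 := congrFun hB (.inl i)
    rw [Matrix.mulVec, dotProduct, Finset.sum_eq_single (.inl i)] at h1
    · simpa using h1
    · rintro (k | k) _ hk
      · have : i ≠ k := fun h => hk (by rw [h])
        simp [this]
      · simp
    · simp
  · have h1 := congrFun hA c
    rw [Matrix.mulVec, dotProduct, Finset.sum_eq_single (.inr ⟨c, ⟨0, hj⟩⟩)] at h1
    · simpa using h1
    · rintro (k | k) _ hk
      · simp
      · have : ¬ (c = k.1 ∧ (k.2 : ℕ) = 0) := fun h =>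
          hk (congrArg _ (sigma_fin_ext h.1.symm h.2))
        simp [this]
    · simp
  · have h1 := congrFun hB (.inr ⟨c, ⟨j, by omega⟩⟩)
    rw [Matrix.mulVec, dotProduct, Finset.sum_eq_single (.inr ⟨c, ⟨j + 1, hj⟩⟩)] at h1
    · simpa using h1
    · rintro (k | k) _ hk
      · simp
      · have : ¬ (c = k.1 ∧ j + 1 = (k.2 : ℕ)) := fun h =>
          hk (congrArg _ (sigma_fin_ext h.1.symm h.2.symm))
        simp [this]
    · simp

theorem Admissible.congr {ι' : Type*} [Fintype ι'] [DecidableEq ι'] {p : ℕ} [Fact p.Prime]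
    {e : ℕ} [CharP F p] {B : Matrix ι ι F} {A : Matrix κ ι F} (hA : Admissible B A)
    (g : Matrix ι ι' F) (h : Matrix ι' ι F) (hgh : g * h = 1) (hhg : h * g = 1) :
    Admissible ((tw p e g)ᵀ * B * g) (A * g) := by
  obtain ⟨P, Q, hPQ⟩ := hA
  have h1 : (tw p e h)ᵀ * (tw p e g)ᵀ = 1 := by
    rw [← transpose_mul, ← tw_mul, hgh, tw_one, transpose_one]
  refine ⟨h * P * (tw p e h)ᵀ, h * Q, ?_⟩
  calc h * P * (tw p e h)ᵀ * ((tw p e g)ᵀ * B * g) + h * Q * (A * g)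
      = h * P * ((tw p e h)ᵀ * (tw p e g)ᵀ) * B * g + h * Q * (A * g) := by
        simp only [Matrix.mul_assoc]
    _ = h * (P * B + Q * A) * g := by
        rw [h1, Matrix.mul_one, Matrix.mul_add, Matrix.add_mul]
        simp only [Matrix.mul_assoc]
    _ = 1 := by rw [hPQ, Matrix.mul_one, hhg]

/-- An admissible family of functionals for a standard form has at least as many members as
there are nonempty chains. -/
theorem Admissible.card_le {κ' : Type*} [Fintype κ'] [DecidableEq κ'] {a : ℕ} {ℓ : κ' → ℕ}
    {A : Matrix κ (StIdx a ℓ) F} (hA : Admissible (St F a ℓ) A) :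
    Fintype.card {c // 0 < ℓ c} ≤ Fintype.card κ := by
  obtain ⟨P, Q, hPQ⟩ := hA
  let s : {c // 0 < ℓ c} → StIdx a ℓ := fun c => .inr ⟨c.1, ⟨0, c.2⟩⟩
  have hs : Function.Injective s := by
    intro c d hcd
    have := congrArg Sigma.fst (Sum.inr_injective hcd)
    exact Subtype.ext this
  have h1 : Q.submatrix s id * A.submatrix id s = 1 := by
    ext c d
    have h2 := congrFun (congrFun hPQ (s c)) (s d)
    have h3 : (P * St F a ℓ) (s c) (s d) = 0 := by
      rw [Matrix.mul_apply]
      refine Finset.sum_eq_zero fun k _ => ?_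
      rcases k with k | k <;> simp [s]
    rw [Matrix.add_apply, h3, zero_add] at h2
    rw [Matrix.one_apply] at h2 ⊢
    rw [Matrix.mul_apply] at h2 ⊢
    simpa [hs.eq_iff] using h2
  have h4 := Matrix.rank_mul_le_left (Q.submatrix s id) (A.submatrix id s)
  rw [h1, Matrix.rank_one] at h4
  exact h4.trans (Matrix.rank_le_card_width _)

end AdmissibleField

end QBicForm

/-! ### Classification over algebraically closed fields -/

namespace QBicForm

open Matrix

section GramChange

variable {p : ℕ} [Fact p.Prime] {e : ℕ} {R : Type*} [CommRing R] [CharP R p]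
  {M : Type*} [AddCommGroup M] [Module R M] {ι ι' : Type*} [Fintype ι] [Fintype ι']
  [DecidableEq ι] [DecidableEq ι']

theorem gram_apply {q : ℕ} {ι : Type*} (β : QBicForm q R M) (b : Module.Basis ι R M) (i j : ι) :
    β.gram b i j = β (b i) (b j) := rfl

/-- The Gram matrix of a family of linear combinations of basis vectors. -/
theorem gram_comb (β : QBicForm (p ^ e) R M) (b : Module.Basis ι R M) (g : Matrix ι ι' R)
    (j l : ι') : β (∑ i, g i j • b i) (∑ k, g k l • b k) =
      ((tw p e g)ᵀ * β.gram b * g) j l := by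
  rw [β.sum_left]
  simp only [map_sum, β.smul_left, map_smul, smul_eq_mul, Matrix.mul_apply, transpose_apply,
    tw_apply, gram_apply, Finset.sum_mul]
  rw [Finset.sum_comm]
  refine Finset.sum_congr rfl fun i _ => ?_
  rw [Finset.mul_sum]
  refine Finset.sum_congr rfl fun k _ => ?_
  ring

theorem cong_gram_gram (β : QBicForm (p ^ e) R M) (b : Module.Basis ι R M)
    (b' : Module.Basis ι' R M) : Cong p e (β.gram b) (β.gram b') := by
  refine ⟨b.toMatrix b', b'.toMatrix b, Module.Basis.toMatrix_mul_toMatrix_flip _ _,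
    Module.Basis.toMatrix_mul_toMatrix_flip _ _, ?_⟩
  ext j l
  rw [← gram_comb, Module.Basis.sum_toMatrix_smul_self, Module.Basis.sum_toMatrix_smul_self]
  rfl

theorem Cong.exists_basis {β : QBicForm (p ^ e) R M} {b : Module.Basis ι R M}
    {C : Matrix ι' ι' R} (h : Cong p e (β.gram b) C) :
    ∃ b' : Module.Basis ι' R M, β.gram b' = C := by
  obtain ⟨g, h, hgh, hhg, hC⟩ := h
  let E : (ι → R) ≃ₗ[R] (ι' → R) := LinearEquiv.ofLinearMap h.mulVecLin g.mulVecLin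
    (by rw [← mulVecLin_mul, hhg, mulVecLin_one]) (by rw [← mulVecLin_mul, hgh, mulVecLin_one])
  refine ⟨Module.Basis.ofEquivFun (b.equivFun.trans E), ?_⟩
  have hb : ∀ j, Module.Basis.ofEquivFun (b.equivFun.trans E) j = ∑ i, g i j • b i := by
    intro j
    rw [Module.Basis.coe_ofEquivFun]
    change b.equivFun.symm (E.symm (Pi.single j 1)) = _
    rw [Module.Basis.equivFun_symm_apply]
    refine Finset.sum_congr rfl fun i _ => ?_
    congr 1
    change (g *ᵥ Pi.single j 1) i = _
    simp
  ext j l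
  rw [gram_apply, hb, hb, gram_comb, hC]

/-- The basis of a module obtained from bases of two complementary submodules. -/
theorem exists_basis_of_isCompl {ι ι' : Type*} {N₁ N₂ : Submodule R M} (h : IsCompl N₁ N₂)
    (b₁ : Module.Basis ι R N₁) (b₂ : Module.Basis ι' R N₂) :
    ∃ b : Module.Basis (ι ⊕ ι') R M, (∀ i, b (.inl i) = b₁ i) ∧ ∀ i, b (.inr i) = b₂ i := by
  refine ⟨(b₁.prod b₂).map (Submodule.prodEquivOfIsCompl N₁ N₂ h), ?_, ?_⟩ <;> intro i <;>
    simp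

end GramChange

section Classification

variable {p : ℕ} [Fact p.Prime] {e : ℕ} {F : Type*} [Field F] [CharP F p]

/-- Over a perfect field, the extension of a standard form by any admissible functionals is again
standard. -/
theorem cong_extMat_St_of_admissible [PerfectRing F p] {κ κ' : Type} [Fintype κ] [DecidableEq κ]
    [Fintype κ'] [DecidableEq κ'] {a : ℕ} {ℓ : κ' → ℕ} {A : Matrix κ (StIdx a ℓ) F}
    (hA : Admissible (St F a ℓ) A) :
    ∃ ℓ' : κ → ℕ, Cong p e (extMat (St F a ℓ) A) (St F a ℓ') := by
  obtain ⟨f⟩ := Function.Embedding.nonempty_of_card_le hA.card_le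
  let ℓ₁ : κ → ℕ := Function.extend f (fun c => ℓ c.1) 0
  have h1 : Cong p e (St F a ℓ) (St F a ℓ₁) := by
    refine Cong.trans (Cong.symm (cong_St_of_injective (ℓ := fun c : {c // 0 < ℓ c} => ℓ c.1) a
      Subtype.val Subtype.val_injective (fun c => rfl) fun d hd => ⟨⟨d, hd⟩, rfl⟩)) ?_
    refine cong_St_of_injective a f f.injective (fun c => f.injective.extend_apply _ _ _) ?_
    intro d hd
    by_contra hnot
    have : ℓ₁ d = 0 := Function.extend_apply' _ _ _ hnot
    omega
  obtain ⟨g, h, hgh, hhg, hC⟩ := h1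
  have h2 := Cong.extMat_right A g h hgh hhg hC
  have hadm := hA.congr (p := p) (e := e) g h hgh hhg
  rw [hC] at hadm
  obtain ⟨H, Z, hH, hHZ⟩ := hadm.exists_eq (admissible_stTail a ℓ₁)
  have h3 := cong_extMat_of_eq (p := p) (e := e) (RingHom.id F)
    ((iterateFrobeniusEquiv F p (e + e)).symm : F →+* F) (by
      intro x
      rw [← pow_mul, ← pow_add]
      exact ((iterateFrobeniusEquiv F p (e + e)).apply_symm_apply x).symm) H Z hH hHZ
  simp only [RingHom.coe_id, Matrix.map_id] at h3
  exact ⟨_, (h2.trans h3).trans (cong_extMat_St a ℓ₁)⟩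

theorem exists_root_pow [PerfectRing F p] (x : F) : ∃ y : F, y ^ p ^ e = x :=
  ⟨(iterateFrobeniusEquiv F p e).symm x, (iterateFrobeniusEquiv F p e).apply_symm_apply x⟩

theorem exists_tw_eq [PerfectRing F p] {m n : Type*} (M : Matrix m n F) :
    ∃ N : Matrix m n F, tw p e N = M := by
  choose f hf using fun i j => exists_root_pow (p := p) (e := e) (M i j)
  exact ⟨Matrix.of f, by ext i j; exact hf i j⟩

/-- The form has a basis in which its Gram matrix is a standard one. -/
def HasStBasis {V : Type v} [AddCommGroup V] [Module F V] (β : QBicForm (p ^ e) F V) : Prop :=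
  ∃ (a : ℕ) (κ : Type) (_ : Fintype κ) (_ : DecidableEq κ) (ℓ : κ → ℕ)
    (b : Module.Basis (StIdx a ℓ) F V), β.gram b = St F a ℓ

variable {V : Type v} [AddCommGroup V] [Module F V] [FiniteDimensional F V]

/-- A form with a vector orthogonal to everything on both sides splits off a chain of
length `1`. -/
theorem HasStBasis.of_radical {β : QBicForm (p ^ e) F V} {z : V} (hz0 : z ≠ 0)
    (hz : ∀ w, β z w = 0) (hz' : ∀ w, β w z = 0)
    (ih : ∀ N : Submodule F V, Module.finrank F N < Module.finrank F V →
      (β.restrict N).HasStBasis) : β.HasStBasis := by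
  obtain ⟨C, hC⟩ := (Submodule.span F {z}).exists_isCompl
  have hdim := Submodule.finrank_add_eq_of_isCompl hC
  rw [finrank_span_singleton hz0] at hdim
  obtain ⟨a, κ, _, _, ℓ, b, hb⟩ := ih C (by omega)
  obtain ⟨b', hb1, hb2⟩ := exists_basis_of_isCompl hC
    ((Module.Basis.singleton Unit F).map (LinearEquiv.toSpanNonzeroSingleton F V z hz0)) b
  have hb1' : ∀ i, b' (.inl i) = z := by
    intro i
    rw [hb1]
    simp
  have hgram : β.gram b' = fromBlocks 0 0 0 (St F a ℓ) := by
    ext (i | i) (j | j)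
    · simp [gram_apply, hb1', hz]
    · simp [gram_apply, hb1', hz]
    · simp [gram_apply, hb1', hz']
    · rw [gram_apply, hb2, hb2, fromBlocks_apply₂₂, ← hb]; rfl
  have h1 : Cong p e (0 : Matrix Unit Unit F) (St F 0 fun _ : Unit => 1) := by
    let σ : StIdx 0 (fun _ : Unit => 1) → Unit := fun _ => ()
    refine Cong.of_equiv _ _ (Equiv.ofBijective σ ⟨?_, ?_⟩) ?_
    · rintro (i | x) (j | y) _
      · exact i.elim0
      · exact i.elim0
      · exact j.elim0
      · exact congrArg _ (sigma_fin_ext rfl (by omega))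
    · exact fun _ => ⟨.inr ⟨(), 0⟩, rfl⟩
    · rintro (i | x) (j | y) <;> (simp; try omega)
  have h2 : Cong p e (β.gram b') (St F (0 + a) (Sum.elim (fun _ : Unit => 1) ℓ)) := by
    rw [hgram]
    exact (h1.blockDiag (Cong.refl _)).trans (cong_St_sum _ _ _ _)
  obtain ⟨b'', hb''⟩ := h2.exists_basis
  exact ⟨_, _, inferInstance, inferInstance, _, b'', hb''⟩

/-- A form whose two-sided radical vanishes while its right radical `X` does not is an extension:
the right radical, paired with a complement of its own orthogonal `X^⊥`, gives the new vectors,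
and the old form lives on a complement of `X` in `X^⊥`. -/
theorem HasStBasis.of_rightRadical [PerfectRing F p] {β : QBicForm (p ^ e) F V}
    (hrad : ∀ z, (∀ w, β z w = 0) → (∀ w, β w z = 0) → z = 0) (hX : β.rightOrtho ⊤ ≠ ⊥)
    (ih : ∀ (W : Type v) [AddCommGroup W] [Module F W] [FiniteDimensional F W]
      (γ : QBicForm (p ^ e) F W), Module.finrank F W < Module.finrank F V → γ.HasStBasis) :
    β.HasStBasis := by
  set X := β.rightOrtho ⊤ with hXdef
  have hXr : ∀ x ∈ X, ∀ w, β w x = 0 := fun x hx w => hx w Submodule.mem_top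
  obtain ⟨C, hC⟩ := X.exists_isCompl
  have hdim := Submodule.finrank_add_eq_of_isCompl hC
  have hXpos : 0 < Module.finrank F X := by
    rw [Module.finrank_pos_iff, Submodule.nontrivial_iff_ne_bot]
    exact hX
  set U : Submodule F C := (β.rightOrtho X).comap C.subtype with hU
  have hUX : ∀ u ∈ U, ∀ x ∈ X, β x (u : V) = 0 := fun u hu x hx => hu x hx
  have hUdim : Module.finrank F U ≤ Module.finrank F C := Submodule.finrank_le U
  obtain ⟨Y, hY⟩ := U.exists_isCompl
  obtain ⟨a, κ₀, _, _, ℓ, u, hu⟩ := ih U ((β.restrict C).restrict U) (by omega)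
  set y := Module.finBasis F Y with hy
  set r := Module.finrank F Y
  set bX := Module.finBasis F X with hbX
  -- the pairing of `X` with `Y` is nondegenerate on the side of `Y`
  set D : Matrix (Fin (Module.finrank F X)) (Fin r) F :=
    Matrix.of fun i d => β (bX i : V) ((y d : C) : V) with hD
  have hDinj : ∀ v, D *ᵥ v = 0 → v = 0 := by
    intro v hv
    have h1 : (∑ d, v d • y d : Y) = 0 := by
      have h2 : ((∑ d, v d • y d : Y) : C) ∈ U := by
        rw [hU, Submodule.mem_comap, mem_rightOrtho]
        intro x hx
        have h3 : β x (((∑ d, v d • y d : Y) : C) : V) = ∑ d, v d * β x ((y d : C) : V) := by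
          simp [map_sum]
        have h4 : x = ∑ i, bX.repr ⟨x, hx⟩ i • (bX i : V) := by
          have := congrArg Subtype.val (bX.sum_repr ⟨x, hx⟩)
          simp only [Submodule.coe_sum, Submodule.coe_smul] at this
          exact this.symm
        rw [Submodule.subtype_apply, h3, h4]
        simp only [β.sum_left, β.smul_left, Finset.mul_sum]
        rw [Finset.sum_comm]
        refine Finset.sum_eq_zero fun i _ => ?_
        have h5 := congrFun hv i
        simp only [Matrix.mulVec, dotProduct, hD, Matrix.of_apply, Pi.zero_apply] at h5
        calc _ = bX.repr ⟨x, hx⟩ i ^ p ^ e * ∑ d, β (bX i : V) ((y d : C) : V) * v d := by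
              rw [Finset.mul_sum]
              refine Finset.sum_congr rfl fun d _ => ?_
              ring
          _ = 0 := by rw [h5, mul_zero]
      have h6 := (Submodule.disjoint_def.1 hY.disjoint) _ h2 (∑ d, v d • y d : Y).2
      exact Subtype.ext h6
    ext d
    exact Fintype.linearIndependent_iff.1 y.linearIndependent v h1 d
  -- the vectors of `X` dual to the basis of `Y`
  obtain ⟨P, L, hL⟩ : ∃ (P : Matrix (Fin r) (Fin r) F) (L : _), P * 0 + L * D = 1 :=
    admissible_of_forall (B := 0) fun v _ hv => hDinj v hv
  obtain ⟨L', hL'⟩ := exists_tw_eq (p := p) (e := e) L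
  have hLp : ∀ i j, L' i j ^ p ^ e = L i j := fun i j => by rw [← hL']; rfl
  set x : Fin r → X := fun c => ∑ i, L' c i • bX i with hx
  have hxy : ∀ c d, β (x c : V) ((y d : C) : V) = (1 : Matrix (Fin r) (Fin r) F) c d := by
    intro c d
    have h1 : (x c : V) = ∑ i, L' c i • (bX i : V) := by simp [hx]
    rw [h1, β.sum_left, ← hL]
    simp [Matrix.mul_apply, β.smul_left, hLp, hD]
  have hXXr : ∀ z ∈ X, (∀ d, β z ((y d : C) : V) = 0) → z = 0 := by
    intro z hz hzy
    refine hrad z (fun w => ?_) (hXr z hz)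
    obtain ⟨w₁, hw₁, w₂, hw₂, rfl⟩ := Submodule.mem_sup.1
      (hC.codisjoint.eq_top ▸ Submodule.mem_top : w ∈ X ⊔ C)
    obtain ⟨u₁, hu₁, u₂, hu₂, h12⟩ := Submodule.mem_sup.1
      (hY.codisjoint.eq_top ▸ Submodule.mem_top : (⟨w₂, hw₂⟩ : C) ∈ U ⊔ Y)
    have h1 : w₂ = (u₁ : V) + (u₂ : V) := by
      have := congrArg Subtype.val h12
      simpa using this.symm
    have h2 : β z (u₂ : V) = 0 := by
      have h3 := congrArg (fun t : Y => ((t : C) : V)) (y.sum_repr ⟨u₂, hu₂⟩)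
      simp only [Submodule.coe_sum, Submodule.coe_smul] at h3
      rw [← h3, map_sum]
      refine Finset.sum_eq_zero fun d _ => ?_
      rw [map_smul, hzy, smul_zero]
    rw [map_add, hXr w₁ hw₁, h1, map_add, hUX u₁ hu₁ z hz, h2]
    simp
  have hxli : LinearIndependent F x := by
    rw [Fintype.linearIndependent_iff]
    intro c hc d
    have h1 : (∑ i, c i • (x i : V)) = 0 := by
      have := congrArg Subtype.val hc
      simpa using this
    have h2 := congrArg (fun t => β t ((y d : C) : V)) h1
    simp only [β.sum_left, β.smul_left, hxy, β.zero_left, Matrix.one_apply] at h2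
    simpa [(Fact.out : p.Prime).ne_zero] using h2
  have hxsp : ⊤ ≤ Submodule.span F (Set.range x) := by
    rintro z -
    choose c hc using fun d => exists_root_pow (p := p) (e := e) (β (z : V) ((y d : C) : V))
    have h1 : z - ∑ i, c i • x i = 0 := by
      refine Subtype.ext (hXXr _ (z - ∑ i, c i • x i).2 fun d => ?_)
      have h2 : ((z - ∑ i, c i • x i : X) : V) = (z : V) - ∑ i, c i • (x i : V) := by simp
      rw [h2, β.sub_left, β.sum_left, sub_eq_zero]
      simp [β.smul_left, hxy, Matrix.one_apply, hc]
    rw [sub_eq_zero.1 h1]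
    exact Submodule.sum_mem _ fun i _ =>
      Submodule.smul_mem _ _ (Submodule.subset_span ⟨i, rfl⟩)
  obtain ⟨bC, hbC1, hbC2⟩ := exists_basis_of_isCompl hY.symm y u
  obtain ⟨b, hb1, hb2⟩ := exists_basis_of_isCompl hC (Module.Basis.mk hxli hxsp) bC
  have hbx : ∀ c, b (.inl c) = (x c : V) := fun c => by rw [hb1, Module.Basis.mk_apply]
  have hby : ∀ d, b (.inr (.inl d)) = ((y d : C) : V) := fun d => by rw [hb2, hbC1]
  have hbu : ∀ i, b (.inr (.inr i)) = ((u i : C) : V) := fun i => by rw [hb2, hbC2]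
  have huu : ∀ i j, β ((u i : C) : V) ((u j : C) : V) = St F a ℓ i j := fun i j => by
    rw [← hu]; rfl
  obtain ⟨G, hG⟩ := exists_tw_eq (p := p) (e := e)
    (Matrix.of fun d c => β ((y c : C) : V) ((y d : C) : V))
  obtain ⟨E, hE⟩ := exists_tw_eq (p := p) (e := e)
    (Matrix.of fun d i => β ((u i : C) : V) ((y d : C) : V))
  set A : Matrix (Fin r) (StIdx a ℓ) F :=
    Matrix.of fun d i => β ((y d : C) : V) ((u i : C) : V) with hAdef
  have hgram : β.gram b = fromBlocks 0 (fromCols 1 0) 0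
      (fromBlocks (tw p e G)ᵀ A (tw p e E)ᵀ (St F a ℓ)) := by
    rw [hG, hE]
    ext (c | c | i) (d | d | j)
    · simp [gram_apply, hbx, hXr _ (x d).2]
    · simp [gram_apply, hbx, hby, hxy]
    · simp [gram_apply, hbx, hbu, hUX _ (u j).2 _ (x c).2]
    · simp [gram_apply, hbx, hXr _ (x d).2]
    · simp [gram_apply, hby]
    · simp [gram_apply, hby, hbu, hAdef]
    · simp [gram_apply, hbx, hXr _ (x d).2]
    · simp [gram_apply, hby, hbu]
    · rw [gram_apply, hbu, hbu, huu]; rfl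
  have hadm : Admissible (St F a ℓ) A := by
    refine admissible_of_forall fun v hv1 hv2 => ?_
    have h0 : (∑ i, v i • u i : U) = 0 := by
      have hval : (((∑ i, v i • u i : U) : C) : V) = ∑ i, v i • ((u i : C) : V) := by simp
      have hmem : (((∑ i, v i • u i : U) : C) : V) ∈ X := by
        intro w _
        have hker : ∀ k, β (b k) (∑ i, v i • ((u i : C) : V)) = 0 := by
          rintro (c | d | j)
          · rw [hbx, ← hval]
            exact hUX _ (∑ i, v i • u i : U).2 _ (x c).2
          · have := congrFun hv2 d
            simp only [Matrix.mulVec, dotProduct, hAdef, Matrix.of_apply, Pi.zero_apply] at this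
            rw [hby, map_sum, ← this]
            refine Finset.sum_congr rfl fun i _ => ?_
            rw [map_smul, smul_eq_mul, mul_comm]
          · have := congrFun hv1 j
            simp only [Matrix.mulVec, dotProduct, Pi.zero_apply] at this
            rw [hbu, map_sum, ← this]
            refine Finset.sum_congr rfl fun i _ => ?_
            rw [map_smul, smul_eq_mul, mul_comm, huu]
        rw [hval, ← b.sum_repr w, β.sum_left]
        refine Finset.sum_eq_zero fun k _ => ?_
        rw [β.smul_left, hker, mul_zero]
      have h1 := (Submodule.disjoint_def.1 hC.disjoint) _ hmem ((∑ i, v i • u i : U) : C).2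
      exact Subtype.ext (Subtype.ext h1)
    ext i
    exact Fintype.linearIndependent_iff.1 u.linearIndependent v h0 i
  obtain ⟨ℓ', hℓ'⟩ := cong_extMat_St_of_admissible (p := p) (e := e) hadm
  have h1 : Cong p e (β.gram b) (St F a ℓ') := by
    rw [hgram]
    refine (cong_extMat_of_junk _ _ _ 1 _ _ ?_ isUnit_one).trans hℓ'
    rw [tw_one, transpose_one, Matrix.one_mul]
  obtain ⟨b'', hb''⟩ := h1.exists_basis
  exact ⟨_, _, inferInstance, inferInstance, _, b'', hb''⟩

/-- Over an algebraically closed field every form is standard in a suitable basis. -/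
theorem hasStBasis [IsAlgClosed F] (he : 1 ≤ e) (β : QBicForm (p ^ e) F V) : β.HasStBasis := by
  induction hn : Module.finrank F V using Nat.strong_induction_on generalizing V with
  | _ n ih =>
    subst hn
    by_cases hnd : β.Nondeg
    · obtain ⟨b, hb⟩ := hnd.exists_orthonormal_basis he _ rfl
      let σ : StIdx (Module.finrank F V) (fun _ : Empty => 0) ≃ Fin (Module.finrank F V) :=
        Equiv.sumEmpty _ _
      have h1 : Cong p e (β.gram b) (St F (Module.finrank F V) fun _ : Empty => 0) := by
        refine Cong.of_equiv _ _ σ ?_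
        rintro (i | ⟨x, _⟩) (j | ⟨y, _⟩)
        · simp [hb, σ, Matrix.one_apply]
        · exact y.elim
        · exact x.elim
        · exact x.elim
      obtain ⟨b'', hb''⟩ := h1.exists_basis
      exact ⟨_, _, inferInstance, inferInstance, _, b'', hb''⟩
    · by_cases hrad : ∀ z, (∀ w, β z w = 0) → (∀ w, β w z = 0) → z = 0
      · refine HasStBasis.of_rightRadical hrad ?_ fun W _ _ _ γ hW => ih _ hW γ rfl
        intro hX
        refine hnd fun v hv => ?_
        have : v ∈ β.rightOrtho ⊤ := fun w _ => hv w
        rwa [hX, Submodule.mem_bot] at this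
      · push Not at hrad
        obtain ⟨z, hz, hz', hz0⟩ := hrad
        exact HasStBasis.of_radical hz0 hz hz' fun N hN => ih _ hN _ rfl

end Classification

end QBicForm

/-! ### The invariants of a standard form -/

namespace QBicForm

open Matrix

section PerpFil

variable {q : ℕ} {R : Type*} [CommRing R] {M : Type*} [AddCommGroup M] [Module R M]

theorem rightOrtho_anti (β : QBicForm q R M) {N N' : Submodule R M} (h : N ≤ N') :
    β.rightOrtho N' ≤ β.rightOrtho N := fun _ hv w hw => hv w (h hw)

theorem perpFil_alternating (β : QBicForm q R M) (j : ℕ) :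
    (Even j → β.perpFil j ≤ β.perpFil (j + 2)) ∧ (Odd j → β.perpFil (j + 2) ≤ β.perpFil j) := by
  induction j with
  | zero => exact ⟨fun _ => bot_le, fun h => absurd h (by decide)⟩
  | succ j ih =>
    refine ⟨fun h => ?_, fun h => ?_⟩
    · exact β.rightOrtho_anti (ih.2 (by rwa [Nat.even_add_one, Nat.not_even_iff_odd] at h))
    · exact β.rightOrtho_anti (ih.1 (by rwa [Nat.odd_add_one, Nat.not_odd_iff_even] at h))

variable {k : Type*} [Field k] {V : Type*} [AddCommGroup V] [Module k V] [FiniteDimensional k V]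

theorem finrank_quotient_submoduleOf {P Q : Submodule k V} (h : Q ≤ P) :
    (Module.finrank k (P ⧸ Q.submoduleOf P) : ℤ) = Module.finrank k P - Module.finrank k Q := by
  have h1 := (Q.submoduleOf P).finrank_quotient_add_finrank
  rw [(Submodule.submoduleOfEquivOfLe h).finrank_eq] at h1
  omega

/-- Since the filtration is increasing on even and decreasing on odd indices, the `a_m` are
differences of dimensions. -/
theorem aInv_succ (β : QBicForm q k V) (m : ℕ) :
    (β.aInv (m + 1) : ℤ) = if Even m
      then (Module.finrank k (β.perpFil (m + 2)) : ℤ) - Module.finrank k (β.perpFil m)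
      else (Module.finrank k (β.perpFil m) : ℤ) - Module.finrank k (β.perpFil (m + 2)) := by
  rw [aInv]
  by_cases h : Even m
  · rw [if_pos h, if_neg (by rwa [Nat.even_add_one, not_not])]
    exact finrank_quotient_submoduleOf ((β.perpFil_alternating m).1 h)
  · rw [if_neg h, if_pos (by rwa [Nat.even_add_one])]
    exact finrank_quotient_submoduleOf
      ((β.perpFil_alternating m).2 (Nat.not_even_iff_odd.1 h))

end PerpFil

section BaseChangeInv

variable {p : ℕ} [Fact p.Prime] {e : ℕ} {k : Type*} [Field k] [CharP k p]
  {V : Type*} [AddCommGroup V] [Module k V] (L : Type*) [Field L] [Algebra k L]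

/-- The right orthogonal commutes with base change. A vector of `L ⊗ V` is expanded along a basis
of `L` over `k`, with coefficients in `V` that are orthogonal to `N` one by one. -/
theorem rightOrtho_baseChange (β : QBicForm (p ^ e) k V) (N : Submodule k V) :
    (β.baseChange L).rightOrtho (N.baseChange L) = (β.rightOrtho N).baseChange L := by
  classical
  apply le_antisymm
  · intro v hv
    let 𝓑 := Module.Basis.ofVectorSpace k L
    obtain ⟨c, rfl⟩ := (TensorProduct.equivFinsuppOfBasisLeft (N := V) 𝓑).symm.surjective v
    rw [TensorProduct.equivFinsuppOfBasisLeft_symm_apply, Finsupp.sum] at hv ⊢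
    refine Submodule.sum_mem _ fun i hi => Submodule.tmul_mem_baseChange_of_mem _ ?_
    intro w hw
    have h1 := hv (1 ⊗ₜ w) (Submodule.tmul_mem_baseChange_of_mem _ hw)
    rw [map_sum] at h1
    simp only [baseChange_tmul, one_pow, one_mul] at h1
    have h2 : ∑ j ∈ c.support, β w (c j) • 𝓑 j = 0 := by
      rw [← h1]
      refine Finset.sum_congr rfl fun j _ => ?_
      rw [Algebra.smul_def, mul_comm]
    exact linearIndependent_iff'.1 𝓑.linearIndependent _ _ h2 i hi
  · rw [Submodule.baseChange_eq_span, Submodule.span_le]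
    rintro _ ⟨v, hv, rfl⟩ w hw
    rw [Submodule.baseChange_eq_span] at hw
    induction hw using Submodule.span_induction with
    | mem x hx =>
      obtain ⟨x, hx, rfl⟩ := hx
      rw [TensorProduct.mk_apply, TensorProduct.mk_apply, baseChange_tmul, hv x hx]
      simp
    | zero => exact zero_left _ _
    | add x y _ _ hx hy => rw [add_left, hx, hy, add_zero]
    | smul a x _ hx => rw [smul_left, hx, mul_zero]

theorem perpFil_baseChange (β : QBicForm (p ^ e) k V) (j : ℕ) :
    (β.baseChange L).perpFil j = (β.perpFil j).baseChange L := by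
  induction j with
  | zero => exact (Submodule.baseChange_bot L).symm
  | succ j ih => rw [perpFil, ih, rightOrtho_baseChange]; rfl

theorem finrank_perpFil_baseChange (β : QBicForm (p ^ e) k V) (j : ℕ) :
    Module.finrank L ((β.baseChange L).perpFil j) = Module.finrank k (β.perpFil j) := by
  rw [perpFil_baseChange, Submodule.baseChange, LinearMap.finrank_range_of_inj,
    Module.finrank_baseChange]
  exact Module.Flat.lTensor_preserves_injective_linearMap _ (Submodule.injective_subtype _)

theorem aInv_succ_baseChange [FiniteDimensional k V] (β : QBicForm (p ^ e) k V) (m : ℕ) :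
    (β.baseChange L).aInv (m + 1) = β.aInv (m + 1) := by
  have h1 := (β.baseChange L).aInv_succ m
  simp only [finrank_perpFil_baseChange] at h1
  rw [← aInv_succ] at h1
  exact_mod_cast h1

end BaseChangeInv

section StandardInvariants

variable {a : ℕ} {κ : Type} {ℓ : κ → ℕ}

/-- The indices of the basis vectors that span the `j`-th step of the orthogonal filtration of a
standard form. -/
def stFil (a : ℕ) {κ : Type} (ℓ : κ → ℕ) (j : ℕ) : Set (StIdx a ℓ) :=
  {x | match x with
    | .inl _ => Odd j
    | .inr x => ((x.2 : ℕ) < j ∧ Even (x.2 : ℕ)) ∨ (j ≤ (x.2 : ℕ) ∧ Odd j)}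

theorem inl_mem_stFil (j : ℕ) (i : Fin a) : Sum.inl i ∈ stFil a ℓ j ↔ Odd j := Iff.rfl

theorem inr_mem_stFil (j : ℕ) (x : Σ c, Fin (ℓ c)) : Sum.inr x ∈ stFil a ℓ j ↔
    ((x.2 : ℕ) < j ∧ Even (x.2 : ℕ)) ∨ (j ≤ (x.2 : ℕ) ∧ Odd j) := Iff.rfl

variable [Fintype κ] [DecidableEq κ]
  {p : ℕ} [Fact p.Prime] {e : ℕ} {F : Type*} [Field F] [CharP F p]
  {V : Type*} [AddCommGroup V] [Module F V]

/-- Each row of a standard Gram matrix has at most one nonzero entry. -/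
theorem St_ne_zero_unique {i k k' : StIdx a ℓ} (h : St F a ℓ i k ≠ 0)
    (h' : St F a ℓ i k' ≠ 0) : k = k' := by
  rcases i with i | x <;> rcases k with k | y <;> rcases k' with k' | y' <;> simp at h h'
  · rw [← h, ← h']
  · rw [sigma_fin_ext (h.1.symm.trans h'.1) (h.2.symm.trans h'.2)]

theorem notMem_stFil_succ_iff (j : ℕ) (k : StIdx a ℓ) :
    k ∉ stFil a ℓ (j + 1) ↔ ∃ i ∈ stFil a ℓ j, St F a ℓ i k ≠ 0 := by
  rcases k with k | ⟨c, k, hk⟩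
  · rw [inl_mem_stFil]
    constructor
    · intro h
      exact ⟨.inl k, (inl_mem_stFil _ _).2 (by rwa [Nat.odd_add_one, not_not] at h), by simp⟩
    · rintro ⟨i | x, hi, h⟩
      · rw [Nat.odd_add_one, not_not]; exact hi
      · simp at h
  · rw [inr_mem_stFil]
    constructor
    · intro h
      simp only [not_or, not_and, Nat.odd_iff, Nat.even_iff] at h
      obtain ⟨k', rfl⟩ : ∃ k', k = k' + 1 := Nat.exists_eq_succ_of_ne_zero (by
        rintro rfl
        have := h.1 (by omega)
        omega)
      refine ⟨.inr ⟨c, ⟨k', by omega⟩⟩, ?_, by simp⟩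
      rw [inr_mem_stFil]
      simp only [Nat.odd_iff, Nat.even_iff]
      by_cases h1 : k' < j
      · have := h.1 (by omega)
        exact Or.inl ⟨h1, by omega⟩
      · have := h.2 (by omega)
        exact Or.inr ⟨by omega, by omega⟩
    · rintro ⟨i | ⟨d, i, hi'⟩, hi, h⟩
      · simp at h
      · simp only [St_inr_inr, ne_eq, ite_eq_right_iff, one_ne_zero, imp_false, not_not] at h
        rw [inr_mem_stFil] at hi
        simp only [Nat.odd_iff, Nat.even_iff] at hi ⊢
        obtain ⟨-, h⟩ := h
        omega

theorem apply_basis_eq_sum {β : QBicForm (p ^ e) F V} {b : Module.Basis (StIdx a ℓ) F V}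
    (hb : β.gram b = St F a ℓ) (i : StIdx a ℓ) (v : V) :
    β (b i) v = ∑ k, b.repr v k * St F a ℓ i k := by
  conv_lhs => rw [← b.sum_repr v, map_sum]
  refine Finset.sum_congr rfl fun k _ => ?_
  rw [map_smul, smul_eq_mul, ← hb, gram_apply]

theorem mem_perpFil_iff {β : QBicForm (p ^ e) F V} {b : Module.Basis (StIdx a ℓ) F V}
    (hb : β.gram b = St F a ℓ) (j : ℕ) (v : V) :
    v ∈ β.perpFil j ↔ ∀ k ∉ stFil a ℓ j, b.repr v k = 0 := by
  have hp : p ^ e ≠ 0 := pow_ne_zero _ (Fact.out : p.Prime).ne_zero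
  induction j generalizing v with
  | zero =>
    have h0 : ∀ k, k ∉ stFil a ℓ 0 := by
      rintro (k | x)
      · rw [inl_mem_stFil]; decide
      · rw [inr_mem_stFil]
        rintro (⟨h, _⟩ | ⟨_, h⟩)
        · omega
        · exact absurd h (by decide)
    rw [perpFil, Submodule.mem_bot]
    constructor
    · rintro rfl k -
      simp
    · intro h
      refine b.repr.map_eq_zero_iff.1 (Finsupp.ext fun k => h k (h0 k))
  | succ j ih =>
    rw [perpFil, mem_rightOrtho]
    constructor
    · intro h k hk
      obtain ⟨i, hi, hik⟩ := (notMem_stFil_succ_iff (F := F) j k).1 hk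
      have h1 := h (b i) ((ih _).2 fun l hl => by
        rw [b.repr_self, Finsupp.single_eq_of_ne]
        rintro rfl
        exact hl hi)
      rw [apply_basis_eq_sum hb, Finset.sum_eq_single k] at h1
      · exact (mul_eq_zero.1 h1).resolve_right hik
      · intro l _ hl
        by_contra h2
        exact hl (St_ne_zero_unique (right_ne_zero_of_mul h2) hik)
      · simp
    · intro h w hw
      rw [← b.sum_repr w, β.sum_left]
      refine Finset.sum_eq_zero fun i _ => ?_
      rw [β.smul_left]
      by_cases hi : i ∈ stFil a ℓ j
      · rw [apply_basis_eq_sum hb, Finset.sum_eq_zero, mul_zero]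
        intro k _
        by_cases hik : St F a ℓ i k = 0
        · rw [hik, mul_zero]
        · rw [h k ((notMem_stFil_succ_iff (F := F) j k).2 ⟨i, hi, hik⟩), zero_mul]
      · rw [(ih w).1 hw i hi, zero_pow hp, zero_mul]

theorem finrank_perpFil_eq {β : QBicForm (p ^ e) F V} {b : Module.Basis (StIdx a ℓ) F V}
    (hb : β.gram b = St F a ℓ) (j : ℕ) :
    Module.finrank F (β.perpFil j) = (stFil a ℓ j).ncard := by
  classical
  have h1 : β.perpFil j = Submodule.span F (Set.range fun i : stFil a ℓ j => b i) := by
    ext v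
    rw [mem_perpFil_iff hb]
    have h2 : (Set.range fun i : stFil a ℓ j => b i) = b '' stFil a ℓ j := by
      ext; simp
    rw [h2, Module.Basis.mem_span_image]
    constructor
    · intro h k hk
      by_contra hk'
      exact (Finsupp.mem_support_iff.1 hk) (h k hk')
    · intro h k hk
      by_contra hk'
      exact hk (h (Finsupp.mem_support_iff.2 hk'))
  rw [h1]
  refine (finrank_span_eq_card (b.linearIndependent.comp
    (Subtype.val : stFil a ℓ j → StIdx a ℓ) Subtype.val_injective)).trans ?_
  rw [← Nat.card_eq_fintype_card, Nat.card_coe_set_eq]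

/-- The invariant `a_m` of a standard form counts the chains of length at least `m`. -/
theorem aInv_of_gram_eq_St {β : QBicForm (p ^ e) F V} {b : Module.Basis (StIdx a ℓ) F V}
    (hb : β.gram b = St F a ℓ) (m : ℕ) :
    β.aInv (m + 1) = Fintype.card {c // m < ℓ c} := by
  have : FiniteDimensional F V := b.finiteDimensional_of_finite
  let s : {c // m < ℓ c} → StIdx a ℓ := fun c => .inr ⟨c.1, ⟨m, c.2⟩⟩
  have hs : Function.Injective s := by
    intro c d hcd
    exact Subtype.ext (congrArg Sigma.fst (Sum.inr_injective hcd))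
  have hcard : (Set.range s).ncard = Fintype.card {c // m < ℓ c} := by
    rw [← Set.image_univ, Set.ncard_image_of_injective _ hs, Set.ncard_univ,
      Nat.card_eq_fintype_card]
  -- the indices that separate the two steps of the filtration are the `(c, m)`
  have hdiff : ∀ x : StIdx a ℓ, x ∈ Set.range s ↔ if Even m
      then x ∈ stFil a ℓ (m + 2) ∧ x ∉ stFil a ℓ m
      else x ∈ stFil a ℓ m ∧ x ∉ stFil a ℓ (m + 2) := by
    rintro (i | ⟨c, i, hi⟩)
    · have h1 : (Sum.inl i : StIdx a ℓ) ∉ Set.range s := by rintro ⟨c, hc⟩; simp [s] at hc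
      simp only [h1, inl_mem_stFil, false_iff]
      split_ifs with h <;> simp only [Nat.odd_iff, Nat.even_iff] at * <;> omega
    · have h1 : (Sum.inr ⟨c, i, hi⟩ : StIdx a ℓ) ∈ Set.range s ↔ i = m := by
        constructor
        · rintro ⟨d, hd⟩
          have := congrArg (fun z : Σ c, Fin (ℓ c) => (z.2 : ℕ)) (Sum.inr_injective hd)
          exact this.symm
        · rintro rfl
          exact ⟨⟨c, hi⟩, rfl⟩
      simp only [h1, inr_mem_stFil]
      split_ifs with h <;> simp only [Nat.odd_iff, Nat.even_iff] at * <;> omega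
  have hZ : (β.aInv (m + 1) : ℤ) = (Set.range s).ncard := by
    rw [aInv_succ]
    simp only [finrank_perpFil_eq hb]
    split_ifs with h
    · have h1 : stFil a ℓ (m + 2) = stFil a ℓ m ∪ Set.range s := by
        ext x
        have := hdiff x
        rw [if_pos h] at this
        have h2 : x ∈ stFil a ℓ m → x ∈ stFil a ℓ (m + 2) := by
          rcases x with i | ⟨c, i, hi⟩ <;> simp only [inl_mem_stFil, inr_mem_stFil, Nat.odd_iff,
            Nat.even_iff] at * <;> omega
        rw [Set.mem_union, this]
        tauto
      rw [h1, Set.ncard_union_eq]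
      · push_cast; ring
      · rw [Set.disjoint_right]
        intro x hx
        have := (hdiff x).1 hx
        rw [if_pos h] at this
        exact this.2
    · have h1 : stFil a ℓ m = stFil a ℓ (m + 2) ∪ Set.range s := by
        ext x
        have := hdiff x
        rw [if_neg h] at this
        have h2 : x ∈ stFil a ℓ (m + 2) → x ∈ stFil a ℓ m := by
          rcases x with i | ⟨c, i, hi⟩ <;> simp only [inl_mem_stFil, inr_mem_stFil, Nat.odd_iff,
            Nat.even_iff] at * <;> omega
        rw [Set.mem_union, this]
        tauto
      rw [h1, Set.ncard_union_eq]
      · push_cast; ring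
      · rw [Set.disjoint_right]
        intro x hx
        have := (hdiff x).1 hx
        rw [if_neg h] at this
        exact this.2
  rw [hcard] at hZ
  exact_mod_cast hZ

/-- The invariant `b_m` of a standard form counts the chains of length `m`. -/
theorem bInv_of_gram_eq_St {β : QBicForm (p ^ e) F V} {b : Module.Basis (StIdx a ℓ) F V}
    (hb : β.gram b = St F a ℓ) {m : ℕ} (hm : 1 ≤ m) :
    β.bInv m = (Finset.univ.val.map ℓ).count m := by
  obtain ⟨m, rfl⟩ : ∃ m', m = m' + 1 := ⟨m - 1, by omega⟩
  rw [bInv, aInv_of_gram_eq_St hb, aInv_of_gram_eq_St hb, Multiset.count_map,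
    Fintype.card_subtype, Fintype.card_subtype]
  have h1 : (Finset.univ.filter fun c => m < ℓ c) =
      (Finset.univ.filter fun c => m + 1 < ℓ c) ∪ Finset.univ.filter fun c => m + 1 = ℓ c := by
    ext c
    simp only [Finset.mem_filter, Finset.mem_univ, true_and, Finset.mem_union]
    omega
  rw [h1, Finset.card_union_of_disjoint]
  · push_cast
    rw [add_sub_cancel_left]
    rfl
  · rw [Finset.disjoint_filter]
    intro c _ h2 h3
    omega

end StandardInvariants

end QBicForm

/-! ### Degenerations of types -/

namespace QBicForm

open Matrix

section MultisetIndex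

theorem exists_fin_map_eq {α : Type*} (s : Multiset α) :
    ∃ (n : ℕ) (ℓ : Fin n → α), Finset.univ.val.map ℓ = s := by
  induction s using Quotient.inductionOn with
  | _ l => exact ⟨l.length, l.get, by simp [Fin.univ_val_map]⟩

theorem exists_equiv_of_map_univ_eq {κ κ' : Type*} [Fintype κ] [Fintype κ'] {ℓ : κ → ℕ}
    {ℓ' : κ' → ℕ} (h : Finset.univ.val.map ℓ = Finset.univ.val.map ℓ') :
    ∃ f : κ ≃ κ', ∀ c, ℓ' (f c) = ℓ c := by
  classical
  have key : ∀ v, Nonempty ({c // ℓ c = v} ≃ {c // ℓ' c = v}) := by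
    intro v
    rw [← Fintype.card_eq, Fintype.card_subtype, Fintype.card_subtype]
    have := congrArg (Multiset.count v) h
    rw [Multiset.count_map, Multiset.count_map] at this
    simp only [eq_comm (a := v)] at this
    exact this
  have g := fun v => (key v).some
  refine ⟨(Equiv.sigmaFiberEquiv ℓ).symm.trans
    ((Equiv.sigmaCongrRight g).trans (Equiv.sigmaFiberEquiv ℓ')), fun c => ?_⟩
  exact (g (ℓ c) ⟨c, rfl⟩).2

theorem map_univ_sum {κ κ' α : Type*} [Fintype κ] [Fintype κ'] (f : κ ⊕ κ' → α) :
    Finset.univ.val.map f =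
      Finset.univ.val.map (fun c => f (.inl c)) + Finset.univ.val.map (fun c => f (.inr c)) := by
  rw [← Finset.univ_disjSum_univ, Finset.val_disjSum, Multiset.disjSum, Multiset.map_add,
    Multiset.map_map, Multiset.map_map]
  rfl

end MultisetIndex

section TypeDegeneration

variable (p : ℕ) [Fact p.Prime] (e : ℕ) (F : Type u) [Field F] [CharP F p]

/-- The standard form with `a` loops and a chain of length `l` for each member `l` of the
multiset `s` degenerates to the one with the data `a'` and `s'`. -/
def TDeg (a : ℕ) (s : Multiset ℕ) (a' : ℕ) (s' : Multiset ℕ) : Prop :=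
  ∃ (n n' : ℕ) (ℓ : Fin n → ℕ) (ℓ' : Fin n' → ℕ), Finset.univ.val.map ℓ = s ∧
    Finset.univ.val.map ℓ' = s' ∧ Deg p e (St F a ℓ) (St F a' ℓ')

variable {p e F}

/-- A standard form depends only on the multiset of its chain lengths. -/
theorem cong_St_of_map_eq {κ κ' : Type*} [Fintype κ] [DecidableEq κ] [Fintype κ']
    [DecidableEq κ'] (a : ℕ) {ℓ : κ → ℕ} {ℓ' : κ' → ℕ}
    (h : Finset.univ.val.map ℓ = Finset.univ.val.map ℓ') :
    Cong p e (St F a ℓ) (St F a ℓ') := by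
  obtain ⟨f, hf⟩ := exists_equiv_of_map_univ_eq h
  exact cong_St_of_injective a f f.injective hf fun d _ => f.surjective d

variable [PerfectRing F p] {a b a' b' a'' : ℕ} {s t s' t' s'' : Multiset ℕ}

theorem TDeg.of_deg {κ κ' : Type*} [Fintype κ] [DecidableEq κ] [Fintype κ'] [DecidableEq κ']
    {ℓ : κ → ℕ} {ℓ' : κ' → ℕ} (h : Deg p e (St F a ℓ) (St F a' ℓ'))
    (hs : Finset.univ.val.map ℓ = s) (hs' : Finset.univ.val.map ℓ' = s') :
    TDeg p e F a s a' s' := by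
  obtain ⟨n, l, hl⟩ := exists_fin_map_eq s
  obtain ⟨n', l', hl'⟩ := exists_fin_map_eq s'
  exact ⟨n, n', l, l', hl, hl', Deg.congLeft (cong_St_of_map_eq a (hl.trans hs.symm))
    (h.trans (cong_St_of_map_eq a' (hs'.trans hl'.symm)).deg)⟩

theorem TDeg.deg (h : TDeg p e F a s a' s') {κ κ' : Type*} [Fintype κ] [DecidableEq κ] [Fintype κ']
    [DecidableEq κ'] {ℓ : κ → ℕ} {ℓ' : κ' → ℕ} (hs : Finset.univ.val.map ℓ = s)
    (hs' : Finset.univ.val.map ℓ' = s') : Deg p e (St F a ℓ) (St F a' ℓ') := by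
  obtain ⟨n, n', l, l', hl, hl', hd⟩ := h
  exact Deg.congLeft (cong_St_of_map_eq a (hs.trans hl.symm))
    (hd.trans (cong_St_of_map_eq a' (hl'.trans hs'.symm)).deg)

variable (p e F) in
theorem TDeg.refl (a : ℕ) (s : Multiset ℕ) : TDeg p e F a s a s := by
  obtain ⟨n, l, hl⟩ := exists_fin_map_eq s
  exact ⟨n, n, l, l, hl, hl, (Cong.refl _).deg⟩

theorem TDeg.trans (h : TDeg p e F a s a' s') (h' : TDeg p e F a' s' a'' s'') :
    TDeg p e F a s a'' s'' := by
  obtain ⟨n, n', l, l', hl, hl', hd⟩ := h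
  obtain ⟨m, l'', hl''⟩ := exists_fin_map_eq s''
  exact ⟨n, m, l, l'', hl, hl'', hd.trans (h'.deg hl' hl'')⟩

theorem TDeg.add (h : TDeg p e F a s a' s') (h' : TDeg p e F b t b' t') :
    TDeg p e F (a + b) (s + t) (a' + b') (s' + t') := by
  obtain ⟨n, n', l, l', hl, hl', hd⟩ := h
  obtain ⟨m, m', r, r', hr, hr', hd'⟩ := h'
  refine TDeg.of_deg (Deg.congLeft (cong_St_sum a b l r).symm
    ((Deg.blockDiag hd hd').trans (cong_St_sum a' b' l' r').deg)) ?_ ?_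
  · rw [map_univ_sum]; simp [hl, hr]
  · rw [map_univ_sum]; simp [hl', hr']

theorem TDeg.add_right (h : TDeg p e F a s a' s') (b : ℕ) (t : Multiset ℕ) :
    TDeg p e F (a + b) (s + t) (a' + b) (s' + t) := h.add (TDeg.refl p e F b t)

/-- Chains of length `0` may be added and removed. -/
theorem TDeg.of_add_zeros {m n : ℕ} (h : TDeg p e F a (s + Multiset.replicate m 0) a'
    (s' + Multiset.replicate n 0)) : TDeg p e F a s a' s' := by
  obtain ⟨c, l, hl⟩ := exists_fin_map_eq s
  obtain ⟨c', l', hl'⟩ := exists_fin_map_eq s'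
  have key : ∀ (a m c : ℕ) (l : Fin c → ℕ),
      Cong p e (St F a l) (St F a (Sum.elim l fun _ : Fin m => 0)) := by
    intro a m c l
    refine cong_St_of_injective a Sum.inl Sum.inl_injective (fun _ => rfl) ?_
    rintro (d | d) hd
    · exact ⟨d, rfl⟩
    · simp at hd
  refine ⟨c, c', l, l', hl, hl', Deg.congLeft (key a m c l)
    ((h.deg ?_ ?_).trans (key a' n c' l').symm.deg)⟩
  · rw [map_univ_sum]; simp [hl]
  · rw [map_univ_sum]; simp [hl']

/-- Every chain may be extended by two vectors, provided that both sides have the same number of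
chains. -/
theorem TDeg.lift (h : TDeg p e F a s a' s') (hc : Multiset.card s = Multiset.card s') :
    TDeg p e F a (s.map (· + 2)) a' (s'.map (· + 2)) := by
  obtain ⟨n, n', l, l', rfl, rfl, hd⟩ := h
  obtain rfl : n = n' := by simpa using hc
  refine TDeg.of_deg (Deg.congLeft (cong_extMat_St a l).symm
    ((Deg.extMat hd (admissible_stTail a l) (admissible_stTail a' l')).trans
      (cong_extMat_St a' l').deg)) ?_ ?_
  · simp [Function.comp_def]
  · simp [Function.comp_def]

end TypeDegeneration

end QBicForm

/-! ### The elementary degenerations -/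

namespace QBicForm

open Matrix

section OfMatrix

variable {p : ℕ} [Fact p.Prime] {e : ℕ} {R : Type*} [CommRing R] [CharP R p]
  {ι : Type*} [Fintype ι] [DecidableEq ι]

variable (e) in
/-- The `q`-bic form on `ι → R` with a given Gram matrix in the standard basis. -/
def ofMatrix (B : Matrix ι ι R) : QBicForm (p ^ e) R (ι → R) where
  toFun v := (∑ i, v i ^ p ^ e • LinearMap.proj i) ∘ₗ B.mulVecLin
  map_add' v w := by
    simp only [Pi.add_apply, add_pow_char_pow, add_smul, Finset.sum_add_distrib,
      LinearMap.add_comp]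
  map_smul' c v := by
    simp only [Pi.smul_apply, smul_eq_mul, mul_pow, mul_smul, ← Finset.smul_sum,
      LinearMap.smul_comp]

theorem gram_ofMatrix (B : Matrix ι ι R) :
    (ofMatrix (p := p) e B).gram (Pi.basisFun R ι) = B := by
  have hp : p ^ e ≠ 0 := pow_ne_zero _ (Fact.out : p.Prime).ne_zero
  ext i j
  simp [gram, ofMatrix, Pi.single_apply, ite_pow, zero_pow hp]

end OfMatrix

section BasicDegenerations

variable {p : ℕ} [Fact p.Prime] {e : ℕ} {F : Type u} [Field F] [CharP F p]

variable (F) in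
/-- The Gram matrix of a standard form in an explicit enumeration of its basis. -/
theorem cong_St_list {n : ℕ} {a : ℕ} {m : ℕ} {ℓ : Fin m → ℕ} (B : Matrix (Fin n) (Fin n) F)
    (σ : Fin n → StIdx a ℓ) (hσ : Function.Bijective σ)
    (h : ∀ i j, B i j = St F a ℓ (σ i) (σ j)) : Cong p e (St F a ℓ) B :=
  Cong.of_equiv _ _ (Equiv.ofBijective σ hσ) h

variable (p e F) in
theorem cong_chain_two : Cong p e (St F 0 (fun _ : Fin 1 => 2)) !![0, 1; 0, 0] := by
  refine cong_St_list F _ ![.inr ⟨0, 0⟩, .inr ⟨0, 1⟩] (by decide) fun i j => ?_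
  fin_cases i <;> fin_cases j <;> simp

variable (p e F) in
theorem cong_chain_three :
    Cong p e (St F 0 (fun _ : Fin 1 => 3)) !![0, 1, 0; 0, 0, 1; 0, 0, 0] := by
  refine cong_St_list F _ ![.inr ⟨0, 0⟩, .inr ⟨0, 1⟩, .inr ⟨0, 2⟩] (by decide) fun i j => ?_
  fin_cases i <;> fin_cases j <;> simp

variable (p e F) in
theorem cong_loop : Cong p e (St F 1 (fun _ : Fin 1 => 0)) !![1] := by
  refine cong_St_list F _ ![.inl 0] (by decide) fun i j => ?_
  fin_cases i; fin_cases j; simp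

variable (p e F) in
theorem cong_chain_one : Cong p e (St F 0 (fun _ : Fin 1 => 1)) !![0] := by
  refine cong_St_list F _ ![.inr ⟨0, 0⟩] (by decide) fun i j => ?_
  fin_cases i; fin_cases j; simp

variable (p e F) in
theorem cong_loop_chain_one : Cong p e (St F 1 (fun _ : Fin 1 => 1)) !![1, 0; 0, 0] := by
  refine cong_St_list F _ ![.inl 0, .inr ⟨0, 0⟩] (by decide) fun i j => ?_
  fin_cases i <;> fin_cases j <;> simp

/-- The hyperbolic plane is nondegenerate, hence isomorphic to a sum of two loops. -/
theorem cong_hyperbolic [IsAlgClosed F] (he : 1 ≤ e) :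
    Cong p e (St F 2 (fun _ : Fin 1 => 0)) !![0, 1; 1, 0] := by
  have h1 : (ofMatrix (p := p) e (!![0, 1; 1, 0] : Matrix _ _ F)).Nondeg := by
    intro v hv
    have h0 := hv (Pi.single 0 1)
    have h1 := hv (Pi.single 1 1)
    have hp := (Fact.out : p.Prime).ne_zero
    simp [ofMatrix, Fin.sum_univ_two, hp] at h0 h1
    ext i
    fin_cases i
    · exact h1
    · exact h0
  obtain ⟨b, hb⟩ := h1.exists_orthonormal_basis he 2 (by simp)
  have h2 := cong_gram_gram (ofMatrix (p := p) e (!![0, 1; 1, 0] : Matrix _ _ F)) b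
    (Pi.basisFun F _)
  rw [hb, gram_ofMatrix] at h2
  refine Cong.trans (cong_St_list F 1 ![.inl 0, .inl 1] (by decide) fun i j => ?_) h2
  fin_cases i <;> fin_cases j <;> simp

theorem deg_of_eq {n : Type*} [Fintype n] [DecidableEq n] {B C : Matrix n n F}
    (T : Matrix n n (PowerSeries F)) (hT : T.map PowerSeries.constantCoeff = C)
    (g h : Matrix n n (FractionRing (PowerSeries F))) (hgh : g * h = 1)
    (hg : (tw p e g)ᵀ * B.map (const F) * g = T.map (toFrac F)) : Deg p e B C :=
  ⟨T, hT, Cong.of_mul_eq_one g h hgh hg⟩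

/-- The image of the variable in the fraction field of `F⟦X⟧`. -/
noncomputable abbrev var (F : Type u) [Field F] : FractionRing (PowerSeries F) :=
  toFrac F PowerSeries.X

theorem var_ne_zero : var F ≠ 0 := by
  rw [var, Ne, FaithfulSMul.algebraMap_eq_zero_iff]
  exact PowerSeries.X_ne_zero

variable (p e) in
theorem two_le_pow (he : 1 ≤ e) : 2 ≤ p ^ e :=
  (Fact.out : p.Prime).two_le.trans (Nat.le_self_pow (by omega) p)

variable (p) in
/-- The hyperbolic plane degenerates to a chain of length `2`: scaling the first vector by `t⁻¹`
and the second one by `t ^ q` keeps the first entry and multiplies the other one by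
`t ^ (q ^ 2 - 1)`. -/
theorem deg_hyperbolic (he : 1 ≤ e) :
    Deg p e (!![0, 1; 1, 0] : Matrix _ _ F) !![0, 1; 0, 0] := by
  have hq := two_le_pow p e he
  have ht := var_ne_zero (F := F)
  obtain ⟨q, hq'⟩ : ∃ q, q = p ^ e := ⟨_, rfl⟩
  rw [← hq'] at hq
  obtain ⟨d, hd⟩ : ∃ d, q * q = d + 1 + 1 := ⟨q * q - 2, by have := Nat.mul_le_mul hq hq; omega⟩
  refine deg_of_eq !![0, 1; PowerSeries.X ^ (d + 1), 0] ?_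
    !![(var F)⁻¹, 0; 0, var F ^ q] !![var F, 0; 0, (var F ^ q)⁻¹] ?_ ?_
  · ext i j; fin_cases i <;> fin_cases j <;> simp
  · ext i j; fin_cases i <;> fin_cases j <;> simp [ht, Matrix.mul_apply, Fin.sum_univ_two]
  · have h1 : (var F ^ q) ^ q * (var F)⁻¹ = var F ^ (d + 1) := by
      rw [← pow_mul, hd, pow_succ, mul_assoc, mul_inv_cancel₀ ht, mul_one]
    have hq0 : q ≠ 0 := by omega
    ext i j
    fin_cases i <;> fin_cases j <;>
      simp [ht, Matrix.mul_apply, Fin.sum_univ_two, tw_apply, ← hq', hq0, h1]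

/-- A chain `e₁ → e₂ → e₃` degenerates to a hyperbolic plane and a radical vector, in the basis
`e₂, e₁ + e₃, t e₁`. -/
theorem deg_chain_three :
    Deg p e (!![0, 1, 0; 0, 0, 1; 0, 0, 0] : Matrix _ _ F) !![0, 1, 0; 1, 0, 0; 0, 0, 0] := by
  have hp := (Fact.out : p.Prime).ne_zero
  have ht := var_ne_zero (F := F)
  refine deg_of_eq !![0, 1, 0; 1, 0, 0; PowerSeries.X ^ p ^ e, 0, 0] ?_
    !![0, 1, var F; 1, 0, 0; 0, 1, 0] !![0, 1, 0; 0, 0, 1; (var F)⁻¹, 0, -(var F)⁻¹] ?_ ?_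
  · ext i j; fin_cases i <;> fin_cases j <;> simp [hp]
  · ext i j
    fin_cases i <;> fin_cases j <;> simp [ht, Matrix.mul_apply, Fin.sum_univ_three]
  · ext i j
    fin_cases i <;> fin_cases j <;>
      simp [Matrix.mul_apply, Fin.sum_univ_three, tw_apply, hp]

/-- A chain `e₁ → e₂` degenerates to a loop and a radical vector, in the basis
`e₁ + e₂, t e₁`. -/
theorem deg_chain_two :
    Deg p e (!![0, 1; 0, 0] : Matrix _ _ F) !![1, 0; 0, 0] := by
  have hp := (Fact.out : p.Prime).ne_zero
  have ht := var_ne_zero (F := F)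
  refine deg_of_eq !![1, 0; PowerSeries.X ^ p ^ e, 0] ?_
    !![1, var F; 1, 0] !![0, 1; (var F)⁻¹, -(var F)⁻¹] ?_ ?_
  · ext i j; fin_cases i <;> fin_cases j <;> simp [hp]
  · ext i j
    fin_cases i <;> fin_cases j <;> simp [ht, Matrix.mul_apply, Fin.sum_univ_two]
  · ext i j
    fin_cases i <;> fin_cases j <;>
      simp [Matrix.mul_apply, Fin.sum_univ_two, tw_apply, hp]

theorem deg_loop : Deg p e (!![1] : Matrix _ _ F) !![0] := by
  have ht := var_ne_zero (F := F)
  refine deg_of_eq !![PowerSeries.X ^ (p ^ e + 1)] ?_ !![var F] !![(var F)⁻¹] ?_ ?_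
  · ext i j; fin_cases i; fin_cases j; simp
  · ext i j; fin_cases i; fin_cases j; simp [Matrix.mul_apply, ht]
  · ext i j; fin_cases i; fin_cases j; simp [Matrix.mul_apply, tw_apply, pow_succ]

variable {ι κ : Type*} [Fintype ι] [DecidableEq ι] [Fintype κ] [DecidableEq κ]

/-- The functionals of an extension degenerate to zero, by scaling the `x_c` by `t⁻¹` and the `y_c`
by `t ^ q`. -/
theorem deg_extMat_zero (B : Matrix ι ι F) (A : Matrix κ ι F) :
    Deg p e (extMat B A) (extMat B (0 : Matrix κ ι F)) := by
  have hp := (Fact.out : p.Prime).ne_zero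
  have ht := var_ne_zero (F := F)
  refine deg_of_eq
    (extMat (B.map PowerSeries.C) ((PowerSeries.X ^ (p ^ e * p ^ e) : PowerSeries F) •
      A.map PowerSeries.C)) ?_
    (fromBlocks ((var F)⁻¹ • (1 : Matrix κ κ _)) 0 0
      (fromBlocks (var F ^ p ^ e • (1 : Matrix κ κ _)) 0 0 (1 : Matrix ι ι _)))
    (fromBlocks (var F • (1 : Matrix κ κ _)) 0 0
      (fromBlocks ((var F ^ p ^ e)⁻¹ • (1 : Matrix κ κ _)) 0 0 (1 : Matrix ι ι _))) ?_ ?_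
  · rw [extMat_map, map_C_map_constantCoeff]
    congr 1
    ext i j
    simp [hp]
  · simp only [fromBlocks_multiply, Matrix.mul_zero, Matrix.zero_mul, add_zero, zero_add,
      Matrix.one_mul, Matrix.smul_mul, Matrix.mul_smul, smul_smul,
      inv_mul_cancel₀ (pow_ne_zero (p ^ e) ht), mul_inv_cancel₀ ht, one_smul, smul_zero,
      fromBlocks_one]
  · rw [extMat_map, extMat_map, map_C_map_toFrac]
    simp only [extMat, tw_fromBlocks, tw_smul, tw_one, tw_zero, fromBlocks_transpose,
      fromBlocks_multiply, transpose_smul, transpose_one, transpose_zero, Matrix.mul_zero,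
      Matrix.zero_mul, add_zero, zero_add, Matrix.one_mul, Matrix.mul_one, Matrix.smul_mul,
      Matrix.mul_smul, fromCols_mul_fromBlocks, smul_zero]
    congr 1
    · ext i (j | j)
      · rcases eq_or_ne i j with rfl | hij
        · simp
        · simp [hij]
      · simp
    · congr 1
      ext i j
      simp [const, pow_mul]

/-- The extension by zero functionals splits off chains of length `2`. -/
theorem cong_extMat_St_zero (a : ℕ) (ℓ : κ → ℕ) (m : ℕ) :
    Cong p e (extMat (St F a ℓ) (0 : Matrix (Fin m) _ F))
      (St F a (Sum.elim ℓ fun _ : Fin m => 2)) := by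
  let σ : Fin m ⊕ (Fin m ⊕ StIdx a ℓ) → StIdx a (Sum.elim ℓ fun _ : Fin m => 2) :=
    fun x => match x with
    | .inl c => .inr ⟨.inr c, (0 : Fin 2)⟩
    | .inr (.inl c) => .inr ⟨.inr c, (1 : Fin 2)⟩
    | .inr (.inr (.inl i)) => .inl i
    | .inr (.inr (.inr ⟨c, i⟩)) => .inr ⟨.inl c, i⟩
  have hσ : Function.Bijective σ := by
    refine ⟨?_, ?_⟩
    · rintro (c | c | i | ⟨c, i⟩) (d | d | j | ⟨d, j⟩) hxy
      all_goals
        simp only [σ, Sum.inr.injEq, Sum.inl.injEq, reduceCtorEq] at hxy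
      all_goals try
        have h1 := congrArg Sigma.fst hxy
        have h2 := congrArg
          (fun z : Σ d, Fin (Sum.elim ℓ (fun _ : Fin m => 2) d) => (z.2 : ℕ)) hxy
        simp at h1 h2
      · rw [h1]
      · rw [h1]
      · rw [hxy]
      · rw [sigma_fin_ext (x := ⟨c, i⟩) (y := ⟨d, j⟩) h1 h2]
    · rintro (i | ⟨c | c, i⟩)
      · exact ⟨.inr (.inr (.inl i)), rfl⟩
      · exact ⟨.inr (.inr (.inr ⟨c, i⟩)), rfl⟩
      · change Fin 2 at i
        fin_cases i
        · exact ⟨.inl c, rfl⟩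
        · exact ⟨.inr (.inl c), rfl⟩
  refine (Cong.of_equiv _ _ (Equiv.ofBijective σ hσ) ?_).symm
  rintro (c | c | i | ⟨c, i⟩) (d | d | j | ⟨d, j⟩) <;>
    simp [σ, extMat, Matrix.one_apply, eq_comm]

end BasicDegenerations

section Moves

variable {p : ℕ} [Fact p.Prime] {e : ℕ} {F : Type u} [Field F] [CharP F p]

theorem TDeg.lift_iterate [PerfectRing F p] {a a' : ℕ} {s s' : Multiset ℕ}
    (h : TDeg p e F a s a' s') (hc : Multiset.card s = Multiset.card s') (n : ℕ) :
    TDeg p e F a (s.map (· + 2 * n)) a' (s'.map (· + 2 * n)) := by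
  induction n with
  | zero => simpa using h
  | succ n ih =>
    have h1 := ih.lift (by simpa using hc)
    simpa only [Multiset.map_map, Function.comp_def, Nat.mul_succ, add_assoc] using h1

variable (p e F) [IsAlgClosed F]

theorem tdeg_two_even (he : 1 ≤ e) (l : ℕ) : TDeg p e F 2 {2 * l} 0 {2 * l + 2} := by
  have h : TDeg p e F 2 {0} 0 {2} :=
    TDeg.of_deg (Deg.congLeft (cong_hyperbolic he)
      ((deg_hyperbolic p he).trans (cong_chain_two p e F).symm.deg)) (by simp) (by simp)
  simpa [add_comm] using h.lift_iterate (by simp) l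

theorem tdeg_odd_two (l : ℕ) (he : 1 ≤ e) : TDeg p e F 0 {2 * l + 3} 2 {2 * l + 1} := by
  have h : TDeg p e F 0 {3} 2 {1} := by
    have h1 : Cong p e (fromBlocks (St F 2 fun _ : Fin 1 => 0) 0 0 (St F 0 fun _ : Fin 1 => 1))
        (!![0, 1, 0; 1, 0, 0; 0, 0, 0] : Matrix _ _ F) := by
      refine ((cong_hyperbolic he).blockDiag (cong_chain_one p e F)).trans
        (Cong.of_equiv _ _ (finSumFinEquiv (m := 2) (n := 1)).symm fun i j => ?_)
      fin_cases i <;> fin_cases j <;> rfl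
    refine TDeg.of_add_zeros (m := 0) (n := 1) (TDeg.of_deg (Deg.congLeft (cong_chain_three p e F)
      (deg_chain_three.trans (h1.symm.trans (cong_St_sum 2 0 _ _)).deg)) (by simp) ?_)
    rw [map_univ_sum]
    simp [add_comm]
  simpa [add_comm] using h.lift_iterate (by simp) l

theorem tdeg_one_even (l : ℕ) : TDeg p e F 1 {2 * l} 0 {2 * l + 1} := by
  have h : TDeg p e F 1 {0} 0 {1} :=
    TDeg.of_deg (Deg.congLeft (cong_loop p e F) (deg_loop.trans (cong_chain_one p e F).symm.deg))
      (by simp) (by simp)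
  simpa [add_comm] using h.lift_iterate (by simp) l

theorem tdeg_even_one (l : ℕ) : TDeg p e F 0 {2 * l + 2} 1 {2 * l + 1} := by
  have h : TDeg p e F 0 {2} 1 {1} :=
    TDeg.of_deg (Deg.congLeft (cong_chain_two p e F)
      (deg_chain_two.trans (cong_loop_chain_one p e F).symm.deg)) (by simp) (by simp)
  simpa [add_comm] using h.lift_iterate (by simp) l

/-- A chain of length `x + 2` splits into chains of lengths `x` and `2`. A chain of length `0` is
added to the source, so that both sides have two chains and can be lengthened simultaneously. -/
theorem tdeg_split (x : ℕ) : TDeg p e F 0 ({0} + {x + 2}) 0 ({2} + {x}) := by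
  have h : TDeg p e F 0 {x + 2} 0 ({x} + {2}) := by
    refine TDeg.of_deg (Deg.congLeft (cong_extMat_St 0 fun _ : Fin 1 => x).symm
      ((deg_extMat_zero _ _).trans (cong_extMat_St_zero 0 (fun _ : Fin 1 => x) 1).deg))
      (by simp) ?_
    rw [map_univ_sum]
    simp
  refine TDeg.of_add_zeros (m := 0) (n := 1) ?_
  have h1 := h.add_right 0 {0}
  simpa [add_comm, add_left_comm] using h1

theorem tdeg_even_even {i j : ℕ} (hij : i < j) :
    TDeg p e F 0 ({2 * i} + {2 * j + 2}) 0 ({2 * i + 2} + {2 * j}) := by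
  obtain ⟨d, rfl⟩ := Nat.exists_eq_add_of_lt hij
  have h := (tdeg_split p e F (2 * d + 2)).lift_iterate (by simp) i
  simp only [Multiset.map_add, Multiset.map_singleton] at h
  convert h using 3 <;> ring_nf

end Moves

end QBicForm

/-! ### From inequalities of truncated sums to degenerations -/

namespace QBicForm

section TruncSum

/-- The sum of the parts of `E`, each of them cut off at `k`. -/
def truncSum (E : Multiset ℕ) (k : ℕ) : ℕ := (E.map (min · k)).sum

@[simp] theorem truncSum_cons (l : ℕ) (E : Multiset ℕ) (k : ℕ) :
    truncSum (l ::ₘ E) k = min l k + truncSum E k := by simp [truncSum]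

@[simp] theorem truncSum_nil (k : ℕ) : truncSum 0 k = 0 := rfl

@[simp] theorem truncSum_zero_right (E : Multiset ℕ) : truncSum E 0 = 0 := by
  induction E using Multiset.induction_on with
  | empty => rfl
  | cons l E ih => simp [ih]

theorem truncSum_le_sum (E : Multiset ℕ) (k : ℕ) : truncSum E k ≤ E.sum := by
  induction E using Multiset.induction_on with
  | empty => simp
  | cons l E ih => rw [truncSum_cons, Multiset.sum_cons]; omega

theorem truncSum_mono (E : Multiset ℕ) {j k : ℕ} (h : j ≤ k) : truncSum E j ≤ truncSum E k := by
  induction E using Multiset.induction_on with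
  | empty => simp
  | cons l E ih => rw [truncSum_cons, truncSum_cons]; omega

theorem truncSum_eq_sum {E : Multiset ℕ} {k : ℕ} (h : ∀ l ∈ E, l ≤ k) : truncSum E k = E.sum := by
  induction E using Multiset.induction_on with
  | empty => simp
  | cons l E ih =>
    rw [truncSum_cons, Multiset.sum_cons, ih fun x hx => h x (Multiset.mem_cons_of_mem hx)]
    have := h l (Multiset.mem_cons_self l E)
    omega

theorem truncSum_eq_sum_of_sum_le {E : Multiset ℕ} {k : ℕ} (h : E.sum ≤ k) :
    truncSum E k = E.sum :=
  truncSum_eq_sum fun _ hl => (Multiset.le_sum_of_mem hl).trans h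

/-- The number of parts equal to `k` is minus the second difference of `truncSum E` at `k`. -/
theorem truncSum_add_truncSum_add_count (E : Multiset ℕ) (k : ℕ) :
    truncSum E k + truncSum E (k + 1 + 1) + E.count (k + 1) = 2 * truncSum E (k + 1) := by
  induction E using Multiset.induction_on with
  | empty => simp
  | cons l E ih =>
    simp only [truncSum_cons, Multiset.count_cons]
    split_ifs <;> omega

end TruncSum

section HalvedTypes

variable (p : ℕ) [Fact p.Prime] (e : ℕ) (F : Type u) [Field F] [CharP F p]

/-- The degeneration of standard forms, in terms of the number `a` of loops, the halves of the
even chain lengths `E`, and the rounded down halves of the odd chain lengths `O`. -/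
def HDeg (a : ℕ) (E O : Multiset ℕ) (a' : ℕ) (E' O' : Multiset ℕ) : Prop :=
  TDeg p e F a (E.map (fun l => 2 * l) + O.map fun l => 2 * l + 1) a'
    (E'.map (fun l => 2 * l) + O'.map fun l => 2 * l + 1)

section Basic

variable [PerfectRing F p]

theorem HDeg.refl (a : ℕ) (E O : Multiset ℕ) : HDeg p e F a E O a E O := TDeg.refl p e F _ _

variable {p e F} {a a' a'' : ℕ} {E E' E'' O O' O'' : Multiset ℕ}

theorem HDeg.trans (h : HDeg p e F a E O a' E' O') (h' : HDeg p e F a' E' O' a'' E'' O'') :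
    HDeg p e F a E O a'' E'' O'' := TDeg.trans h h'

theorem HDeg.add_right (h : HDeg p e F a E O a' E' O') (b : ℕ) (G P : Multiset ℕ) :
    HDeg p e F (a + b) (E + G) (O + P) (a' + b) (E' + G) (O' + P) := by
  have h1 := TDeg.add_right h b (G.map (fun l => 2 * l) + P.map fun l => 2 * l + 1)
  rw [add_add_add_comm, add_add_add_comm (E'.map _)] at h1
  simpa only [HDeg, Multiset.map_add] using h1

variable (p e F)

theorem hdeg_cons_zero (a : ℕ) (E O : Multiset ℕ) : HDeg p e F a (0 ::ₘ E) O a E O := by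
  refine TDeg.of_add_zeros (m := 0) (n := 1) ?_
  simpa [HDeg, add_comm] using HDeg.refl p e F a (0 ::ₘ E) O

theorem hdeg_zero_cons (a : ℕ) (E O : Multiset ℕ) : HDeg p e F a E O a (0 ::ₘ E) O := by
  refine TDeg.of_add_zeros (m := 1) (n := 0) ?_
  simpa [HDeg, add_comm] using HDeg.refl p e F a (0 ::ₘ E) O

/-- Parts `0` may be discarded and restored. -/
theorem hdeg_filter (a : ℕ) (E O : Multiset ℕ) :
    HDeg p e F a E O a (E.filter (0 < ·)) O ∧ HDeg p e F a (E.filter (0 < ·)) O a E O := by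
  induction E using Multiset.induction_on with
  | empty => exact ⟨HDeg.refl p e F _ _ _, HDeg.refl p e F _ _ _⟩
  | cons l E ih =>
    rcases Nat.eq_zero_or_pos l with rfl | hl
    · rw [Multiset.filter_cons_of_neg _ (lt_irrefl 0)]
      exact ⟨(hdeg_cons_zero p e F a E O).trans ih.1, ih.2.trans (hdeg_zero_cons p e F a E O)⟩
    · rw [Multiset.filter_cons_of_pos (p := (0 < ·)) _ hl, ← Multiset.singleton_add,
        ← Multiset.singleton_add]
      simp only [add_comm ({l} : Multiset ℕ)]
      exact ⟨by simpa using ih.1.add_right 0 {l} 0, by simpa using ih.2.add_right 0 {l} 0⟩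

variable {p e F}

theorem HDeg.of_truncSum_eq (h : ∀ k, truncSum E k = truncSum E' k) : HDeg p e F a E O a E' O := by
  refine (hdeg_filter p e F a E O).1.trans ?_
  convert (hdeg_filter p e F a E' O).2 using 1
  ext k
  rcases k with _ | k
  · simp
  · rw [Multiset.count_filter_of_pos (by simp), Multiset.count_filter_of_pos (by simp)]
    have h1 := truncSum_add_truncSum_add_count E k
    have h2 := truncSum_add_truncSum_add_count E' k
    have h3 := h k
    have h4 := h (k + 1)
    have h5 := h (k + 1 + 1)
    omega

end Basic

section Moves

variable [IsAlgClosed F] (a l : ℕ) (E O : Multiset ℕ)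

theorem hdeg_even_succ (he : 1 ≤ e) :
    HDeg p e F (a + 2) (l ::ₘ E) O a ((l + 1) ::ₘ E) O := by
  have h : HDeg p e F 2 {l} 0 0 {l + 1} 0 := by
    simpa [HDeg, mul_add] using tdeg_two_even p e F he l
  simpa [add_comm a] using h.add_right a E O

theorem hdeg_even_even {i j : ℕ} (hij : i < j) :
    HDeg p e F a (i ::ₘ (j + 1) ::ₘ E) O a ((i + 1) ::ₘ j ::ₘ E) O := by
  have h : HDeg p e F 0 ({i} + {j + 1}) 0 0 ({i + 1} + {j}) 0 := by
    simpa [HDeg, mul_add] using tdeg_even_even p e F hij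
  simpa using h.add_right a E O

theorem hdeg_odd_succ (he : 1 ≤ e) :
    HDeg p e F a E ((l + 1) ::ₘ O) (a + 2) E (l ::ₘ O) := by
  have h : HDeg p e F 0 0 {l + 1} 2 0 {l} := by
    simpa [HDeg, mul_add, add_assoc] using tdeg_odd_two p e F l he
  simpa [add_comm a] using h.add_right a E O

theorem hdeg_even_odd : HDeg p e F (a + 1) (l ::ₘ E) O a E (l ::ₘ O) := by
  have h : HDeg p e F 1 {l} 0 0 0 {l} := by
    simpa [HDeg] using tdeg_one_even p e F l
  simpa [add_comm a] using h.add_right a E O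

theorem hdeg_even_succ_odd : HDeg p e F a ((l + 1) ::ₘ E) O (a + 1) E (l ::ₘ O) := by
  have h : HDeg p e F 0 {l + 1} 0 1 0 {l} := by
    simpa [HDeg, mul_add] using tdeg_even_one p e F l
  simpa [add_comm a] using h.add_right a E O

end Moves

variable [IsAlgClosed F] {p e F}

/-- The degenerations between standard forms without odd chains. Let the truncated sums of `E` and
`E'` differ for the first time at `k + 1`. The part `k` of `E`, which exists by concavity, is
increased by `1`, at the cost of the part `i` at which the truncated sums agree again, or of two
loops if they never do. -/
theorem hdeg_of_even (he : 1 ≤ e) {a a' : ℕ} {E E' : Multiset ℕ}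
    (hn : a + 2 * E.sum = a' + 2 * E'.sum) (hf : ∀ k, truncSum E k ≤ truncSum E' k) :
    HDeg p e F a E 0 a' E' 0 := by
  induction hd : ∑ k ∈ Finset.range (E'.sum + 1), (truncSum E' k - truncSum E k) using
    Nat.strong_induction_on generalizing a E with
  | _ d ih =>
  subst hd
  -- in both cases below, the truncated sums grow by `1` on a range of `j` that starts at `k`
  have step : ∀ {b G k}, HDeg p e F a E 0 b G 0 → b + 2 * G.sum = a + 2 * E.sum → k ≤ E'.sum →
      truncSum E k < truncSum E' k → truncSum E k < truncSum G k →
      (∀ j, truncSum E j ≤ truncSum G j ∧ truncSum G j ≤ truncSum E' j) →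
      HDeg p e F a E 0 a' E' 0 := by
    intro b G k h hb hk hk' hG hGj
    refine h.trans (ih _ ?_ (hb.trans hn) (fun j => (hGj j).2) rfl)
    refine Finset.sum_lt_sum (fun j _ => ?_) ⟨k, Finset.mem_range.2 (by omega), ?_⟩
    · have := hGj j
      omega
    · omega
  by_cases hlt : ∃ k, truncSum E k < truncSum E' k
  swap
  · have heq : ∀ k, truncSum E k = truncSum E' k := fun k =>
      (hf k).antisymm (not_lt.1 fun h => hlt ⟨k, h⟩)
    have h1 := heq (E.sum + E'.sum)
    rw [truncSum_eq_sum_of_sum_le (by omega), truncSum_eq_sum_of_sum_le (by omega)] at h1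
    obtain rfl : a = a' := by omega
    exact HDeg.of_truncSum_eq heq
  obtain ⟨k, hk, hkmin⟩ : ∃ k, truncSum E k < truncSum E' k ∧
      ∀ j < k, truncSum E j = truncSum E' j := by
    classical
    exact ⟨Nat.find hlt, Nat.find_spec hlt, fun j hj =>
      (hf j).antisymm (not_lt.1 (Nat.find_min hlt hj))⟩
  obtain ⟨k, rfl⟩ : ∃ k', k = k' + 1 := by
    rcases k with _ | k
    · simp at hk
    · exact ⟨k, rfl⟩
  have hkE' : k + 1 ≤ E'.sum := by
    by_contra hcon
    have h1 := truncSum_le_sum E' (k + 1)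
    have h2 := hkmin k (by omega)
    rw [truncSum_eq_sum_of_sum_le (E := E') (by omega)] at h2
    have h3 := truncSum_mono E (show k ≤ k + 1 by omega)
    omega
  -- a part `k`, which is invisible if `k = 0`
  obtain ⟨E₁, hE₁, hE₁', hsum⟩ : ∃ E₁, HDeg p e F a E 0 a (k ::ₘ E₁) 0 ∧
      (∀ j, truncSum (k ::ₘ E₁) j = truncSum E j) ∧ (k ::ₘ E₁).sum = E.sum := by
    rcases k with _ | k
    · exact ⟨E, hdeg_zero_cons p e F _ _ _, by simp, by simp⟩
    · have h1 := truncSum_add_truncSum_add_count E k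
      have h2 := truncSum_add_truncSum_add_count E' k
      have h3 := hkmin k (by omega)
      have h4 := hkmin (k + 1) (by omega)
      obtain ⟨E₁, rfl⟩ := Multiset.exists_cons_of_mem
        (Multiset.count_pos.1 (by omega : 0 < E.count (k + 1)))
      exact ⟨E₁, HDeg.refl p e F _ _ _, fun _ => rfl, rfl⟩
  have hE₁j := fun j => (hE₁' j)
  simp only [truncSum_cons] at hE₁j
  rw [Multiset.sum_cons] at hsum
  by_cases hret : ∃ i, k + 1 < i ∧ truncSum E i = truncSum E' i
  · obtain ⟨i, ⟨hki, hi⟩, himin⟩ : ∃ i, (k + 1 < i ∧ truncSum E i = truncSum E' i) ∧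
        ∀ j < i, k + 1 < j → truncSum E j < truncSum E' j := by
      classical
      exact ⟨Nat.find hret, Nat.find_spec hret, fun j hj hkj =>
        (hf j).lt_of_ne fun h => Nat.find_min hret hj ⟨hkj, h⟩⟩
    obtain ⟨i, rfl⟩ : ∃ i', i = i' + 1 + 1 := ⟨i - 2, by omega⟩
    have h0 : truncSum E (i + 1) < truncSum E' (i + 1) := by
      rcases eq_or_ne i k with rfl | h
      · exact hk
      · exact himin _ (by omega) (by omega)
    have h1 := truncSum_add_truncSum_add_count E (i + 1)
    have h2 := truncSum_add_truncSum_add_count E' (i + 1)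
    have h3 := hf (i + 1 + 1 + 1)
    have hmem : i + 1 + 1 ∈ E₁ := by
      have h4 := truncSum_add_truncSum_add_count (k ::ₘ E₁) (i + 1)
      simp only [hE₁'] at h4
      rw [Multiset.count_cons_of_ne (by omega)] at h4
      exact Multiset.count_pos.1 (by omega)
    obtain ⟨E₂, rfl⟩ := Multiset.exists_cons_of_mem hmem
    simp only [truncSum_cons] at hE₁j
    rw [Multiset.sum_cons] at hsum
    refine step (k := k + 1) (hE₁.trans (hdeg_even_even p e F a E₂ 0 (by omega : k < i + 1)))
      ?_ hkE' hk ?_ fun j => ?_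
    · simp only [Multiset.sum_cons]
      omega
    · have := hE₁j (k + 1)
      simp only [truncSum_cons]
      omega
    · have h5 := hE₁j j
      have h6 := hf j
      simp only [truncSum_cons]
      rcases lt_or_ge j (k + 1) with h | h
      · omega
      rcases lt_or_ge j (i + 1 + 1) with h' | h'
      · have h7 : truncSum E j < truncSum E' j := by
          rcases eq_or_ne j (k + 1) with rfl | h
          · exact hk
          · exact himin _ (by omega) (by omega)
        omega
      · omega
  · push Not at hret
    have hret' : ∀ j, k + 1 ≤ j → truncSum E j < truncSum E' j := by
      intro j hj
      rcases hj.eq_or_lt with rfl | h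
      · exact hk
      · exact (hf j).lt_of_ne (hret j h)
    have ha : 2 ≤ a := by
      have h1 := hret' (E.sum + E'.sum + (k + 1)) (by omega)
      rw [truncSum_eq_sum_of_sum_le (by omega), truncSum_eq_sum_of_sum_le (by omega)] at h1
      omega
    obtain ⟨b, rfl⟩ : ∃ b, a = b + 2 := ⟨a - 2, by omega⟩
    refine step (k := k + 1) (hE₁.trans (hdeg_even_succ p e F b k E₁ 0 he)) ?_ hkE' hk ?_
      fun j => ?_
    · simp only [Multiset.sum_cons]
      omega
    · have := hE₁j (k + 1)
      simp only [truncSum_cons]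
      omega
    · have h5 := hE₁j j
      have h6 := hf j
      have h7 := hret' j
      simp only [truncSum_cons]
      omega

theorem exists_max_mem {O : Multiset ℕ} (hO : O ≠ 0) : ∃ ν ∈ O, ∀ x ∈ O, x ≤ ν := by
  obtain ⟨ν, hν, h⟩ := O.toFinset.exists_max_image id (by simpa using hO)
  exact ⟨ν, by simpa using hν, fun x hx => h x (by simpa using hx)⟩

theorem exists_min_mem {O : Multiset ℕ} (hO : O ≠ 0) : ∃ ν ∈ O, ∀ x ∈ O, ν ≤ x := by
  obtain ⟨ν, hν, h⟩ := O.toFinset.exists_min_image id (by simpa using hO)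
  exact ⟨ν, by simpa using hν, fun x hx => h x (by simpa using hx)⟩

/-- The total dimension of the standard form with the given halved type. -/
def halvedDim (a : ℕ) (E O : Multiset ℕ) : ℕ := a + 2 * E.sum + 2 * O.sum + Multiset.card O

/-- The degenerations from a standard form without odd chains. The target is replaced by one that
degenerates to it, with fewer loops, or smaller even parts, or fewer odd chains; the last step, in
which the longest odd chain becomes even, applies once the dimension forces the inequalities. -/
theorem hdeg_of_source_even (he : 1 ≤ e) (c : ℕ) : ∀ {a a' : ℕ} {E E' O' : Multiset ℕ},
    Multiset.card O' = c → halvedDim a E 0 = halvedDim a' E' O' →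
    (∀ k, truncSum E k ≤ truncSum E' k + c * k) → HDeg p e F a E 0 a' E' O' := by
  induction c with
  | zero =>
    intro a a' E E' O' hc hn hf
    obtain rfl := Multiset.card_eq_zero.1 hc
    exact hdeg_of_even he (by simpa [halvedDim] using hn) (by simpa using hf)
  | succ c ihc =>
    intro a a' E E' O' hc hn hf
    induction hd : 2 * E'.sum + a' using Nat.strong_induction_on generalizing a' E' O' with
    | _ d ih =>
    subst hd
    have hO' : O' ≠ 0 := by rintro rfl; simp at hc
    obtain ⟨ν, hν, hνmax⟩ := exists_max_mem hO'
    obtain ⟨O', rfl⟩ := Multiset.exists_cons_of_mem hν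
    rw [Multiset.card_cons, add_left_inj] at hc
    simp only [halvedDim, Multiset.sum_zero, Multiset.card_zero, Multiset.sum_cons,
      Multiset.card_cons, hc] at hn
    by_cases ha' : 2 ≤ a'
    · -- two loops of the target come from a longer odd chain
      obtain ⟨b, rfl⟩ : ∃ b, a' = b + 2 := ⟨a' - 2, by omega⟩
      refine (ih (2 * E'.sum + b) (by omega) (a' := b) (E' := E') (O' := (ν + 1) ::ₘ O')
        (by simp [hc]) ?_ hf rfl).trans (hdeg_odd_succ p e F b ν E' O' he)
      simp only [halvedDim, Multiset.sum_zero, Multiset.card_zero, Multiset.sum_cons,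
        Multiset.card_cons, hc]
      omega
    by_cases hL : ∃ L ∈ E', 1 ≤ L ∧ (∀ x ∈ E', x ≤ L) ∧
        ∀ k, L ≤ k → truncSum E k < E'.sum + (c + 1) * k
    · -- the longest even chain of the target may be shortened in favour of an odd chain
      obtain ⟨L, hL, hL1, hLmax, hlt⟩ := hL
      obtain ⟨E', rfl⟩ := Multiset.exists_cons_of_mem hL
      obtain ⟨L, rfl⟩ : ∃ L', L = L' + 1 := ⟨L - 1, by omega⟩
      rw [Multiset.sum_cons] at hn hlt
      refine (ih (2 * (L ::ₘ E').sum + a') ?_ (a' := a') (E' := L ::ₘ E') (O' := (ν + 1) ::ₘ O')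
        (by simp [hc]) ?_ (fun k => ?_) rfl).trans
        ((hdeg_odd_succ p e F a' ν _ O' he).trans (hdeg_even_succ p e F a' L E' _ he))
      · simp only [Multiset.sum_cons]
        omega
      · simp only [halvedDim, Multiset.sum_zero, Multiset.card_zero, Multiset.sum_cons,
          Multiset.card_cons, hc]
        omega
      · have h1 := hf k
        rw [truncSum_cons] at h1 ⊢
        rcases lt_or_ge k (L + 1) with h | h
        · rw [min_eq_right (by omega)] at h1 ⊢
          exact h1
        · have h2 := hlt k h
          have h3 := truncSum_eq_sum (E := E') (k := k) fun x hx =>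
            (hLmax x (Multiset.mem_cons_of_mem hx)).trans h
          rw [h3, min_eq_left (by omega)]
          omega
    -- beyond `ν + a'`, the dimension alone bounds the truncated sums
    have hbound : ∀ k, ν + a' < k → truncSum E k ≤ E'.sum + (ν + a') + c * k := by
      intro k hk
      obtain ⟨j, rfl⟩ : ∃ j, k = ν + a' + 1 + j := ⟨k - (ν + a' + 1), by omega⟩
      have h1 : O'.sum ≤ c * ν := by
        have := O'.sum_le_card_nsmul ν fun x hx => hνmax x (Multiset.mem_cons_of_mem hx)
        rwa [hc, smul_eq_mul] at this
      have h2 := truncSum_le_sum E (ν + a' + 1 + j)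
      have h3 : c * (ν + a' + 1 + j) = c * ν + c * a' + c + c * j := by ring
      omega
    -- a longest even part beyond `ν + a'` would have satisfied the strict inequalities `hL`
    have hmax : ∀ k, ν + a' < k → truncSum E' k = E'.sum := by
      intro k hk
      refine truncSum_eq_sum fun x hx => ?_
      obtain ⟨L, hL', hLmax⟩ := exists_max_mem (O := E') (by rintro rfl; simp at hx)
      rcases Nat.eq_zero_or_pos L with rfl | hL0
      · exact (hLmax x hx).trans (Nat.zero_le k)
      · push Not at hL
        obtain ⟨j, hj, hj'⟩ := hL L hL' hL0 hLmax
        have h1 : j ≤ ν + a' := by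
          by_contra hcon
          have h2 := hbound j (by omega)
          have h3 : (c + 1) * j = c * j + j := by ring
          omega
        exact (hLmax x hx).trans (by omega)
    have hf' : ∀ k, truncSum E k ≤ truncSum ((ν + a') ::ₘ E') k + c * k := by
      intro k
      rw [truncSum_cons]
      rcases le_or_gt k (ν + a') with h | h
      · have := hf k
        rw [min_eq_right h]
        linarith
      · rw [min_eq_left h.le, hmax k h]
        linarith [hbound k h]
    obtain rfl | rfl : a' = 0 ∨ a' = 1 := by omega
    · refine (ihc hc ?_ hf').trans (hdeg_even_odd p e F 0 ν E' O')
      simp only [halvedDim, Multiset.sum_zero, Multiset.card_zero, Multiset.sum_cons, hc]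
      omega
    · refine (ihc hc ?_ hf').trans (hdeg_even_succ_odd p e F 0 ν E' O')
      simp only [halvedDim, Multiset.sum_zero, Multiset.card_zero, Multiset.sum_cons, hc]
      omega

/-- The degenerations of standard forms, in terms of truncated sums. The smallest odd chain of the
source is shortened to an odd chain of the target, and both are removed. -/
theorem hdeg_of_le (he : 1 ≤ e) {a a' : ℕ} {E E' O O' : Multiset ℕ}
    (hn : halvedDim a E O = halvedDim a' E' O')
    (hO : ∀ m, Multiset.card (O.filter (· < m)) ≤ Multiset.card (O'.filter (· < m)))
    (hf : ∀ k, truncSum E k + k * Multiset.card O ≤ truncSum E' k + k * Multiset.card O') :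
    HDeg p e F a E O a' E' O' := by
  induction hc : Multiset.card O generalizing a O O' with
  | zero =>
    obtain rfl := Multiset.card_eq_zero.1 hc
    exact hdeg_of_source_even he _ rfl hn fun k => by simpa [mul_comm] using hf k
  | succ c ih =>
    obtain ⟨ν, hν, hmin⟩ := exists_min_mem (O := O) (by rintro rfl; simp at hc)
    obtain ⟨O, rfl⟩ := Multiset.exists_cons_of_mem hν
    obtain ⟨ν', hν', hle⟩ : ∃ ν' ∈ O', ν' ≤ ν := by
      have h1 := hO (ν + 1)
      rw [Multiset.filter_cons_of_pos (p := (· < ν + 1)) _ (Nat.lt_succ_self ν),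
        Multiset.card_cons] at h1
      obtain ⟨x, hx⟩ := Multiset.card_pos_iff_exists_mem.1 (lt_of_lt_of_le (Nat.succ_pos _) h1)
      rw [Multiset.mem_filter] at hx
      exact ⟨x, hx.1, Nat.lt_succ_iff.1 hx.2⟩
    obtain ⟨O', rfl⟩ := Multiset.exists_cons_of_mem hν'
    have hshrink : ∀ d b, HDeg p e F b E ((ν' + d) ::ₘ O) (b + 2 * d) E (ν' ::ₘ O) := by
      intro d
      induction d with
      | zero => exact fun b => HDeg.refl p e F _ _ _
      | succ d ih =>
        intro b
        refine (hdeg_odd_succ p e F b (ν' + d) E O he).trans ?_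
        convert ih (b + 2) using 1
        ring
    obtain ⟨d, rfl⟩ := Nat.exists_eq_add_of_le hle
    refine (hshrink d a).trans ?_
    have h := (ih (a := a + 2 * d) (O := O) (O' := O') ?_ (fun m => ?_) (fun k => ?_) ?_).add_right
      0 0 {ν'}
    · rw [add_comm O, add_comm O', Multiset.singleton_add, Multiset.singleton_add] at h
      simpa using h
    · simp only [halvedDim, Multiset.sum_cons, Multiset.card_cons] at hn ⊢
      omega
    · have h1 := hO m
      rcases lt_or_ge (ν' + d) m with h | h
      · rw [Multiset.filter_cons_of_pos (p := (· < m)) _ h,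
          Multiset.filter_cons_of_pos (p := (· < m)) _ (by omega), Multiset.card_cons,
          Multiset.card_cons] at h1
        omega
      · rw [Multiset.filter_eq_nil.2 fun x hx => not_lt.2
          (h.trans (hmin x (Multiset.mem_cons_of_mem hx)))]
        simp
    · have h1 := hf k
      simp only [Multiset.card_cons, mul_add] at h1
      omega
    · simpa using hc

end HalvedTypes

end QBicForm

/-! ### The numerical invariants -/

namespace QBicForm

section Counting

theorem exists_halves (s : Multiset ℕ) :
    ∃ E O : Multiset ℕ, E.map (fun l => 2 * l) + O.map (fun l => 2 * l + 1) = s := by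
  induction s using Multiset.induction_on with
  | empty => exact ⟨0, 0, rfl⟩
  | cons l s ih =>
    obtain ⟨E, O, rfl⟩ := ih
    obtain ⟨k, rfl | rfl⟩ := Nat.even_or_odd' l
    · exact ⟨k ::ₘ E, O, by simp⟩
    · exact ⟨E, k ::ₘ O, by simp⟩

theorem finsum_count (S : Multiset ℕ) (r : ℕ) :
    ∑ᶠ l ∈ Set.Ici r, (S.count l : ℤ) = Multiset.card (S.filter (r ≤ ·)) := by
  rw [finsum_mem_eq_sum_of_inter_support_eq (t := (S.filter (r ≤ ·)).toFinset)]
  · rw [← Multiset.toFinset_sum_count_eq, Nat.cast_sum]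
    refine Finset.sum_congr rfl fun l hl => ?_
    rw [Multiset.count_filter_of_pos]
    simp only [Multiset.mem_toFinset, Multiset.mem_filter] at hl
    exact hl.2
  · ext l
    simp
    tauto

/-- The truncated sum in terms of multiplicities. -/
theorem sum_mul_count_add (E : Multiset ℕ) {r : ℕ} (hr : 1 ≤ r) :
    ∑ l ∈ Finset.Icc 1 (r - 1), (l : ℤ) * E.count l + r * Multiset.card (E.filter (r ≤ ·)) =
      truncSum E r := by
  induction E using Multiset.induction_on with
  | empty => simp
  | cons x E ih =>
    simp only [Multiset.count_cons, Nat.cast_add, Nat.cast_ite, Nat.cast_one, Nat.cast_zero,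
      mul_add, Finset.sum_add_distrib, mul_ite, mul_one, mul_zero, Finset.sum_ite_eq',
      Finset.mem_Icc, truncSum_cons, ← ih]
    rcases lt_or_ge x r with h | h
    · rw [Multiset.filter_cons_of_neg (p := (r ≤ ·)) _ (by omega), min_eq_left h.le]
      rcases Nat.eq_zero_or_pos x with rfl | hx
      · simp
      · rw [if_pos (by omega)]
        ring
    · rw [Multiset.filter_cons_of_pos (p := (r ≤ ·)) _ h, min_eq_right h, if_neg (by omega)]
      push_cast [Multiset.card_cons]
      ring

theorem sum_count_eq_card_filter (O : Multiset ℕ) (m : ℕ) :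
    ∑ l ∈ Finset.Icc 1 m, (O.count (l - 1) : ℤ) = Multiset.card (O.filter (· < m)) := by
  induction m with
  | zero => simp
  | succ m ih =>
    rw [Finset.sum_Icc_succ_top (by omega), ih]
    have h : O.filter (· < m + 1) = O.filter (· < m) + O.filter (m = ·) := by
      ext x
      rw [Multiset.count_add, Multiset.count_filter, Multiset.count_filter,
        Multiset.count_filter]
      split_ifs <;> omega
    rw [h, Multiset.card_add, Nat.add_sub_cancel, Multiset.count_eq_card_filter_eq]
    push_cast
    rfl

end Counting

section InvariantInequalities

variable {q : ℕ} {k : Type*} [Field k] {V : Type*} [AddCommGroup V] [Module k V]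

theorem PhiEven_eq (β : QBicForm q k V) (r : ℕ) : β.PhiEven r = 2 * β.PsiEven r := by
  simp only [PhiEven, PsiEven, mul_add, Finset.mul_sum, mul_assoc]

theorem PhiOdd_eq (β : QBicForm q k V) (r : ℕ) :
    β.PhiOdd r = Module.finrank k V + β.PsiOdd r := by
  rw [PhiOdd, PsiOdd, add_assoc]

theorem Phi_le_iff_Psi_le (β β' : QBicForm q k V) (m : ℕ) :
    β.Phi m ≤ β'.Phi m ↔ β.Psi m ≤ β'.Psi m := by
  rw [Phi, Phi, Psi, Psi]
  split_ifs
  · rw [PhiEven_eq, PhiEven_eq]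
    omega
  · rw [PhiOdd_eq, PhiOdd_eq]
    omega

/-- The chains of even length `2 l` and of odd length `2 l + 1`, for `l` in `E` and `O`, are
those of a standard form with the invariants `b_m` of `β`. -/
def HasHalves (β : QBicForm q k V) (E O : Multiset ℕ) : Prop :=
  ∀ m, 1 ≤ m → β.bInv m =
    (E.map (fun l => 2 * l) + O.map fun l => 2 * l + 1).count m

variable {β : QBicForm q k V} {E O : Multiset ℕ}

theorem HasHalves.bInv_even (h : β.HasHalves E O) {l : ℕ} (hl : 1 ≤ l) :
    β.bInv (2 * l) = E.count l := by
  have h0 : (O.map fun l => 2 * l + 1).count (2 * l) = 0 := by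
    refine Multiset.count_eq_zero_of_notMem ?_
    simp only [Multiset.mem_map, not_exists, not_and]
    omega
  rw [h _ (by omega), Multiset.count_add, Multiset.count_map_eq_count' (fun l => 2 * l) E
    (fun x y hxy => by simpa using hxy), h0, add_zero]

theorem HasHalves.bInv_odd (h : β.HasHalves E O) {l : ℕ} (hl : 1 ≤ l) :
    β.bInv (2 * l - 1) = O.count (l - 1) := by
  obtain ⟨l, rfl⟩ : ∃ l', l = l' + 1 := ⟨l - 1, by omega⟩
  rw [h _ (by omega), show 2 * (l + 1) - 1 = 2 * l + 1 by omega, Multiset.count_add,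
    Multiset.count_map_eq_count' (fun l => 2 * l + 1) O (fun x y hxy => by simpa using hxy),
    Multiset.count_eq_zero_of_notMem, zero_add, Nat.add_sub_cancel]
  simp only [Multiset.mem_map, not_exists, not_and]
  omega

theorem HasHalves.Theta_eq (h : β.HasHalves E O) (m : ℕ) :
    β.Theta m = Multiset.card (O.filter (· < m)) := by
  rw [← sum_count_eq_card_filter, Theta]
  exact Finset.sum_congr rfl fun l hl => h.bInv_odd (Finset.mem_Icc.1 hl).1

theorem HasHalves.PsiEven_eq (h : β.HasHalves E O) {r : ℕ} (hr : 1 ≤ r) :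
    β.PsiEven r = truncSum E r + r * Multiset.card O := by
  have h1 : ∑ᶠ l ∈ Set.Ici 1, β.bInv (2 * l - 1) = Multiset.card O := by
    have h2 : ∀ l ∈ Set.Ici 1, β.bInv (2 * l - 1) = ((O.map (· + 1)).count l : ℤ) := by
      intro l hl
      rw [h.bInv_odd hl]
      obtain ⟨l, rfl⟩ : ∃ l', l = l' + 1 := ⟨l - 1, (Nat.sub_add_cancel hl).symm⟩
      rw [Multiset.count_map_eq_count' (· + 1) O (add_left_injective 1), Nat.add_sub_cancel]
    rw [finsum_mem_congr rfl h2, finsum_count, Multiset.filter_eq_self.2 (by simp),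
      Multiset.card_map]
  have h3 : ∑ᶠ l ∈ Set.Ici r, β.bInv (2 * l) = Multiset.card (E.filter (r ≤ ·)) := by
    rw [← finsum_count]
    exact finsum_mem_congr rfl fun l hl => h.bInv_even (hr.trans hl)
  have h4 : ∑ l ∈ Finset.Icc 1 (r - 1), (l : ℤ) * β.bInv (2 * l) =
      ∑ l ∈ Finset.Icc 1 (r - 1), (l : ℤ) * E.count l :=
    Finset.sum_congr rfl fun l hl => by rw [h.bInv_even (Finset.mem_Icc.1 hl).1]
  rw [PsiEven, h1, h3, h4, ← sum_mul_count_add E hr]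
  ring

end InvariantInequalities

section GeometricType

variable {p : ℕ} [Fact p.Prime] {e : ℕ} {k : Type u} [Field k] [CharP k p]
  {V : Type v} [AddCommGroup V] [Module k V] [FiniteDimensional k V]

theorem bInv_baseChange (L : Type*) [Field L] [Algebra k L] [CharP L p]
    (β : QBicForm (p ^ e) k V) {m : ℕ} (hm : 1 ≤ m) : (β.baseChange L).bInv m = β.bInv m := by
  obtain ⟨m, rfl⟩ : ∃ m', m = m' + 1 := ⟨m - 1, by omega⟩
  rw [bInv, bInv, aInv_succ_baseChange, aInv_succ_baseChange]

instance charP_algebraicClosure : CharP (AlgebraicClosure k) p :=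
  charP_of_injective_algebraMap (algebraMap k (AlgebraicClosure k)).injective p

/-- Over an algebraic closure, every form has a standard Gram matrix, whose chain lengths are
recorded by the invariants over the ground field. -/
theorem exists_halves_basis (he : 1 ≤ e) (β : QBicForm (p ^ e) k V) :
    ∃ (a : ℕ) (κ : Type) (_ : Fintype κ) (_ : DecidableEq κ) (ℓ : κ → ℕ)
      (b : Module.Basis (StIdx a ℓ) (AlgebraicClosure k) (AlgebraicClosure k ⊗[k] V))
      (E O : Multiset ℕ), (β.baseChange (AlgebraicClosure k)).gram b = St _ a ℓ ∧
      E.map (fun l => 2 * l) + O.map (fun l => 2 * l + 1) = Finset.univ.val.map ℓ ∧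
      β.HasHalves E O ∧ Module.finrank k V = halvedDim a E O := by
  obtain ⟨a, κ, _, _, ℓ, b, hb⟩ := hasStBasis he (β.baseChange (AlgebraicClosure k))
  obtain ⟨E, O, hEO⟩ := exists_halves (Finset.univ.val.map ℓ)
  refine ⟨a, κ, _, _, ℓ, b, E, O, hb, hEO, fun m hm => ?_, ?_⟩
  · rw [hEO, ← bInv_baseChange (AlgebraicClosure k) β hm, bInv_of_gram_eq_St hb hm]
  · rw [← Module.finrank_baseChange (R := AlgebraicClosure k), Module.finrank_eq_card_basis b]
    have h1 : ∑ c, ℓ c = (Finset.univ.val.map ℓ).sum := rfl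
    rw [Fintype.card_sum, Fintype.card_sigma]
    simp only [Fintype.card_fin]
    rw [h1, ← hEO, Multiset.sum_add, Multiset.sum_map_mul_left, Multiset.map_id',
      Multiset.sum_map_add, Multiset.sum_map_mul_left, Multiset.map_id', halvedDim]
    simp
    ring

/-- The inequalities between the invariants imply that `β` degenerates to `β'` over an algebraic
closure. -/
theorem deg_of_invariants_le (he : 1 ≤ e) {β β' : QBicForm (p ^ e) k V}
    (hPsi : ∀ m, 1 ≤ m → β.Psi m ≤ β'.Psi m) (hTheta : ∀ m, 1 ≤ m → β.Theta m ≤ β'.Theta m)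
    {ι : Type*} [Fintype ι] [DecidableEq ι]
    (b : Module.Basis ι (AlgebraicClosure k) (AlgebraicClosure k ⊗[k] V)) :
    Deg p e ((β.baseChange (AlgebraicClosure k)).gram b)
      ((β'.baseChange (AlgebraicClosure k)).gram b) := by
  obtain ⟨a, κ, _, _, ℓ, c, E, O, hc, hEO, h, hn⟩ := exists_halves_basis he β
  obtain ⟨a', κ', _, _, ℓ', c', E', O', hc', hEO', h', hn'⟩ := exists_halves_basis he β'
  have hdeg : HDeg p e (AlgebraicClosure k) a E O a' E' O' := by
    refine hdeg_of_le he (hn.symm.trans hn') (fun m => ?_) fun r => ?_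
    · rcases Nat.eq_zero_or_pos m with rfl | hm
      · simp
      · have h1 := hTheta m hm
        rw [h.Theta_eq, h'.Theta_eq] at h1
        exact_mod_cast h1
    · rcases Nat.eq_zero_or_pos r with rfl | hr
      · simp
      · have h1 := hPsi (2 * r) (by omega)
        rw [Psi, Psi, if_pos (even_two_mul r), if_pos (even_two_mul r),
          Nat.mul_div_cancel_left r two_pos, h.PsiEven_eq hr, h'.PsiEven_eq hr] at h1
        exact_mod_cast h1
  have h1 := TDeg.deg hdeg hEO.symm hEO'.symm
  rw [← hc, ← hc'] at h1
  exact Deg.congLeft (cong_gram_gram _ b c) (h1.trans (cong_gram_gram _ c' b).deg)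

end GeometricType

end QBicForm

/-! ### Specialization and orbit closure -/

namespace QBicForm

section Isomorphisms

variable {p : ℕ} [Fact p.Prime] {e : ℕ} {R : Type*} [CommRing R] [CharP R p]
  {M : Type*} [AddCommGroup M] [Module R M] {N : Type*} [AddCommGroup N] [Module R N]
  {ι ι' : Type*} [Fintype ι] [Fintype ι'] [DecidableEq ι] [DecidableEq ι']

theorem isomorphic_of_gram_eq {β : QBicForm (p ^ e) R M} {γ : QBicForm (p ^ e) R N}
    {b : Module.Basis ι R M} {c : Module.Basis ι R N} (h : β.gram b = γ.gram c) :
    Isomorphic β γ := by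
  have hbc : ∀ x y, γ.toFun x y = ∑ i, ∑ j, c.repr x i ^ p ^ e * (c.repr y j * γ.gram c i j) := by
    intro x y
    conv_lhs => rw [← c.sum_repr x, ← c.sum_repr y]
    rw [γ.sum_left]
    simp only [map_sum, γ.smul_left, map_smul, smul_eq_mul, Finset.mul_sum, gram_apply]
  have hb : ∀ x y, β.toFun x y = ∑ i, ∑ j, b.repr x i ^ p ^ e * (b.repr y j * β.gram b i j) := by
    intro x y
    conv_lhs => rw [← b.sum_repr x, ← b.sum_repr y]
    rw [β.sum_left]
    simp only [map_sum, β.smul_left, map_smul, smul_eq_mul, Finset.mul_sum, gram_apply]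
  refine ⟨b.equiv c (Equiv.refl ι), fun m n => ?_⟩
  rw [hbc, hb, h]
  simp [Module.Basis.equiv]

theorem isomorphic_of_cong {β : QBicForm (p ^ e) R M} {γ : QBicForm (p ^ e) R N}
    {b : Module.Basis ι R M} {c : Module.Basis ι' R N} (h : Cong p e (β.gram b) (γ.gram c)) :
    Isomorphic β γ := by
  obtain ⟨b', hb'⟩ := h.exists_basis
  exact isomorphic_of_gram_eq hb'

theorem gram_baseChange (S : Type*) [CommRing S] [Algebra R S] (β : QBicForm (p ^ e) R M)
    (b : Module.Basis ι R M) :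
    (β.baseChange S).gram (Algebra.TensorProduct.basis S b) =
      (β.gram b).map (algebraMap R S) := by
  ext i j
  simp [gram, baseChange_tmul]

theorem exists_gram_eq (b : Module.Basis ι R M) (B : Matrix ι ι R) :
    ∃ γ : QBicForm (p ^ e) R M, γ.gram b = B := by
  let β := ofMatrix (p := p) e B
  refine ⟨⟨fun m => β (b.equivFun m) ∘ₗ b.equivFun.toLinearMap, fun m n => ?_, fun c m => ?_⟩, ?_⟩
  · ext x
    simp [β.add_left]
  · ext x
    simp [β.smul_left]
  · conv_rhs => rw [← gram_ofMatrix (p := p) (e := e) B]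
    ext i j
    simp [gram, β, Pi.basisFun_apply, Finsupp.single_eq_pi_single]

end Isomorphisms

section Specialization

variable {p : ℕ} [Fact p.Prime] {e : ℕ} {k : Type u} [Field k] [CharP k p]
  {V : Type v} [AddCommGroup V] [Module k V] [FiniteDimensional k V]
  {F : Type u} [Field F] [CharP F p] [Algebra k F]

theorem const_algebraMap (x : k) :
    const F (algebraMap k F x) = algebraMap k (FractionRing (PowerSeries F)) x := by
  rw [IsScalarTower.algebraMap_apply k (PowerSeries F) (FractionRing (PowerSeries F)),
    PowerSeries.algebraMap_apply]
  rfl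

theorem map_const_map_algebraMap {m n : Type*} (B : Matrix m n k) :
    (B.map (algebraMap k F)).map (const F) =
      B.map (algebraMap k (FractionRing (PowerSeries F))) := by
  ext i j
  simp only [Matrix.map_apply, const_algebraMap]

/-- A degeneration over an extension `F` of `k` is a specialization over the discrete valuation
ring `F⟦X⟧`. -/
theorem specializesTo_of_deg {β β' : QBicForm (p ^ e) k V} {ι : Type} [Fintype ι] [DecidableEq ι]
    {b : Module.Basis ι k V}
    (h : Deg p e ((β.gram b).map (algebraMap k F)) ((β'.gram b).map (algebraMap k F))) :
    β.SpecializesTo β' := by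
  obtain ⟨T, hT, hcong⟩ := h
  rw [map_const_map_algebraMap] at hcong
  refine ⟨PowerSeries F, inferInstance, inferInstance, inferInstance, inferInstance,
    ι → PowerSeries F, inferInstance, inferInstance, inferInstance, inferInstance,
    ofMatrix e T, ?_, ?_⟩
  · refine isomorphic_of_cong (b := Algebra.TensorProduct.basis _ b)
      (c := Algebra.TensorProduct.basis _ (Pi.basisFun (PowerSeries F) ι)) ?_
    rw [gram_baseChange, gram_baseChange, gram_ofMatrix]
    exact hcong
  · have : CharP (IsLocalRing.ResidueField (PowerSeries F)) p := charP_of_injective_algebraMap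
      (algebraMap k (IsLocalRing.ResidueField (PowerSeries F))).injective p
    refine isomorphic_of_gram_eq (b := Algebra.TensorProduct.basis _ b)
      (c := Algebra.TensorProduct.basis _ (Pi.basisFun (PowerSeries F) ι)) ?_
    rw [gram_baseChange, gram_baseChange, gram_ofMatrix]
    ext i j
    have hij := congrFun (congrFun hT i) j
    rw [Matrix.map_apply, Matrix.map_apply] at hij
    rw [Matrix.map_apply, Matrix.map_apply,
      IsScalarTower.algebraMap_apply k (PowerSeries F), ← sub_eq_zero, ← map_sub]
    change IsLocalRing.residue _ _ = 0
    rw [IsLocalRing.residue_eq_zero_iff, IsLocalRing.mem_maximalIdeal, mem_nonunits_iff,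
      PowerSeries.isUnit_iff_constantCoeff, map_sub, hij, isUnit_iff_ne_zero, not_not, sub_eq_zero,
      PowerSeries.algebraMap_apply, PowerSeries.constantCoeff_C]

/-- The limit of a degeneration lies in the closure of the orbit. -/
theorem point_mem_closure_orbit_of_deg {β β' : QBicForm (p ^ e) k V} {ι : Type} [Fintype ι]
    [DecidableEq ι] {b : Module.Basis ι k V}
    (h : Deg p e ((β.gram b).map (algebraMap k F)) ((β'.gram b).map (algebraMap k F))) :
    point b (β'.baseChange k) ∈ closure (orbit b β) := by
  obtain ⟨T, hT, hcong⟩ := h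
  rw [map_const_map_algebraMap] at hcong
  rw [← PrimeSpectrum.zeroLocus_vanishingIdeal_eq_closure, PrimeSpectrum.mem_zeroLocus]
  intro f hf
  let L := FractionRing (PowerSeries F)
  obtain ⟨γ, hγ⟩ := exists_gram_eq (p := p) (e := e) (Algebra.TensorProduct.basis L b)
    (T.map (toFrac F))
  have hmem : point b γ ∈ orbit b β := by
    refine ⟨L, inferInstance, inferInstance, γ, isomorphic_of_cong
      (b := Algebra.TensorProduct.basis L b) (c := Algebra.TensorProduct.basis L b) ?_, rfl⟩
    rw [hγ, gram_baseChange]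
    exact hcong
  -- `f` vanishes at the generic point of the family, hence on the whole family and at its limit
  have h1 := (PrimeSpectrum.mem_vanishingIdeal _ _).1 hf _ hmem
  change MvPolynomial.aeval _ f = 0 at h1
  change MvPolynomial.aeval _ f = 0
  rw [hγ] at h1
  rw [gram_baseChange]
  have h2 : MvPolynomial.aeval (R := k) (fun ij : ι × ι => T ij.1 ij.2) f = 0 := by
    refine FaithfulSMul.algebraMap_injective (PowerSeries F) L ?_
    rw [← MvPolynomial.aeval_algebraMap_apply, map_zero]
    exact h1
  have h3 := congrArg (PowerSeries.constantCoeff (R := F)) h2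
  have h4 : (PowerSeries.constantCoeff (R := F)).comp (algebraMap k (PowerSeries F)) =
      algebraMap k F := by
    ext x
    simp [PowerSeries.algebraMap_apply]
  rw [MvPolynomial.map_aeval, map_zero, h4] at h3
  refine (algebraMap k F).injective ?_
  rw [← MvPolynomial.aeval_algebraMap_apply, map_zero, ← h3]
  change MvPolynomial.aeval _ f = MvPolynomial.aeval _ f
  congr 2
  ext ij
  exact (congrFun (congrFun hT ij.1) ij.2).symm

end Specialization

end QBicForm

theorem mainTheorem8 (p : ℕ) [Fact p.Prime] (e : ℕ) (he : 1 ≤ e)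
    {k : Type u} [Field k] [CharP k p] (hk : Nonempty (GaloisField p (2 * e) →+* k))
    {V : Type v} [AddCommGroup V] [Module k V] [FiniteDimensional k V]
    (β β' : QBicForm (p ^ e) k V) :
    ((∀ m : ℕ, 1 ≤ m → β.Phi m ≤ β'.Phi m) ↔ (∀ m : ℕ, 1 ≤ m → β.Psi m ≤ β'.Psi m)) ∧
    ((∀ m : ℕ, 1 ≤ m → β.Phi m ≤ β'.Phi m) → (∀ m : ℕ, 1 ≤ m → β.Theta m ≤ β'.Theta m) →
      β.SpecializesTo β' ∧
      ∀ b : Module.Basis (Fin (Module.finrank k V)) k V,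
        QBicForm.point b (β'.baseChange k) ∈ closure (QBicForm.orbit b β)) := by
  have hiff : (∀ m : ℕ, 1 ≤ m → β.Phi m ≤ β'.Phi m) ↔ (∀ m : ℕ, 1 ≤ m → β.Psi m ≤ β'.Psi m) :=
    forall₂_congr fun m _ => QBicForm.Phi_le_iff_Psi_le β β' m
  refine ⟨hiff, fun hPhi hTheta => ?_⟩
  have hdeg : ∀ b : Module.Basis (Fin (Module.finrank k V)) k V,
      QBicForm.Deg p e ((β.gram b).map (algebraMap k (AlgebraicClosure k)))
        ((β'.gram b).map (algebraMap k (AlgebraicClosure k))) := by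
    intro b
    rw [← QBicForm.gram_baseChange, ← QBicForm.gram_baseChange]
    exact QBicForm.deg_of_invariants_le he (hiff.1 hPhi) hTheta _
  exact ⟨QBicForm.specializesTo_of_deg (hdeg (Module.finBasis k V)),
    fun b => QBicForm.point_mem_closure_orbit_of_deg (hdeg b)⟩
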